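/- Let $M$ be a smooth Riemannian manifold, let $J\subset\mathbb R$ be an interval with more than one point and let $c\colon J\to M$ be a non-constant geodesic. Put $E_t=\dot c(t)^\perp\subset T_{c(t)}M$, fix $t_0\in J$, and write $'$ for the covariant derivative along $c$ and $R(X,Y)Z=\nabla_X\nabla_YZ-\nabla_Y\nabla_XZ-\nabla_{[X,Y]}Z$. Let $A_t\colon E_{t_0}\to E_t$, $t\in J$, be a Lagrange tensor along $c$. This means that for every $v\in E_{t_0}$ the field $A_tv$ is a smooth Jacobi field along $c$, i.e. $A''+R(A\,\cdot,\dot c)\dot c=0$; that $A$ is non-degenerate, i.e. $A_tv$ does not vanish identically if $v\neq 0$; that $A_t$ is invertible for at least one $t\in J$; and that $S_t=A_t'A_t^{-1}\colon E_t\to E_t$ is symmetric at all regular points, i.e. at all $t\in J$ for which $A_t$ is invertible. Let $p\ge 1$ and let $W\subset E_{t_0}$ be a $p$-dimensional subspace with orthonormal basis $e_1,\dots,e_p$. At regular points put $$g_W(t)=(\det M_t)^{-1/2p},\qquad (M_t)_{ij}=\langle (A_t^*)^{-1}e_i,(A_t^*)^{-1}e_j\rangle=\langle (A_t^*A_t)^{-1}e_i,e_j\rangle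 ,$$ and at the other points of $J$ (which are isolated) let $g_W(t)$ be the limit of the values of $g_W$ at nearby regular points. One says that $M$ has non-negative (resp. positive) $p$-sectional curvature if for all $x\in M$ and all non-zero $v\in T_xM$ the sum of the $p$ smallest eigenvalues, counted with multiplicity, of $R(\cdot,v)v$ on $v^\perp$ is non-negative (resp. positive). Then: (a) If $M$ has non-negative (resp. positive) $p$-sectional curvature, then $g_W$ is concave (resp. strictly concave) on any interval $K\subset J$ on which $g_W$ is positive. (b) For every $t^*\in J$, the function $g_W$ is smooth and positive at $t^*$ if and only if $W\perp\ker A_{t^*}$. If $t^*$ is an interior point of $J$, then $g_W$ is smooth at $t^*$ if and only if $W\perp\ker A_{t^*}$. (At an endpoint of $J$ smoothness is one-sided.) (c) If $M$ has non-negative $p$-sectional curvature and $g_W$ is constant on $J$, then for every $v\in W$ the field $(A_t^*)^{-1}v$, defined at the regular points, extends to a vector field along $c$ on all of $J$ that is parallel and a Jacobi field. -/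

import Mathlib

set_option maxSynthPendingDepth 3

noncomputable section

namespace VirtualJacobi

section Coordinates

variable {E : Type*} [NormedAddCommGroup E] [NormedSpace ℝ E]

/-- The Christoffel symbols of the first kind of a field `g` of bilinear forms on a vector space,
`(u, v) ↦ (w ↦ 1/2 (∂_u g(v, w) + ∂_v g(u, w) - ∂_w g(u, v)))`. -/
def christoffelLower (g : E → E →L[ℝ] E →L[ℝ] ℝ) (y : E) : E →L[ℝ] E →L[ℝ] E →L[ℝ] ℝ :=
  let dg : E →L[ℝ] E →L[ℝ] E →L[ℝ] ℝ := fderiv ℝ g y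
  (1 / 2 : ℝ) • (dg + dg.flip - (ContinuousLinearMap.flipₗᵢ ℝ E E ℝ :
    (E →L[ℝ] E →L[ℝ] ℝ) →L[ℝ] E →L[ℝ] E →L[ℝ] ℝ) ∘L dg.flip)

theorem christoffelLower_apply (g : E → E →L[ℝ] E →L[ℝ] ℝ) (y u v w : E) :
    christoffelLower g y u v w =
      1 / 2 * (fderiv ℝ g y u v w + fderiv ℝ g y v u w - fderiv ℝ g y w u v) := by
  simp [christoffelLower]

/-- The Christoffel symbols `Γ(u, v)` of `g`, obtained from those of the first kind by raising the
last index: `g(Γ(u, v), w) = 1/2 (∂_u g(v, w) + ∂_v g(u, w) - ∂_w g(u, v))`. -/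
def christoffel (g : E → E →L[ℝ] E →L[ℝ] ℝ) (y : E) : E →L[ℝ] E →L[ℝ] E :=
  (ContinuousLinearMap.compL ℝ E (E →L[ℝ] ℝ) E (g y).inverse) ∘L christoffelLower g y

theorem christoffel_apply (g : E → E →L[ℝ] E →L[ℝ] ℝ) (y u v : E) :
    christoffel g y u v = (g y).inverse (christoffelLower g y u v) := rfl

/-- The curvature tensor `R(u, v)w = ∇_u ∇_v w - ∇_v ∇_u w - ∇_[u,v] w` of `g` in coordinates:
`(∂_u Γ)(v, w) - (∂_v Γ)(u, w) + Γ(u, Γ(v, w)) - Γ(v, Γ(u, w))`. -/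
def coordCurvature (g : E → E →L[ℝ] E →L[ℝ] ℝ) (y u v w : E) : E :=
  let Γ := christoffel g y
  let dΓ := fderiv ℝ (christoffel g) y
  dΓ u v w - dΓ v u w + Γ u (Γ v w) - Γ v (Γ u w)

theorem coordCurvature_add_left (g : E → E →L[ℝ] E →L[ℝ] ℝ) (y u u' v w : E) :
    coordCurvature g y (u + u') v w = coordCurvature g y u v w + coordCurvature g y u' v w := by
  simp only [coordCurvature, map_add, add_apply]
  abel

theorem coordCurvature_smul_left (g : E → E →L[ℝ] E →L[ℝ] ℝ) (a : ℝ) (y u v w : E) :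
    coordCurvature g y (a • u) v w = a • coordCurvature g y u v w := by
  simp only [coordCurvature, map_smul, smul_apply, smul_add, smul_sub]

/-- The sum of the `p` smallest eigenvalues, counted with multiplicity, of an endomorphism. -/
def sumSmallestEigenvalues {V : Type*} [AddCommGroup V] [Module ℝ V] [FiniteDimensional ℝ V]
    (p : ℕ) (f : V →ₗ[ℝ] V) : ℝ :=
  ((f.charpoly.roots.sort (· ≤ ·)).take p).sum

end Coordinates

open Bundle Manifold Set Filter Topology
open scoped ContDiff InnerProductSpace

section Riemannian

variable {E : Type*} [NormedAddCommGroup E] [NormedSpace ℝ E] [FiniteDimensional ℝ E]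
  {M : Type*} [TopologicalSpace M] [ChartedSpace E M] [IsManifold 𝓘(ℝ, E) ∞ M]

instance instFiniteDimensionalTangentSpace (x : M) :
    FiniteDimensional ℝ (TangentSpace 𝓘(ℝ, E) x) :=
  inferInstanceAs (FiniteDimensional ℝ E)

/-- The coordinates of a tangent vector at `x` in the preferred chart at `x₀`. -/
def toCoord (x₀ x : M) : TangentSpace 𝓘(ℝ, E) x →L[ℝ] E :=
  (trivializationAt E (TangentSpace 𝓘(ℝ, E) : M → Type _) x₀).continuousLinearMapAt ℝ x

/-- The tangent vector at `x` with given coordinates in the preferred chart at `x₀`. -/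
def ofCoord (x₀ x : M) : E →L[ℝ] TangentSpace 𝓘(ℝ, E) x :=
  (trivializationAt E (TangentSpace 𝓘(ℝ, E) : M → Type _) x₀).symmL ℝ x

variable [RiemannianBundle (fun x : M ↦ TangentSpace 𝓘(ℝ, E) x)]

/-- The Riemannian metric read in the preferred chart at `x₀`. -/
def chartMetric (x₀ : M) (y : E) : E →L[ℝ] E →L[ℝ] ℝ :=
  let x : M := (extChartAt 𝓘(ℝ, E) x₀).symm y
  (innerSL ℝ (E := TangentSpace 𝓘(ℝ, E) x)).bilinearComp (ofCoord x₀ x) (ofCoord x₀ x)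

/-- The Riemannian curvature tensor `R(u, v)w` at `x`, computed in the preferred chart at `x`. -/
def curvature (x : M) (u v w : TangentSpace 𝓘(ℝ, E) x) : TangentSpace 𝓘(ℝ, E) x :=
  ofCoord x x (coordCurvature (chartMetric x) (extChartAt 𝓘(ℝ, E) x x)
    (toCoord x x u) (toCoord x x v) (toCoord x x w))

/-- The curvature endomorphism `R(·, v)v` of the orthogonal complement of `v`. -/
def curvatureEndomorphism (x : M) (v : TangentSpace 𝓘(ℝ, E) x) :
    (ℝ ∙ v)ᗮ →ₗ[ℝ] (ℝ ∙ v)ᗮ where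
  toFun w := (ℝ ∙ v)ᗮ.orthogonalProjectionOnto (curvature x (w : TangentSpace 𝓘(ℝ, E) x) v v)
  map_add' w w' := by
    simp only [curvature, Submodule.coe_add, map_add, coordCurvature_add_left]
  map_smul' a w := by
    simp only [curvature, Submodule.coe_smul, map_smul, coordCurvature_smul_left, RingHom.id_apply]

variable (E M) in
/-- Non-negative `p`-sectional curvature. -/
def NonnegPCurvature (p : ℕ) : Prop :=
  ∀ (x : M) (v : TangentSpace 𝓘(ℝ, E) x), v ≠ 0 →
    0 ≤ sumSmallestEigenvalues p (curvatureEndomorphism x v)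

variable (E M) in
/-- Positive `p`-sectional curvature. -/
def PosPCurvature (p : ℕ) : Prop :=
  ∀ (x : M) (v : TangentSpace 𝓘(ℝ, E) x), v ≠ 0 →
    0 < sumSmallestEigenvalues p (curvatureEndomorphism x v)

/-- The velocity field of a curve `c` defined on the interval `J`. -/
def velocity (c : ℝ → M) (J : Set ℝ) (t : ℝ) : TangentSpace 𝓘(ℝ, E) (c t) :=
  mfderivWithin 𝓘(ℝ, ℝ) 𝓘(ℝ, E) c J t (1 : ℝ)

/-- The covariant derivative, for the Levi-Civita connection, of a vector field `X` along the curve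
`c` defined on the interval `J`; in coordinates it is `X' + Γ(c', X)`. -/
def covDeriv (c : ℝ → M) (J : Set ℝ) (X : ∀ t, TangentSpace 𝓘(ℝ, E) (c t)) (t : ℝ) :
    TangentSpace 𝓘(ℝ, E) (c t) :=
  ofCoord (c t) (c t)
    (derivWithin (fun s ↦ toCoord (c t) (c s) (X s)) J t
      + christoffel (chartMetric (c t)) (extChartAt 𝓘(ℝ, E) (c t) (c t))
          (toCoord (c t) (c t) (velocity c J t)) (toCoord (c t) (c t) (X t)))

/-- Smoothness on `J` of a vector field along `c`. -/
def IsSmoothAlong (c : ℝ → M) (J : Set ℝ) (X : ∀ t, TangentSpace 𝓘(ℝ, E) (c t)) : Prop :=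
  ContMDiffOn 𝓘(ℝ, ℝ) 𝓘(ℝ, E).tangent ∞
    (fun t ↦ (⟨c t, X t⟩ : TangentBundle 𝓘(ℝ, E) M)) J

/-- `c` is a (non-constant) geodesic on the interval `J`. -/
structure IsGeodesicOn (c : ℝ → M) (J : Set ℝ) : Prop where
  smooth : ContMDiffOn 𝓘(ℝ, ℝ) 𝓘(ℝ, E) ∞ c J
  velocity_ne_zero : ∀ t ∈ J, velocity (E := E) c J t ≠ 0
  covDeriv_velocity : ∀ t ∈ J, covDeriv (E := E) c J (velocity c J) t = 0

/-- `X` is a parallel vector field along `c`. -/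
def IsParallelOn (c : ℝ → M) (J : Set ℝ) (X : ∀ t, TangentSpace 𝓘(ℝ, E) (c t)) : Prop :=
  IsSmoothAlong c J X ∧ ∀ t ∈ J, covDeriv c J X t = 0

/-- `X` is a Jacobi field along `c`: `X'' + R(X, c')c' = 0`. -/
def IsJacobiFieldOn (c : ℝ → M) (J : Set ℝ) (X : ∀ t, TangentSpace 𝓘(ℝ, E) (c t)) : Prop :=
  IsSmoothAlong c J X ∧ ∀ t ∈ J,
    covDeriv c J (covDeriv c J X) t
      + curvature (c t) (X t) (velocity c J t) (velocity c J t) = 0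

/-- The orthogonal complement `E_t` of the velocity in the tangent space at `c t`. -/
abbrev normalSpace (c : ℝ → M) (J : Set ℝ) (t : ℝ) : Submodule ℝ (TangentSpace 𝓘(ℝ, E) (c t)) :=
  (ℝ ∙ velocity c J t)ᗮ

/-- A Lagrange tensor `A_t : E_{t₀} → E_t` along `c`. -/
structure IsLagrangeTensor (c : ℝ → M) (J : Set ℝ) (t₀ : ℝ)
    (A : ∀ t, normalSpace (E := E) c J t₀ →L[ℝ] normalSpace (E := E) c J t) : Prop where
  /-- `A'' + RA = 0`. -/
  jacobi : ∀ v, IsJacobiFieldOn c J (fun t ↦ (A t v : TangentSpace 𝓘(ℝ, E) (c t)))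
  /-- `A` is non-degenerate. -/
  nondegenerate : ∀ v, v ≠ 0 → ∃ t ∈ J, A t v ≠ 0
  /-- `S = A' A⁻¹` is defined somewhere. -/
  exists_regular : ∃ t ∈ J, (A t).IsInvertible
  /-- `S = A' A⁻¹` is symmetric at regular points. -/
  symmetric : ∀ t ∈ J, (A t).IsInvertible → ∀ x y : normalSpace (E := E) c J t,
    ⟪covDeriv c J (fun s ↦ (A s ((A t).inverse x) : TangentSpace 𝓘(ℝ, E) (c s))) t,
        (y : TangentSpace 𝓘(ℝ, E) (c t))⟫_ℝ
      = ⟪(x : TangentSpace 𝓘(ℝ, E) (c t)),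
        covDeriv c J (fun s ↦ (A s ((A t).inverse y) : TangentSpace 𝓘(ℝ, E) (c s))) t⟫_ℝ

/-- The inverse `(A_t^*)⁻¹ : E_{t₀} → E_t` of the adjoint of `A_t` (for `A_t` invertible). -/
def adjointInv {c : ℝ → M} {J : Set ℝ} {t₀ : ℝ}
    (A : ∀ t, normalSpace (E := E) c J t₀ →L[ℝ] normalSpace (E := E) c J t) (t : ℝ) :
    normalSpace (E := E) c J t₀ →L[ℝ] normalSpace (E := E) c J t :=
  (ContinuousLinearMap.adjoint (A t)).inverse

/-- The matrix `M_t` of the `W`-block of `(A_t^* A_t)⁻¹` in an orthonormal basis of `W`. -/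
def blockMatrix {c : ℝ → M} {J : Set ℝ} {t₀ : ℝ}
    (A : ∀ t, normalSpace (E := E) c J t₀ →L[ℝ] normalSpace (E := E) c J t)
    {W : Submodule ℝ (normalSpace (E := E) c J t₀)} {p : ℕ} (e : OrthonormalBasis (Fin p) ℝ W)
    (t : ℝ) : Matrix (Fin p) (Fin p) ℝ :=
  Matrix.of fun i j ↦
    ⟪adjointInv A t (e i : normalSpace (E := E) c J t₀),
      adjointInv A t (e j : normalSpace (E := E) c J t₀)⟫_ℝ

open scoped Classical in
/-- The function `g_W`: it is `(det M_t)^(-1/2p)` at regular points, and at the (isolated) singular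
points it is given by the limit of these values. -/
def gW {c : ℝ → M} {J : Set ℝ} {t₀ : ℝ}
    (A : ∀ t, normalSpace (E := E) c J t₀ →L[ℝ] normalSpace (E := E) c J t)
    {W : Submodule ℝ (normalSpace (E := E) c J t₀)} {p : ℕ} (e : OrthonormalBasis (Fin p) ℝ W)
    (t : ℝ) : ℝ :=
  if (A t).IsInvertible then (blockMatrix A e t).det ^ (-(1 / (2 * (p : ℝ))))
  else limUnder (𝓝[J \ {t}] t) fun s ↦ (blockMatrix A e s).det ^ (-(1 / (2 * (p : ℝ))))

end Riemannian

end VirtualJacobi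

end

open Bundle Manifold Set VirtualJacobi
open scoped ContDiff

set_option linter.unusedSectionVars false

/-! The proof replaces the tensor `A` by its virtual Jacobi fields z = (A^*)⁻¹v. At regular points
they are characterised by ⟪z, A u⟫ = ⟪v, u⟫ for all u, and differentiating gives ⟪z', A u⟫ = -⟪z, A'
u⟫. If w is a second such field, some u has A u = w and A' u = -w' at the given point. Together with
A'' = -RA this yields ⟪z', w⟫ = ⟪z, w'⟫ and ⟪z'', w⟫ = 2⟪z', w'⟫ + ⟪R z, w⟫ (`inner_D_virt_symm`,
`inner_D_D_virt`).

Let M be the Gram matrix of the fields z_i of a basis of W and put N_ij = ⟪z_i', z_j⟫. Then M' = 2N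
and N' = Q with Q_ij = 3⟪z_i', z_j'⟫ + ⟪R z_i, z_j⟫. For g = (det M)^(-1/2p) this gives g''/g =
(1/p)(2 tr(M⁻¹NM⁻¹N) - tr(M⁻¹Q) + tr(M⁻¹N)²/p). In an orthonormal frame of the span of the z_i, the
inequalities of Bessel and Cauchy-Schwarz bound the bracket by minus the trace of R on that span
(`trace_inequality`). By Ky Fan's principle that trace is at least the sum of the p smallest
eigenvalues (`sumSmallestEigenvalues_le`). This is (a). If g is constant, equality forces z_i' = 0;
then ⟪z, A' u⟫ = 0, and one more derivative gives R z = 0, which is (c).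

Singular points are treated by desingularising `A` at t: it is kept on the complement of ker A_t and
divided by s - t on the kernel, with A' as value at s = t. Symmetry makes A'(ker A_t) orthogonal to
the image of A_t, and non-degeneracy makes A' injective on the kernel, so the new tensor is
invertible at t (`desing_self_injective`). Hence z extends smoothly when v ⟂ ker A_t
(`smooth_virt`). Otherwise z has a pole of order one, so det M tends to infinity and g to 0. Since
det M is at most of order |s - t|^(-2p), also g ≥ c|s - t|, so that g has a corner at an interior t
(`not_differentiableAt_gramRoot`). This is (b).

All of this takes place over an abstract `MetricConnection`. The part on Riemannian geometry shows
that the normal bundle of a geodesic is an instance: smoothness, metric compatibility, symmetry of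
the curvature, division by s - t, and uniqueness for Jacobi fields. -/

namespace VirtualJacobi

open Filter Topology
open scoped InnerProductSpace

/-! ### Christoffel symbols and curvature in coordinates -/

section Coordinates

theorem two_le_infty : (2 : WithTop ℕ∞) ≤ ∞ := ENat.LEInfty.out

variable {E : Type*} [NormedAddCommGroup E] [NormedSpace ℝ E] [FiniteDimensional ℝ E]
  {g g₀ g₁ : E → E →L[ℝ] E →L[ℝ] ℝ} {φ : E → E} {y : E}

theorem apply_christoffel (h : (g y).IsInvertible) (u v w : E) :
    g y (christoffel g y u v) w = christoffelLower g y u v w := by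
  rw [christoffel_apply, h.self_apply_inverse]

theorem contDiffAt_christoffelLower (hg : ContDiffAt ℝ ∞ g y) :
    ContDiffAt ℝ ∞ (christoffelLower g) y := by
  have h : ContDiffAt ℝ ∞ (fderiv ℝ g) y := hg.fderiv_right (by simp)
  have h' : ContDiffAt ℝ ∞ (fun z ↦ (fderiv ℝ g z).flip) y :=
    (ContinuousLinearMap.flipₗᵢ ℝ E E (E →L[ℝ] ℝ)).toContinuousLinearEquiv.contDiff.contDiffAt.comp
      y h
  exact ((h.add h').sub (contDiffAt_const.clm_comp h')).const_smul (1 / 2 : ℝ)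

theorem contDiffAt_christoffel (hg : ContDiffAt ℝ ∞ g y) (h : (g y).IsInvertible) :
    ContDiffAt ℝ ∞ (christoffel g) y := by
  have : CompleteSpace E := FiniteDimensional.complete ℝ E
  have hi : ContDiffAt ℝ ∞ (fun z ↦ (g z).inverse) y := h.contDiffAt_map_inverse.comp y hg
  exact ((ContinuousLinearMap.compL ℝ E (E →L[ℝ] ℝ) E).contDiff.contDiffAt.comp y hi).clm_comp
    (contDiffAt_christoffelLower hg)

theorem eventually_isInvertible (hg : ContinuousAt g y) (h : (g y).IsInvertible) :
    ∀ᶠ z in 𝓝 y, (g z).IsInvertible := by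
  have : CompleteSpace E := FiniteDimensional.complete ℝ E
  obtain ⟨e, he⟩ := h
  have := hg.eventually (by rw [← he]; exact e.nhds)
  filter_upwards [this] with z hz
  obtain ⟨e', he'⟩ := hz
  exact ⟨e', he'⟩

theorem fderiv_symm_of_eventually (hg : DifferentiableAt ℝ g y)
    (hs : ∀ᶠ z in 𝓝 y, ∀ v w, g z v w = g z w v) (u v w : E) :
    fderiv ℝ g y u v w = fderiv ℝ g y u w v := by
  have h1 : HasFDerivAt (fun z ↦ g z v w) _ y :=
    (hg.hasFDerivAt.clm_apply (hasFDerivAt_const v y)).clm_apply (hasFDerivAt_const w y)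
  have h2 : HasFDerivAt (fun z ↦ g z w v) _ y :=
    (hg.hasFDerivAt.clm_apply (hasFDerivAt_const w y)).clm_apply (hasFDerivAt_const v y)
  have h3 := h2.congr_of_eventuallyEq (hs.mono fun z hz ↦ hz v w)
  simpa using congr($(h1.unique h3) u)

theorem christoffel_symm (hg : DifferentiableAt ℝ g y)
    (hs : ∀ᶠ z in 𝓝 y, ∀ v w, g z v w = g z w v) (u v : E) :
    christoffel g y u v = christoffel g y v u := by
  rw [christoffel_apply, christoffel_apply]
  congr 1
  ext w
  rw [christoffelLower_apply, christoffelLower_apply, fderiv_symm_of_eventually hg hs w u v]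
  ring

/-- Compatibility of the Christoffel symbols with the metric. -/
theorem fderiv_eq_christoffel (hg : DifferentiableAt ℝ g y) (h : (g y).IsInvertible)
    (hs : ∀ᶠ z in 𝓝 y, ∀ v w, g z v w = g z w v) (u v w : E) :
    fderiv ℝ g y u v w = g y (christoffel g y u v) w + g y v (christoffel g y u w) := by
  rw [hs.self_of_nhds v, apply_christoffel h, apply_christoffel h, christoffelLower_apply,
    christoffelLower_apply, fderiv_symm_of_eventually hg hs v u w,
    fderiv_symm_of_eventually hg hs w u v, fderiv_symm_of_eventually hg hs u w v]
  ring

/-- The transformation law of the Christoffel symbols. -/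
theorem fderiv_apply_christoffel (hφ : ContDiffAt ℝ ∞ φ y)
    (hφi : (fderiv ℝ φ y).IsInvertible)
    (hg : ContDiffAt ℝ ∞ g₀ (φ y)) (hg₁ : DifferentiableAt ℝ g₁ y) (h₀ : (g₀ (φ y)).IsInvertible) (h₁ : (g₁ y).IsInvertible)
    (hs : ∀ᶠ z in 𝓝 (φ y), ∀ v w, g₀ z v w = g₀ z w v)
    (hgg : ∀ᶠ z in 𝓝 y, g₁ z = (g₀ (φ z)).bilinearComp (fderiv ℝ φ z) (fderiv ℝ φ z)) (u v : E) :
    fderiv ℝ φ y (christoffel g₁ y u v) =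
      fderiv ℝ (fderiv ℝ φ) y u v
        + christoffel g₀ (φ y) (fderiv ℝ φ y u) (fderiv ℝ φ y v) := by
  have hP : DifferentiableAt ℝ (fderiv ℝ φ) y :=
    (hφ.fderiv_right (m := ∞) (by simp)).differentiableAt (by simp)
  have hg' : DifferentiableAt ℝ g₀ (φ y) := hg.differentiableAt (by simp)
  have hφd : DifferentiableAt ℝ φ y := hφ.differentiableAt (by simp)
  have hsy := hs.self_of_nhds
  have hsym : ∀ a b, fderiv ℝ (fderiv ℝ φ) y a b = fderiv ℝ (fderiv ℝ φ) y b a := fun a b ↦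
    (hφ.isSymmSndFDerivAt (by simp [two_le_infty])).eq a b
  -- The pullback relation for the metrics, differentiated once. In the cyclic combination that
  -- defines the Christoffel symbols, all second derivatives of `φ` cancel except the two copies of
  -- the one in the directions u, v.
  have key : ∀ a b c, fderiv ℝ g₁ y a b c =
      fderiv ℝ g₀ (φ y) (fderiv ℝ φ y a) (fderiv ℝ φ y b) (fderiv ℝ φ y c)
        + g₀ (φ y) (fderiv ℝ (fderiv ℝ φ) y a b) (fderiv ℝ φ y c)
        + g₀ (φ y) (fderiv ℝ φ y b) (fderiv ℝ (fderiv ℝ φ) y a c) := by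
    intro a b c
    have hb : HasFDerivAt (fun z ↦ fderiv ℝ φ z b) _ y :=
      hP.hasFDerivAt.clm_apply (hasFDerivAt_const b y)
    have hc : HasFDerivAt (fun z ↦ fderiv ℝ φ z c) _ y :=
      hP.hasFDerivAt.clm_apply (hasFDerivAt_const c y)
    have h2 := ((hg'.hasFDerivAt.comp y hφd.hasFDerivAt).clm_apply hb).clm_apply hc
    have h1 := (hg₁.hasFDerivAt.clm_apply (hasFDerivAt_const b y)).clm_apply (hasFDerivAt_const c y)
    have h3 := h2.congr_of_eventuallyEq (f₁ := fun z ↦ g₁ z b c)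
      (hgg.mono fun z hz ↦ by simp [hz])
    have := congr($(h1.unique h3) a)
    simp at this
    rw [this]
    ring
  have hPs : Function.Surjective (fderiv ℝ φ y) := by
    obtain ⟨e, he⟩ := hφi
    rw [← he]; exact e.surjective
  obtain ⟨e, he⟩ := h₀
  apply e.injective
  have he' : ∀ x, e x = g₀ (φ y) x := fun x ↦ by rw [← he]; rfl
  ext w'
  obtain ⟨w, rfl⟩ := hPs w'
  have h4 : g₀ (φ y) (fderiv ℝ φ y (christoffel g₁ y u v)) (fderiv ℝ φ y w)
      = g₁ y (christoffel g₁ y u v) w := by simp [hgg.self_of_nhds]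
  rw [he', he', h4, apply_christoffel h₁, map_add, add_apply, apply_christoffel ⟨e, he⟩,
    christoffelLower_apply, christoffelLower_apply, key, key, key, hsym v u, hsym w u, hsym w v,
    hsy (fderiv ℝ φ y u), hsy (fderiv ℝ φ y v)]
  ring

/-- The curvature tensor does not depend on the coordinates. -/
theorem fderiv_coordCurvature (hφ : ContDiffAt ℝ ∞ φ y) (hΓ₀ : DifferentiableAt ℝ (christoffel g₀) (φ y))
    (hΓ₁ : DifferentiableAt ℝ (christoffel g₁) y)
    (hΓ : ∀ᶠ z in 𝓝 y, ∀ u v, fderiv ℝ φ z (christoffel g₁ z u v) =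
      fderiv ℝ (fderiv ℝ φ) z u v
        + christoffel g₀ (φ z) (fderiv ℝ φ z u) (fderiv ℝ φ z v)) (u v w : E) :
    fderiv ℝ φ y (coordCurvature g₁ y u v w) =
      coordCurvature g₀ (φ y) (fderiv ℝ φ y u) (fderiv ℝ φ y v) (fderiv ℝ φ y w) := by
  have hP : ContDiffAt ℝ ∞ (fderiv ℝ φ) y := hφ.fderiv_right (by simp)
  have hPd : DifferentiableAt ℝ (fderiv ℝ φ) y := hP.differentiableAt (by simp)
  have hP2 : DifferentiableAt ℝ (fderiv ℝ (fderiv ℝ φ)) y :=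
    (hP.fderiv_right (m := ∞) (by simp)).differentiableAt (by simp)
  have hφd : DifferentiableAt ℝ φ y := hφ.differentiableAt (by simp)
  have hsym : ∀ a b, fderiv ℝ (fderiv ℝ φ) y a b = fderiv ℝ (fderiv ℝ φ) y b a := fun a b ↦
    (hφ.isSymmSndFDerivAt (by simp [two_le_infty])).eq a b
  have hsym2 : ∀ a b, fderiv ℝ (fderiv ℝ (fderiv ℝ φ)) y a b
      = fderiv ℝ (fderiv ℝ (fderiv ℝ φ)) y b a := fun a b ↦
    (hP.isSymmSndFDerivAt (by simp [two_le_infty])).eq a b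
  have hy := hΓ.self_of_nhds
  -- The transformation law of the Christoffel symbols, differentiated once. After antisymmetrising
  -- in u and v the third derivatives of `φ` drop out, and the law itself removes the remaining
  -- second derivatives.
  have key : ∀ u v w, fderiv ℝ φ y (fderiv ℝ (christoffel g₁) y u v w)
      + fderiv ℝ (fderiv ℝ φ) y u (christoffel g₁ y v w)
      = fderiv ℝ (fderiv ℝ (fderiv ℝ φ)) y u v w
        + fderiv ℝ (christoffel g₀) (φ y) (fderiv ℝ φ y u) (fderiv ℝ φ y v) (fderiv ℝ φ y w)
        + christoffel g₀ (φ y) (fderiv ℝ (fderiv ℝ φ) y u v) (fderiv ℝ φ y w)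
        + christoffel g₀ (φ y) (fderiv ℝ φ y v) (fderiv ℝ (fderiv ℝ φ) y u w) := by
    intro u v w
    have hv : HasFDerivAt (fun z ↦ fderiv ℝ φ z v) _ y :=
      hPd.hasFDerivAt.clm_apply (hasFDerivAt_const v y)
    have hw : HasFDerivAt (fun z ↦ fderiv ℝ φ z w) _ y :=
      hPd.hasFDerivAt.clm_apply (hasFDerivAt_const w y)
    have h1 := hPd.hasFDerivAt.clm_apply ((hΓ₁.hasFDerivAt.clm_apply
      (hasFDerivAt_const v y)).clm_apply (hasFDerivAt_const w y))
    have h2 := ((hP2.hasFDerivAt.clm_apply (hasFDerivAt_const v y)).clm_apply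
      (hasFDerivAt_const w y)).add
        (((hΓ₀.hasFDerivAt.comp y hφd.hasFDerivAt).clm_apply hv).clm_apply hw)
    have h3 := h1.unique (h2.congr_of_eventuallyEq (hΓ.mono fun z hz ↦ hz v w))
    have := congr($h3 u)
    simp at this
    rw [this]
    abel
  have k1 := key u v w
  have k2 := key v u w
  rw [hsym2 v u, hsym v u] at k2
  have e1 := eq_sub_of_add_eq k1
  have e2 := eq_sub_of_add_eq k2
  simp only [coordCurvature, map_add, map_sub, hy, e1, e2]
  abel

/-- Differentiating g(Γ(a, b), w), which is a combination of first derivatives of g, expresses the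
derivative of Γ through second derivatives of g and products of Christoffel symbols; metric
compatibility absorbs the derivative of g that appears. The claim then follows from the symmetry of
the second derivatives of g in both pairs of slots and from that of Γ. -/
theorem apply_coordCurvature_symm (hg : ContDiffAt ℝ ∞ g y) (h : (g y).IsInvertible)
    (hs : ∀ᶠ z in 𝓝 y, ∀ v w, g z v w = g z w v) (u v w : E) :
    g y (coordCurvature g y u v v) w = g y (coordCurvature g y w v v) u := by
  have hgd : DifferentiableAt ℝ g y := hg.differentiableAt (by simp)
  have hg1 : ContDiffAt ℝ ∞ (fderiv ℝ g) y := hg.fderiv_right (by simp)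
  have hg1d : DifferentiableAt ℝ (fderiv ℝ g) y := hg1.differentiableAt (by simp)
  have hΓ : DifferentiableAt ℝ (christoffel g) y :=
    (contDiffAt_christoffel hg h).differentiableAt (by simp)
  have hsym : ∀ a b, fderiv ℝ (fderiv ℝ g) y a b = fderiv ℝ (fderiv ℝ g) y b a := fun a b ↦
    (hg.isSymmSndFDerivAt (by simp [two_le_infty])).eq a b
  have hd : ∀ a b (x : E), HasFDerivAt (fun z ↦ fderiv ℝ g z a b x)
      ((((ContinuousLinearMap.apply ℝ ℝ x) ∘L (ContinuousLinearMap.apply ℝ (E →L[ℝ] ℝ) b)) ∘L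
        (ContinuousLinearMap.apply ℝ (E →L[ℝ] E →L[ℝ] ℝ) a)) ∘L fderiv ℝ (fderiv ℝ g) y) y := by
    intro a b x
    exact ((((ContinuousLinearMap.apply ℝ ℝ x) ∘L (ContinuousLinearMap.apply ℝ (E →L[ℝ] ℝ) b)) ∘L
        (ContinuousLinearMap.apply ℝ (E →L[ℝ] E →L[ℝ] ℝ) a)).hasFDerivAt.comp y hg1d.hasFDerivAt)
  have hss : ∀ a b x z, fderiv ℝ (fderiv ℝ g) y a b x z = fderiv ℝ (fderiv ℝ g) y a b z x := by
    intro a b x z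
    have e : ∀ᶠ t in 𝓝 y, fderiv ℝ g t b x z = fderiv ℝ g t b z x := by
      have := (hg.of_le two_le_infty).eventually (by simp)
      filter_upwards [hs.eventually_nhds, this] with t ht ht2
      exact fderiv_symm_of_eventually (ht2.differentiableAt (by simp)) ht b x z
    simpa using congr($((hd b x z).unique ((hd b z x).congr_of_eventuallyEq e)) a)
  have key : ∀ u a b w, g y (fderiv ℝ (christoffel g) y u a b) w =
      1 / 2 * (fderiv ℝ (fderiv ℝ g) y u a b w + fderiv ℝ (fderiv ℝ g) y u b a w
        - fderiv ℝ (fderiv ℝ g) y u w a b)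
      - g y (christoffel g y u (christoffel g y a b)) w
      - g y (christoffel g y a b) (christoffel g y u w) := by
    intro u a b w
    have h1 := (hgd.hasFDerivAt.clm_apply ((hΓ.hasFDerivAt.clm_apply
      (hasFDerivAt_const a y)).clm_apply (hasFDerivAt_const b y))).clm_apply
        (hasFDerivAt_const w y)
    have h2 := (((hd a b w).add (hd b a w)).sub (hd w a b)).const_mul (1 / 2 : ℝ)
    have h3 := h1.unique (h2.congr_of_eventuallyEq
      ((eventually_isInvertible hg.continuousAt h).mono fun z hz ↦ by
        simp [apply_christoffel hz, christoffelLower_apply]))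
    have := congr($h3 u)
    simp [fderiv_eq_christoffel hgd h hs] at this
    linarith
  have hsy := hs.self_of_nhds
  have hΓs := christoffel_symm hgd hs
  simp only [coordCurvature, map_add, map_sub, add_apply, sub_apply, key]
  rw [hΓs w u, hsy (christoffel g y v v) (christoffel g y u w), hsym v u, hsym v w, hsym w u,
    hsy (christoffel g y u v), hss v v u w, hss u v v w, hss w v v u,
    hss v v w u, hΓs w v, hΓs v u]
  ring

theorem coordCurvature_self (u w : E) : coordCurvature g y u u w = 0 := by
  simp [coordCurvature]

theorem contDiffAt_coordCurvature {F : Type*} [NormedAddCommGroup F] [NormedSpace ℝ F] {s : Set F}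
    {x : F} {γ u v w : F → E} (hg : ContDiffAt ℝ ∞ g (γ x)) (h : (g (γ x)).IsInvertible)
    (hγ : ContDiffWithinAt ℝ ∞ γ s x) (hu : ContDiffWithinAt ℝ ∞ u s x)
    (hv : ContDiffWithinAt ℝ ∞ v s x) (hw : ContDiffWithinAt ℝ ∞ w s x) :
    ContDiffWithinAt ℝ ∞ (fun t ↦ coordCurvature g (γ t) (u t) (v t) (w t)) s x := by
  have hΓ := contDiffAt_christoffel hg h
  have hΓ' : ContDiffAt ℝ ∞ (fderiv ℝ (christoffel g)) (γ x) := hΓ.fderiv_right (by simp)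
  have h1 := hΓ.comp_contDiffWithinAt x hγ
  have h2 := hΓ'.comp_contDiffWithinAt x hγ
  exact (((((h2.clm_apply hu).clm_apply hv).clm_apply hw).sub
    (((h2.clm_apply hv).clm_apply hu).clm_apply hw)).add
    ((h1.clm_apply hu).clm_apply ((h1.clm_apply hv).clm_apply hw))).sub
    ((h1.clm_apply hv).clm_apply ((h1.clm_apply hu).clm_apply hw))

end Coordinates

/-! ### Independence of the chart for metric, connection and curvature -/

section Charts

variable {E : Type*} [NormedAddCommGroup E] [NormedSpace ℝ E] [FiniteDimensional ℝ E]
  {M : Type*} [TopologicalSpace M] [ChartedSpace E M] [IsManifold 𝓘(ℝ, E) ∞ M]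
  {x₀ x₁ x : M}

theorem extChartAt_symm_apply (hx : x ∈ (chartAt E x₀).source) :
    (extChartAt 𝓘(ℝ, E) x₀).symm (extChartAt 𝓘(ℝ, E) x₀ x) = x :=
  (extChartAt 𝓘(ℝ, E) x₀).left_inv (by simpa using hx)

theorem toCoord_ofCoord (hx : x ∈ (chartAt E x₀).source) (u : E) :
    toCoord x₀ x (ofCoord x₀ x u) = u :=
  (trivializationAt E (TangentSpace 𝓘(ℝ, E) : M → Type _) x₀).continuousLinearMapAt_symmL
    (by simpa using hx) u

theorem ofCoord_toCoord (hx : x ∈ (chartAt E x₀).source) (w : TangentSpace 𝓘(ℝ, E) x) :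
    ofCoord x₀ x (toCoord x₀ x w) = w :=
  (trivializationAt E (TangentSpace 𝓘(ℝ, E) : M → Type _) x₀).symmL_continuousLinearMapAt
    (by simpa using hx) w

theorem toCoord_eq_tangentCoordChange (hx : x ∈ (chartAt E x₀).source)
    (w : TangentSpace 𝓘(ℝ, E) x) :
    toCoord x₀ x w = tangentCoordChange 𝓘(ℝ, E) x x₀ x w := by
  unfold toCoord
  rw [TangentBundle.continuousLinearMapAt_trivializationAt_eq_core hx]
  rfl

/-- The change of coordinates from the chart at `x₁` to the chart at `x₀`. -/
noncomputable def transition (x₁ x₀ : M) : E → E :=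
  extChartAt 𝓘(ℝ, E) x₀ ∘ (extChartAt 𝓘(ℝ, E) x₁).symm

theorem fderiv_transition_toCoord (h₀ : x ∈ (chartAt E x₀).source)
    (h₁ : x ∈ (chartAt E x₁).source) (w : TangentSpace 𝓘(ℝ, E) x) :
    fderiv ℝ (transition x₁ x₀) (extChartAt 𝓘(ℝ, E) x₁ x) (toCoord x₁ x w) = toCoord x₀ x w := by
  rw [toCoord_eq_tangentCoordChange h₀, toCoord_eq_tangentCoordChange h₁]
  have := tangentCoordChange_comp (I := 𝓘(ℝ, E)) (w := x) (x := x₁) (y := x₀) (z := x) (v := w)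
    (by simp [h₀, h₁])
  rw [← this, tangentCoordChange_def (x := x₁)]
  simp [transition, fderivWithin_univ]

theorem transition_apply (h₁ : x ∈ (chartAt E x₁).source) :
    transition x₁ x₀ (extChartAt 𝓘(ℝ, E) x₁ x) = extChartAt 𝓘(ℝ, E) x₀ x := by
  simp [transition, h₁]

theorem contDiffAt_transition (h₀ : x ∈ (chartAt E x₀).source)
    (h₁ : x ∈ (chartAt E x₁).source) :
    ContDiffAt ℝ ∞ (transition x₁ x₀) (extChartAt 𝓘(ℝ, E) x₁ x) := by
  rw [← contDiffWithinAt_univ]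
  have := contDiffWithinAt_ext_coord_change (I := 𝓘(ℝ, E)) (n := ∞) x₀ x₁
    (y := extChartAt 𝓘(ℝ, E) x₁ x) (by simp [h₀, h₁])
  simpa [transition] using this

theorem isInvertible_fderiv_transition (h₀ : x ∈ (chartAt E x₀).source)
    (h₁ : x ∈ (chartAt E x₁).source) :
    (fderiv ℝ (transition x₁ x₀) (extChartAt 𝓘(ℝ, E) x₁ x)).IsInvertible := by
  refine ⟨ContinuousLinearEquiv.equivOfInverse
    (fderiv ℝ (transition x₁ x₀) (extChartAt 𝓘(ℝ, E) x₁ x))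
    (fderiv ℝ (transition x₀ x₁) (extChartAt 𝓘(ℝ, E) x₀ x)) ?_ ?_, rfl⟩
  · intro u
    obtain ⟨w, rfl⟩ : ∃ w, toCoord x₁ x w = u := ⟨_, toCoord_ofCoord h₁ u⟩
    rw [fderiv_transition_toCoord h₀ h₁, fderiv_transition_toCoord h₁ h₀]
  · intro u
    obtain ⟨w, rfl⟩ : ∃ w, toCoord x₀ x w = u := ⟨_, toCoord_ofCoord h₀ u⟩
    rw [fderiv_transition_toCoord h₁ h₀, fderiv_transition_toCoord h₀ h₁]

theorem eventually_symm_mem_source (h₀ : x ∈ (chartAt E x₀).source)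
    (h₁ : x ∈ (chartAt E x₁).source) :
    ∀ᶠ y in 𝓝 (extChartAt 𝓘(ℝ, E) x₁ x), y ∈ (extChartAt 𝓘(ℝ, E) x₁).target ∧
      (extChartAt 𝓘(ℝ, E) x₁).symm y ∈ (chartAt E x₀).source := by
  have hm : (extChartAt 𝓘(ℝ, E) x₁).target ∈ 𝓝 (extChartAt 𝓘(ℝ, E) x₁ x) :=
    (isOpen_extChartAt_target x₁).mem_nhds ((extChartAt 𝓘(ℝ, E) x₁).map_source (by simpa using h₁))
  refine Filter.Eventually.and hm ?_
  have := continuousAt_extChartAt_symm' (I := 𝓘(ℝ, E)) (x := x₁) (x' := x) (by simpa using h₁)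
  apply this.eventually
  rw [extChartAt_symm_apply h₁]
  exact (chartAt E x₀).open_source.mem_nhds h₀

variable [RiemannianBundle (fun x : M ↦ TangentSpace 𝓘(ℝ, E) x)]

theorem chartMetric_apply (x₀ : M) (y u v : E) :
    chartMetric x₀ y u v = ⟪ofCoord x₀ ((extChartAt 𝓘(ℝ, E) x₀).symm y) u,
      ofCoord x₀ ((extChartAt 𝓘(ℝ, E) x₀).symm y) v⟫_ℝ := rfl

theorem chartMetric_symm (x₀ : M) (y u v : E) :
    chartMetric x₀ y u v = chartMetric x₀ y v u := by
  rw [chartMetric_apply, chartMetric_apply, real_inner_comm]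

theorem chartMetric_toCoord (hx : x ∈ (chartAt E x₀).source) (u v : TangentSpace 𝓘(ℝ, E) x) :
    chartMetric x₀ (extChartAt 𝓘(ℝ, E) x₀ x) (toCoord x₀ x u) (toCoord x₀ x v) = ⟪u, v⟫_ℝ := by
  have aux : ∀ z : M, z = x → ⟪ofCoord x₀ z (toCoord x₀ x u), ofCoord x₀ z (toCoord x₀ x v)⟫_ℝ
      = ⟪u, v⟫_ℝ := by
    rintro z rfl
    rw [ofCoord_toCoord hx, ofCoord_toCoord hx]
  exact aux _ (extChartAt_symm_apply hx)

theorem isInvertible_chartMetric (hx : x ∈ (chartAt E x₀).source) :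
    (chartMetric x₀ (extChartAt 𝓘(ℝ, E) x₀ x)).IsInvertible := by
  have hinj : Function.Injective (chartMetric x₀ (extChartAt 𝓘(ℝ, E) x₀ x)) := by
    rw [injective_iff_map_eq_zero]
    intro u hu
    obtain ⟨w, rfl⟩ : ∃ w, toCoord x₀ x w = u := ⟨_, toCoord_ofCoord hx u⟩
    have := chartMetric_toCoord hx w w
    rw [hu] at this
    rw [inner_self_eq_zero.1 this.symm, map_zero]
  let e : E ≃ₗ[ℝ] (E →L[ℝ] ℝ) := LinearMap.linearEquivOfInjective
    (chartMetric x₀ (extChartAt 𝓘(ℝ, E) x₀ x)).toLinearMap hinj (by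
      rw [← (LinearMap.toContinuousLinearMap : (E →ₗ[ℝ] ℝ) ≃ₗ[ℝ] _).finrank_eq,
        Module.finrank_linearMap, Module.finrank_self, mul_one])
  exact ⟨e.toContinuousLinearEquiv, by ext; rfl⟩

theorem chartMetric_eq_bilinearComp (h₀ : x ∈ (chartAt E x₀).source)
    (h₁ : x ∈ (chartAt E x₁).source) :
    ∀ᶠ y in 𝓝 (extChartAt 𝓘(ℝ, E) x₁ x), chartMetric x₁ y =
      (chartMetric x₀ (transition x₁ x₀ y)).bilinearComp
        (fderiv ℝ (transition x₁ x₀) y) (fderiv ℝ (transition x₁ x₀) y) := by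
  filter_upwards [eventually_symm_mem_source h₀ h₁] with y hy
  obtain ⟨z, hz, rfl⟩ : ∃ z ∈ (chartAt E x₁).source, extChartAt 𝓘(ℝ, E) x₁ z = y :=
    ⟨(extChartAt 𝓘(ℝ, E) x₁).symm y, by simpa using (extChartAt 𝓘(ℝ, E) x₁).map_target hy.1,
      (extChartAt 𝓘(ℝ, E) x₁).right_inv hy.1⟩
  have hz0 := hy.2
  rw [extChartAt_symm_apply hz] at hz0
  ext u v
  obtain ⟨w, rfl⟩ : ∃ w, toCoord x₁ z w = u := ⟨_, toCoord_ofCoord hz u⟩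
  obtain ⟨w', rfl⟩ : ∃ w, toCoord x₁ z w = v := ⟨_, toCoord_ofCoord hz v⟩
  rw [ContinuousLinearMap.bilinearComp_apply, chartMetric_toCoord hz,
    fderiv_transition_toCoord hz0 hz, fderiv_transition_toCoord hz0 hz, transition_apply hz,
    chartMetric_toCoord hz0]

theorem contDiffAt_chartMetric
    [IsContMDiffRiemannianBundle 𝓘(ℝ, E) ∞ E (fun x : M ↦ TangentSpace 𝓘(ℝ, E) x)]
    (hx : x ∈ (chartAt E x₀).source) :
    ContDiffAt ℝ ∞ (chartMetric x₀) (extChartAt 𝓘(ℝ, E) x₀ x) := by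
  -- Vector fields with constant coordinates are smooth sections, so their inner products, the
  -- entries of the metric in the chart, are smooth functions.
  have hsec : ∀ u : E, ContMDiffOn 𝓘(ℝ, E) 𝓘(ℝ, E).tangent ∞ (fun y : E ↦
      (⟨(extChartAt 𝓘(ℝ, E) x₀).symm y, ofCoord x₀ ((extChartAt 𝓘(ℝ, E) x₀).symm y) u⟩ :
        TangentBundle 𝓘(ℝ, E) M)) (extChartAt 𝓘(ℝ, E) x₀).target := by
    intro u
    have h1 : ContMDiffOn 𝓘(ℝ, E) 𝓘(ℝ, E) ∞ (extChartAt 𝓘(ℝ, E) x₀).symm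
      (extChartAt 𝓘(ℝ, E) x₀).target := contMDiffOn_extChartAt_symm x₀
    have hm : ∀ y ∈ (extChartAt 𝓘(ℝ, E) x₀).target,
        (extChartAt 𝓘(ℝ, E) x₀).symm y ∈ (chartAt E x₀).source := fun y hy ↦ by
      simpa using (extChartAt 𝓘(ℝ, E) x₀).map_target hy
    refine ((trivializationAt E (TangentSpace 𝓘(ℝ, E) : M → Type _) x₀).contMDiffOn_iff
      (fun y hy ↦ ?_)).2 ⟨h1, ?_⟩
    · rw [Trivialization.mem_source]
      simpa using hm y hy
    · refine contMDiffOn_const (c := u) |>.congr fun y hy ↦ ?_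
      have := toCoord_ofCoord (hm y hy) u
      rw [toCoord, Trivialization.continuousLinearMapAt_apply,
        Trivialization.linearMapAt_apply, if_pos (by simpa using hm y hy)] at this
      exact this
  have hopen : IsOpen (extChartAt 𝓘(ℝ, E) x₀).target := isOpen_extChartAt_target x₀
  have hmem : extChartAt 𝓘(ℝ, E) x₀ x ∈ (extChartAt 𝓘(ℝ, E) x₀).target :=
    (extChartAt 𝓘(ℝ, E) x₀).map_source (by simpa using hx)
  refine ContDiffOn.contDiffAt ?_ (hopen.mem_nhds hmem)
  rw [contDiffOn_clm_apply]
  intro u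
  rw [contDiffOn_clm_apply]
  intro v
  rw [← contMDiffOn_iff_contDiffOn]
  exact ContMDiffOn.inner_bundle (E := (TangentSpace 𝓘(ℝ, E) : M → Type _)) (hsec u) (hsec v)

variable [IsContMDiffRiemannianBundle 𝓘(ℝ, E) ∞ E (fun x : M ↦ TangentSpace 𝓘(ℝ, E) x)]

theorem christoffel_transition (h₀ : x ∈ (chartAt E x₀).source)
    (h₁ : x ∈ (chartAt E x₁).source) (u v : E) :
    fderiv ℝ (transition x₁ x₀) (extChartAt 𝓘(ℝ, E) x₁ x)
        (christoffel (chartMetric x₁) (extChartAt 𝓘(ℝ, E) x₁ x) u v) =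
      fderiv ℝ (fderiv ℝ (transition x₁ x₀)) (extChartAt 𝓘(ℝ, E) x₁ x) u v
        + christoffel (chartMetric x₀) (extChartAt 𝓘(ℝ, E) x₀ x)
          (fderiv ℝ (transition x₁ x₀) (extChartAt 𝓘(ℝ, E) x₁ x) u)
          (fderiv ℝ (transition x₁ x₀) (extChartAt 𝓘(ℝ, E) x₁ x) v) := by
  have := fderiv_apply_christoffel (contDiffAt_transition h₀ h₁)
    (isInvertible_fderiv_transition h₀ h₁) (g₀ := chartMetric x₀) (g₁ := chartMetric x₁)
    (by rw [transition_apply h₁]; exact contDiffAt_chartMetric h₀)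
    ((contDiffAt_chartMetric h₁).differentiableAt (by simp))
    (by rw [transition_apply h₁]; exact isInvertible_chartMetric h₀)
    (isInvertible_chartMetric h₁) (.of_forall fun z ↦ chartMetric_symm x₀ z)
    (chartMetric_eq_bilinearComp h₀ h₁) u v
  rwa [transition_apply h₁] at this

/-- The curvature at x is defined in the preferred chart at x, which moves with x. Along a curve one
fixed chart is needed. The transformation law of Γ holds at all points near x, hence may be
differentiated there. -/
theorem toCoord_curvature (h₀ : x ∈ (chartAt E x₀).source) (u v w : TangentSpace 𝓘(ℝ, E) x) :
    toCoord x₀ x (curvature x u v w) = coordCurvature (chartMetric x₀) (extChartAt 𝓘(ℝ, E) x₀ x)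
      (toCoord x₀ x u) (toCoord x₀ x v) (toCoord x₀ x w) := by
  have hx : x ∈ (chartAt E x).source := mem_chart_source E x
  rw [← fderiv_transition_toCoord h₀ hx, curvature, toCoord_ofCoord hx,
    ← fderiv_transition_toCoord h₀ hx u, ← fderiv_transition_toCoord h₀ hx v,
    ← fderiv_transition_toCoord h₀ hx w, ← transition_apply (x₀ := x₀) hx]
  refine fderiv_coordCurvature (contDiffAt_transition h₀ hx) ?_ ?_ ?_ _ _ _
  · rw [transition_apply hx]
    exact (contDiffAt_christoffel (contDiffAt_chartMetric h₀)
      (isInvertible_chartMetric h₀)).differentiableAt (by simp)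
  · exact (contDiffAt_christoffel (contDiffAt_chartMetric hx)
      (isInvertible_chartMetric hx)).differentiableAt (by simp)
  · filter_upwards [eventually_symm_mem_source h₀ hx] with y hy u v
    obtain ⟨z, hz, rfl⟩ : ∃ z ∈ (chartAt E x).source, extChartAt 𝓘(ℝ, E) x z = y :=
      ⟨(extChartAt 𝓘(ℝ, E) x).symm y, by simpa using (extChartAt 𝓘(ℝ, E) x).map_target hy.1,
        (extChartAt 𝓘(ℝ, E) x).right_inv hy.1⟩
    have hz0 := hy.2
    rw [extChartAt_symm_apply hz] at hz0
    rw [christoffel_transition hz0 hz, transition_apply hz]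

theorem inner_curvature_symm (x : M) (u v w : TangentSpace 𝓘(ℝ, E) x) :
    ⟪curvature x u v v, w⟫_ℝ = ⟪curvature x w v v, u⟫_ℝ := by
  have hx : x ∈ (chartAt E x).source := mem_chart_source E x
  rw [← chartMetric_toCoord hx, ← chartMetric_toCoord hx, toCoord_curvature hx,
    toCoord_curvature hx]
  exact apply_coordCurvature_symm (contDiffAt_chartMetric hx) (isInvertible_chartMetric hx)
    (.of_forall fun z ↦ chartMetric_symm x z) _ _ _

theorem curvature_self (x : M) (u w : TangentSpace 𝓘(ℝ, E) x) : curvature x u u w = 0 := by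
  rw [curvature, coordCurvature_self, map_zero]

end Charts

/-! ### Covariant derivative along a curve -/

section AlongCurve

variable {E : Type*} [NormedAddCommGroup E] [NormedSpace ℝ E] [FiniteDimensional ℝ E]
  {M : Type*} [TopologicalSpace M] [ChartedSpace E M] [IsManifold 𝓘(ℝ, E) ∞ M]
  {x₀ : M} {c : ℝ → M} {J : Set ℝ} {t : ℝ} {X Y : ∀ t, TangentSpace 𝓘(ℝ, E) (c t)}

/-- Smoothness at `t`, within `J`, of a vector field along `c`. -/
def SmoothAlongAt (c : ℝ → M) (J : Set ℝ) (X : ∀ t, TangentSpace 𝓘(ℝ, E) (c t)) (t : ℝ) : Prop :=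
  ContMDiffWithinAt 𝓘(ℝ, ℝ) 𝓘(ℝ, E).tangent ∞
    (fun t ↦ (⟨c t, X t⟩ : TangentBundle 𝓘(ℝ, E) M)) J t

theorem hasDerivWithinAt_fderiv_apply {φ : E → E} {γ a : ℝ → E} {γ' a' : E}
    (hφ : ContDiffAt ℝ ∞ φ (γ t)) (hγ : HasDerivWithinAt γ γ' J t)
    (ha : HasDerivWithinAt a a' J t) :
    HasDerivWithinAt (fun s ↦ fderiv ℝ φ (γ s) (a s))
      (fderiv ℝ (fderiv ℝ φ) (γ t) γ' (a t) + fderiv ℝ φ (γ t) a') J t := by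
  have hP : HasFDerivAt (fderiv ℝ φ) (fderiv ℝ (fderiv ℝ φ) (γ t)) (γ t) :=
    ((hφ.fderiv_right (m := ∞) (by simp)).differentiableAt (by simp)).hasFDerivAt
  exact (hP.comp_hasDerivWithinAt t hγ).clm_apply ha

theorem eventually_mem_source (hc : ContMDiffWithinAt 𝓘(ℝ, ℝ) 𝓘(ℝ, E) ∞ c J t)
    (h₀ : c t ∈ (chartAt E x₀).source) : ∀ᶠ s in 𝓝[J] t, c s ∈ (chartAt E x₀).source :=
  hc.continuousWithinAt.eventually ((chartAt E x₀).open_source.mem_nhds h₀)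

theorem smoothAlongAt_iff (hc : ContMDiffWithinAt 𝓘(ℝ, ℝ) 𝓘(ℝ, E) ∞ c J t)
    (h₀ : c t ∈ (chartAt E x₀).source) :
    SmoothAlongAt c J X t ↔ ContDiffWithinAt ℝ ∞ (fun s ↦ toCoord x₀ (c s) (X s)) J t := by
  have hmem : (⟨c t, X t⟩ : TangentBundle 𝓘(ℝ, E) M) ∈
      (trivializationAt E (TangentSpace 𝓘(ℝ, E) : M → Type _) x₀).source := by
    rw [Trivialization.mem_source]
    simpa using h₀
  have heq : ∀ s, c s ∈ (chartAt E x₀).source → toCoord x₀ (c s) (X s) =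
      ((trivializationAt E (TangentSpace 𝓘(ℝ, E) : M → Type _) x₀) ⟨c s, X s⟩).2 := by
    intro s hs
    rw [toCoord, Trivialization.continuousLinearMapAt_apply,
        Trivialization.linearMapAt_apply, if_pos (by simpa using hs)]
  have key := (trivializationAt E (TangentSpace 𝓘(ℝ, E) : M → Type _) x₀).contMDiffWithinAt_iff
    (IM := 𝓘(ℝ, ℝ)) (IB := 𝓘(ℝ, E)) (n := ∞) (s := J)
    (f := fun s ↦ (⟨c s, X s⟩ : TangentBundle 𝓘(ℝ, E) M)) hmem
  rw [contMDiffWithinAt_iff_contDiffWithinAt] at key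
  refine key.trans ((and_iff_right hc).trans ?_)
  have hev : (fun s ↦ toCoord x₀ (c s) (X s)) =ᶠ[𝓝[J] t] fun s ↦
      ((trivializationAt E (TangentSpace 𝓘(ℝ, E) : M → Type _) x₀) ⟨c s, X s⟩).2 := by
    filter_upwards [eventually_mem_source hc h₀] with s hs using heq s hs
  exact ⟨fun h ↦ h.congr_of_eventuallyEq hev (heq t h₀),
    fun h ↦ h.congr_of_eventuallyEq hev.symm (heq t h₀).symm⟩

theorem hasDerivWithinAt_extChartAt (hc : ContMDiffWithinAt 𝓘(ℝ, ℝ) 𝓘(ℝ, E) ∞ c J t)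
    (h₀ : c t ∈ (chartAt E x₀).source) :
    HasDerivWithinAt (fun s ↦ extChartAt 𝓘(ℝ, E) x₀ (c s)) (toCoord x₀ (c t) (velocity c J t))
      J t := by
  have h1 : MDifferentiableWithinAt 𝓘(ℝ, ℝ) 𝓘(ℝ, E) c J t :=
    hc.mdifferentiableWithinAt (by simp)
  have h2 : MDifferentiableAt 𝓘(ℝ, E) 𝓘(ℝ, E) (extChartAt 𝓘(ℝ, E) x₀) (c t) :=
    mdifferentiableAt_extChartAt h₀
  have h3 := h2.hasMFDerivAt.comp_hasMFDerivWithinAt t h1.hasMFDerivWithinAt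
  obtain ⟨L, hL, hL1⟩ : ∃ L : ℝ →L[ℝ] E,
      HasFDerivWithinAt (fun s ↦ extChartAt 𝓘(ℝ, E) x₀ (c s)) L J t ∧
      L 1 = mfderiv 𝓘(ℝ, E) 𝓘(ℝ, E) (extChartAt 𝓘(ℝ, E) x₀) (c t) (velocity c J t) :=
    ⟨_, h3.hasFDerivWithinAt, rfl⟩
  have h5 : toCoord x₀ (c t) (velocity (E := E) c J t) =
      mfderiv 𝓘(ℝ, E) 𝓘(ℝ, E) (extChartAt 𝓘(ℝ, E) x₀) (c t) (velocity c J t) := by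
    unfold toCoord
    rw [TangentBundle.continuousLinearMapAt_trivializationAt h₀]
    rfl
  rw [h5, ← hL1]
  exact hL.hasDerivWithinAt

theorem contDiffWithinAt_extChartAt_comp (hc : ContMDiffWithinAt 𝓘(ℝ, ℝ) 𝓘(ℝ, E) ∞ c J t)
    (h₀ : c t ∈ (chartAt E x₀).source) :
    ContDiffWithinAt ℝ ∞ (fun s ↦ extChartAt 𝓘(ℝ, E) x₀ (c s)) J t := by
  rw [← contMDiffWithinAt_iff_contDiffWithinAt]
  exact (contMDiffAt_extChartAt' (I := 𝓘(ℝ, E)) (n := ∞) h₀).comp_contMDiffWithinAt t hc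

theorem SmoothAlongAt.differentiableWithinAt (hX : SmoothAlongAt c J X t)
    (hc : ContMDiffWithinAt 𝓘(ℝ, ℝ) 𝓘(ℝ, E) ∞ c J t) (h₀ : c t ∈ (chartAt E x₀).source) :
    DifferentiableWithinAt ℝ (fun s ↦ toCoord x₀ (c s) (X s)) J t :=
  ((smoothAlongAt_iff hc h₀).1 hX).differentiableWithinAt (by simp)

theorem smoothAlongAt_velocity (hc : ContMDiffOn 𝓘(ℝ, ℝ) 𝓘(ℝ, E) ∞ c J) (hJ : UniqueDiffOn ℝ J)
    (ht : t ∈ J) : SmoothAlongAt (E := E) c J (velocity c J) t := by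
  have h₀ := mem_chart_source E (c t)
  rw [smoothAlongAt_iff (hc t ht) h₀]
  have := (contDiffWithinAt_extChartAt_comp (hc t ht) h₀).derivWithin hJ (m := ∞) (by simp) ht
  refine this.congr_of_eventuallyEq ?_ ?_
  · filter_upwards [eventually_mem_source (hc t ht) h₀, self_mem_nhdsWithin] with s hs hsJ
    exact ((hasDerivWithinAt_extChartAt (hc s hsJ) hs).derivWithin (hJ s hsJ)).symm
  · exact ((hasDerivWithinAt_extChartAt (hc t ht) h₀).derivWithin (hJ t ht)).symm

variable [RiemannianBundle (fun x : M ↦ TangentSpace 𝓘(ℝ, E) x)]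
  [IsContMDiffRiemannianBundle 𝓘(ℝ, E) ∞ E (fun x : M ↦ TangentSpace 𝓘(ℝ, E) x)]

/-- The product rule for the transformed coordinates produces a second derivative of the transition
map, which cancels the one in the transformation law of Γ. Only differentiability is assumed,
because at points near a point of smoothness nothing stronger is used (see
`SmoothAlongAt.covDeriv`). -/
theorem toCoord_covDeriv_of_differentiable (hc : ContMDiffWithinAt 𝓘(ℝ, ℝ) 𝓘(ℝ, E) ∞ c J t)
    (hJ : UniqueDiffWithinAt ℝ J t) (h₀ : c t ∈ (chartAt E x₀).source)
    (hX : DifferentiableWithinAt ℝ (fun s ↦ toCoord (c t) (c s) (X s)) J t) :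
    toCoord x₀ (c t) (covDeriv c J X t) = derivWithin (fun s ↦ toCoord x₀ (c s) (X s)) J t
      + christoffel (chartMetric x₀) (extChartAt 𝓘(ℝ, E) x₀ (c t))
          (toCoord x₀ (c t) (velocity c J t)) (toCoord x₀ (c t) (X t)) := by
  have h₁ := mem_chart_source E (c t)
  have hd := hasDerivWithinAt_fderiv_apply (φ := transition (c t) x₀)
    (γ := fun s ↦ extChartAt 𝓘(ℝ, E) (c t) (c s)) (contDiffAt_transition h₀ h₁)
    (hasDerivWithinAt_extChartAt hc h₁) hX.hasDerivWithinAt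
  have hd' := hd.congr_of_eventuallyEq (f₁ := fun s ↦ toCoord x₀ (c s) (X s)) (by
      filter_upwards [eventually_mem_source hc h₀, eventually_mem_source hc h₁] with s hs hs'
      exact (fderiv_transition_toCoord hs hs' (X s)).symm)
      (fderiv_transition_toCoord h₀ h₁ (X t)).symm
  rw [hd'.derivWithin hJ, ← fderiv_transition_toCoord h₀ h₁ (covDeriv c J X t), covDeriv,
    toCoord_ofCoord h₁, map_add, christoffel_transition h₀ h₁, fderiv_transition_toCoord h₀ h₁,
    fderiv_transition_toCoord h₀ h₁]
  abel

theorem toCoord_covDeriv (hX : SmoothAlongAt c J X t)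
    (hc : ContMDiffWithinAt 𝓘(ℝ, ℝ) 𝓘(ℝ, E) ∞ c J t)
    (hJ : UniqueDiffWithinAt ℝ J t) (h₀ : c t ∈ (chartAt E x₀).source) :
    toCoord x₀ (c t) (covDeriv c J X t) = derivWithin (fun s ↦ toCoord x₀ (c s) (X s)) J t
      + christoffel (chartMetric x₀) (extChartAt 𝓘(ℝ, E) x₀ (c t))
          (toCoord x₀ (c t) (velocity c J t)) (toCoord x₀ (c t) (X t)) :=
  toCoord_covDeriv_of_differentiable hc hJ h₀
    (hX.differentiableWithinAt hc (mem_chart_source E (c t)))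

theorem hasDerivWithinAt_inner (hX : SmoothAlongAt c J X t) (hY : SmoothAlongAt c J Y t)
    (hc : ContMDiffWithinAt 𝓘(ℝ, ℝ) 𝓘(ℝ, E) ∞ c J t) (hJ : UniqueDiffWithinAt ℝ J t) :
    HasDerivWithinAt (fun s ↦ ⟪X s, Y s⟫_ℝ)
      (⟪covDeriv c J X t, Y t⟫_ℝ + ⟪X t, covDeriv c J Y t⟫_ℝ) J t := by
  have h₀ := mem_chart_source E (c t)
  have hg := contDiffAt_chartMetric (x₀ := c t) h₀
  have hgd : DifferentiableAt ℝ (chartMetric (c t)) (extChartAt 𝓘(ℝ, E) (c t) (c t)) :=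
    hg.differentiableAt (by simp)
  have hx := (hX.differentiableWithinAt hc h₀).hasDerivWithinAt
  have hy := (hY.differentiableWithinAt hc h₀).hasDerivWithinAt
  have hG := hgd.hasFDerivAt.comp_hasDerivWithinAt t (hasDerivWithinAt_extChartAt hc h₀)
  have h := (hG.clm_apply hx).clm_apply hy
  have h' : HasDerivWithinAt (fun s ↦ ⟪X s, Y s⟫_ℝ) _ J t := h.congr_of_eventuallyEq (by
      filter_upwards [eventually_mem_source hc h₀] with s hs
      exact (chartMetric_toCoord hs (X s) (Y s)).symm) (chartMetric_toCoord h₀ (X t) (Y t)).symm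
  convert h' using 1
  rw [← chartMetric_toCoord h₀, ← chartMetric_toCoord h₀, toCoord_covDeriv hX hc hJ h₀,
    toCoord_covDeriv hY hc hJ h₀]
  simp only [map_add, add_apply, Function.comp]
  rw [fderiv_eq_christoffel hgd (isInvertible_chartMetric h₀)
    (.of_forall fun z ↦ chartMetric_symm (c t) z)]
  ring

theorem SmoothAlongAt.inner (hX : SmoothAlongAt c J X t) (hY : SmoothAlongAt c J Y t) :
    ContDiffWithinAt ℝ ∞ (fun s ↦ ⟪X s, Y s⟫_ℝ) J t := by
  rw [← contMDiffWithinAt_iff_contDiffWithinAt]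
  exact ContMDiffWithinAt.inner_bundle (E := (TangentSpace 𝓘(ℝ, E) : M → Type _)) hX hY

/-- Smoothness of infinite order at a point does not pass to a neighbourhood, but each finite order
does; order one suffices. The chart used at s is the one at `c s`, hence the change of coordinates.
-/
theorem SmoothAlongAt.eventually_differentiable (hX : SmoothAlongAt c J X t)
    (hc : ContMDiffOn 𝓘(ℝ, ℝ) 𝓘(ℝ, E) ∞ c J) (ht : t ∈ J) :
    ∀ᶠ s in 𝓝[J] t, DifferentiableWithinAt ℝ (fun r ↦ toCoord (c s) (c r) (X r)) J s := by
  have h₀ := mem_chart_source E (c t)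
  have h1 := ((smoothAlongAt_iff (hc t ht) h₀).1 hX).of_le (m := 1) (by simp)
  have h2 := h1.eventually (by simp)
  rw [insert_eq_of_mem ht] at h2
  filter_upwards [h2, eventually_mem_source (hc t ht) h₀, self_mem_nhdsWithin] with s hs hs' hsJ
  have h₁ := mem_chart_source E (c s)
  have hP : DifferentiableAt ℝ (fderiv ℝ (transition (c t) (c s)))
      (extChartAt 𝓘(ℝ, E) (c t) (c s)) :=
    (((contDiffAt_transition h₁ hs').fderiv_right (m := ∞) (by simp)).differentiableAt (by simp))
  have h3 := (hP.comp_differentiableWithinAt s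
    (hasDerivWithinAt_extChartAt (hc s hsJ) hs').differentiableWithinAt).clm_apply
      (hs.differentiableWithinAt (by simp))
  refine h3.congr_of_eventuallyEq ?_ (fderiv_transition_toCoord h₁ hs' (X s)).symm
  filter_upwards [eventually_mem_source (hc s hsJ) h₁, eventually_mem_source (hc s hsJ) hs'] with
    r hr hr' using (fderiv_transition_toCoord hr hr' (X r)).symm

theorem SmoothAlongAt.covDeriv (hX : SmoothAlongAt c J X t)
    (hc : ContMDiffOn 𝓘(ℝ, ℝ) 𝓘(ℝ, E) ∞ c J) (hJ : UniqueDiffOn ℝ J) (ht : t ∈ J) :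
    SmoothAlongAt c J (covDeriv c J X) t := by
  have h₀ := mem_chart_source E (c t)
  rw [smoothAlongAt_iff (hc t ht) h₀]
  have hx := (smoothAlongAt_iff (hc t ht) h₀).1 hX
  have hv := (smoothAlongAt_iff (hc t ht) h₀).1 (smoothAlongAt_velocity hc hJ ht)
  have hΓ := (contDiffAt_christoffel (contDiffAt_chartMetric h₀)
    (isInvertible_chartMetric h₀)).comp_contDiffWithinAt t
      (contDiffWithinAt_extChartAt_comp (hc t ht) h₀)
  have := (hx.derivWithin hJ (m := ∞) (by simp) ht).add ((hΓ.clm_apply hv).clm_apply hx)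
  refine this.congr_of_eventuallyEq ?_ (toCoord_covDeriv hX (hc t ht) (hJ t ht) h₀)
  filter_upwards [eventually_mem_source (hc t ht) h₀, self_mem_nhdsWithin,
    hX.eventually_differentiable hc ht] with s hs hsJ hsd
  exact toCoord_covDeriv_of_differentiable (hc s hsJ) (hJ s hsJ) hs hsd

theorem SmoothAlongAt.curvature (hX : SmoothAlongAt c J X t)
    (hc : ContMDiffOn 𝓘(ℝ, ℝ) 𝓘(ℝ, E) ∞ c J) (hJ : UniqueDiffOn ℝ J) (ht : t ∈ J) :
    SmoothAlongAt c J (fun s ↦ curvature (c s) (X s) (velocity c J s) (velocity c J s)) t := by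
  have h₀ := mem_chart_source E (c t)
  rw [smoothAlongAt_iff (hc t ht) h₀]
  have hx := (smoothAlongAt_iff (hc t ht) h₀).1 hX
  have hv := (smoothAlongAt_iff (hc t ht) h₀).1 (smoothAlongAt_velocity hc hJ ht)
  refine (contDiffAt_coordCurvature (γ := fun s ↦ extChartAt 𝓘(ℝ, E) (c t) (c s))
    (contDiffAt_chartMetric h₀) (isInvertible_chartMetric h₀)
    (contDiffWithinAt_extChartAt_comp (hc t ht) h₀) hx hv hv).congr_of_eventuallyEq ?_
    (toCoord_curvature h₀ _ _ _)
  filter_upwards [eventually_mem_source (hc t ht) h₀] with s hs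
  exact toCoord_curvature hs _ _ _

end AlongCurve

/-! ### Smooth division by `s - t`, also at an endpoint -/

section Division

variable {E : Type*} [NormedAddCommGroup E] [NormedSpace ℝ E] {I : Set ℝ} {t : ℝ}

theorem norm_le_of_norm_deriv_le_pow {G G' : ℝ → E} (hI : Convex ℝ I) (ht : t ∈ I)
    (hG : ∀ s ∈ I, HasDerivWithinAt G (G' s) I s) (h0 : G t = 0) {ε : ℝ} (m : ℕ) {s : ℝ}
    (hs : s ∈ I) (hε : 0 ≤ ε) (hb : ∀ r ∈ segment ℝ t s, ‖G' r‖ ≤ ε * |r - t| ^ m) :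
    ‖G s‖ ≤ ε * |s - t| ^ (m + 1) := by
  have hsub : segment ℝ t s ⊆ I := hI.segment_subset ht hs
  have := (convex_segment t s).norm_image_sub_le_of_norm_hasDerivWithin_le (f := G) (f' := G')
    (C := ε * |s - t| ^ m) (fun r hr ↦ (hG r (hsub hr)).mono hsub) (fun r hr ↦ ?_)
    (left_mem_segment ℝ t s) (right_mem_segment ℝ t s)
  · rw [h0, sub_zero, Real.norm_eq_abs] at this
    rw [pow_succ, ← mul_assoc]
    exact this
  · refine (hb r hr).trans ?_
    rw [segment_eq_uIcc] at hr
    have := abs_sub_left_of_mem_uIcc hr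
    gcongr

/-- Integration of an asymptotic expansion: an error o((s - t)^(k + m)) in the derivative gains one
order, by the mean value inequality on the segment from t to s. -/
theorem tendsto_of_hasDerivWithinAt_pow_smul {F h : ℝ → E} (hI : Convex ℝ I) (ht : t ∈ I) (k : ℕ)
    (hh : ∀ s ∈ I, HasDerivWithinAt (fun s ↦ (s - t) ^ (k + 1) • h s) ((s - t) ^ k • F s) I s)
    {P P' : ℝ → E} (hP : ∀ s, HasDerivAt P (P' s) s) (m : ℕ) (hP0 : P t = 0)
    (hPF : (fun s ↦ (s - t) ^ k • F s - P' s) =o[𝓝[I] t] fun s ↦ (s - t) ^ (k + m)) :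
    (fun s ↦ (s - t) ^ (k + 1) • h s - P s) =o[𝓝[I] t] fun s ↦ (s - t) ^ (k + m + 1) := by
  rw [Asymptotics.isLittleO_iff] at hPF ⊢
  intro ε hε
  have h1 := hPF hε
  rw [eventually_nhdsWithin_iff, Metric.eventually_nhds_iff] at h1 ⊢
  obtain ⟨δ, hδ, h1⟩ := h1
  refine ⟨δ, hδ, fun s hs hsI ↦ ?_⟩
  have := norm_le_of_norm_deriv_le_pow (G := fun s ↦ (s - t) ^ (k + 1) • h s - P s) hI ht
    (fun s hs ↦ (hh s hs).sub (hP s).hasDerivWithinAt) (by simp [hP0]) (k + m) hsI hε.le ?_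
  · simpa using this
  · intro r hr
    have hrI := hI.segment_subset ht hsI hr
    have := h1 (y := r) ?_ hrI
    · simpa using this
    · refine lt_of_le_of_lt ?_ hs
      rw [segment_eq_uIcc] at hr
      simpa [Real.dist_eq] using abs_sub_left_of_mem_uIcc hr

theorem isLittleO_of_pow_smul {f : ℝ → E} {k m : ℕ}
    (h : (fun r ↦ (r - t) ^ k • f r) =o[𝓝[I] t] fun r ↦ (r - t) ^ (k + m)) :
    f =o[𝓝[I \ {t}] t] fun r ↦ (r - t) ^ m := by
  have h' := h.mono (nhdsWithin_mono t sdiff_subset (s := I \ {t}))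
  refine ((Asymptotics.isBigO_refl (fun r : ℝ ↦ ((r - t) ^ k)⁻¹)
    (𝓝[I \ {t}] t)).smul_isLittleO h').congr' ?_ ?_
  · filter_upwards [self_mem_nhdsWithin] with r hr
    rw [smul_smul, inv_mul_cancel₀ (pow_ne_zero _ (sub_ne_zero.2 hr.2)), one_smul]
  · filter_upwards [self_mem_nhdsWithin] with r hr
    rw [smul_eq_mul, pow_add, ← mul_assoc,
      inv_mul_cancel₀ (pow_ne_zero _ (sub_ne_zero.2 hr.2)), one_mul]

/-- Since (s - t)^(k+1) h is a primitive of (s - t)^k F that vanishes at t, h is a weighted average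
of F between t and s and inherits its regularity. In the induction on n, the derivative of h solves
the same problem for F' with k + 1 in place of k, so k has to stay free. -/
theorem contDiffOn_of_hasDerivWithinAt_pow_smul (hI : Convex ℝ I) (hI' : (interior I).Nonempty)
    (ht : t ∈ I) (n : ℕ) : ∀ (k : ℕ) (F h : ℝ → E), ContDiffOn ℝ n F I →
    (∀ s ∈ I, HasDerivWithinAt (fun s ↦ (s - t) ^ (k + 1) • h s) ((s - t) ^ k • F s) I s) →
    ((k + 1 : ℝ) • h t = F t) → ContDiffOn ℝ n h I := by
  have hu := uniqueDiffOn_convex hI hI'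
  have hne : ∀ k : ℕ, (k + 1 : ℝ) ≠ 0 := fun k ↦ by positivity
  -- Away from t the hypothesis can be solved for the derivative of h.
  have off : ∀ (k : ℕ) (F h : ℝ → E),
      (∀ s ∈ I, HasDerivWithinAt (fun s ↦ (s - t) ^ (k + 1) • h s) ((s - t) ^ k • F s) I s) →
      ∀ s ∈ I, s ≠ t → HasDerivWithinAt h ((s - t)⁻¹ • (F s - (k + 1 : ℝ) • h s)) I s := by
    intro k F h hh s hs hst
    have hst' : s - t ≠ 0 := sub_ne_zero.2 hst
    have hp : HasDerivWithinAt (fun s : ℝ ↦ ((s - t) ^ (k + 1))⁻¹)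
        (-((k + 1 : ℕ) * (s - t) ^ k * 1) / ((s - t) ^ (k + 1)) ^ 2) I s := by
      have := (((hasDerivWithinAt_id s I).sub_const t).pow (k + 1)).inv (pow_ne_zero _ hst')
      exact this.congr_deriv (by simp)
    have h2 := hp.smul (hh s hs)
    have h3 := h2.congr_of_eventuallyEq (f₁ := h) (by
      have : ∀ᶠ r in 𝓝[I] s, r ≠ t := (eventually_ne_nhds hst).filter_mono nhdsWithin_le_nhds
      filter_upwards [this] with r hr
      rw [Pi.smul_apply', smul_smul, inv_mul_cancel₀ (pow_ne_zero _ (sub_ne_zero.2 hr)), one_smul])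
      (by rw [Pi.smul_apply', smul_smul, inv_mul_cancel₀ (pow_ne_zero _ hst'), one_smul])
    convert h3 using 1
    rw [smul_sub, smul_smul, smul_smul, smul_smul, sub_eq_add_neg, ← neg_smul]
    congr 2
    · field_simp
      ring
    · push_cast
      field_simp
      ring
  induction n with
  | zero =>
    intro k F h hF hh ht0
    simp only [Nat.cast_zero, contDiffOn_zero] at hF ⊢
    intro s hs
    by_cases hst : s = t
    · subst hst
      have hP : ∀ r, HasDerivAt (fun r : ℝ ↦ (r - s) ^ (k + 1) • h s)
          ((((k + 1 : ℕ) : ℝ) * (r - s) ^ k * 1) • h s) r := fun r ↦ by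
        have := (((hasDerivAt_id r).sub_const s).pow (k + 1)).smul_const (h s)
        simpa using this
      have h1 := tendsto_of_hasDerivWithinAt_pow_smul hI ht k hh hP 0 (by simp) (by
        have : (fun r ↦ (r - s) ^ k • F r - (((k + 1 : ℕ) : ℝ) * (r - s) ^ k * 1) • h s) =
            fun r ↦ (r - s) ^ k • (F r - F s) := by
          ext r
          rw [smul_sub, ← ht0, smul_smul]
          push_cast
          congr 2
          ring
        rw [this]
        have h2 : (fun r ↦ F r - F s) =o[𝓝[I] s] fun _ ↦ (1 : ℝ) := by
          rw [Asymptotics.isLittleO_one_iff]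
          simpa using (hF s hs).tendsto.sub_const (F s)
        simpa using (Asymptotics.isBigO_refl (fun r ↦ (r - s) ^ k) (𝓝[I] s)).smul_isLittleO h2)
      have h3 : (fun r ↦ h r - h s) =o[𝓝[I \ {s}] s] fun _ ↦ (1 : ℝ) := by
        have h2 : (fun r ↦ (r - s) ^ (k + 1) • (h r - h s)) =o[𝓝[I] s]
            fun r ↦ (r - s) ^ (k + 1 + 0) := by simpa [smul_sub] using h1
        simpa using isLittleO_of_pow_smul h2
      rw [Asymptotics.isLittleO_one_iff, tendsto_sub_nhds_zero_iff] at h3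
      rw [← continuousWithinAt_sdiff_self]
      exact h3
    · exact (off k F h hh s hs hst).continuousWithinAt
  | succ n ih =>
    intro k F h hF hh ht0
    obtain ⟨hFd, hF'⟩ : DifferentiableOn ℝ F I ∧ ContDiffOn ℝ n (derivWithin F I) I := by
      have := (contDiffOn_succ_iff_derivWithin (n := n) hu).1 (by exact_mod_cast hF)
      exact ⟨this.1, this.2.2⟩
    classical
    -- The candidate for the derivative of h. Its value at t comes from integrating (s - t)^k (F t +
    -- (s - t) F' t), which gives h ≈ F t / (k + 1) + (s - t) F' t / (k + 2).
    let h1 : ℝ → E := Function.update (fun s ↦ (s - t)⁻¹ • (F s - (k + 1 : ℝ) • h s)) t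
      ((k + 2 : ℝ)⁻¹ • derivWithin F I t)
    have hder : ∀ s ∈ I, HasDerivWithinAt h (h1 s) I s := by
      intro s hs
      by_cases hst : s = t
      · subst hst
        have e1 : h1 s = (k + 2 : ℝ)⁻¹ • derivWithin F I s := by simp [h1]
        rw [e1]
        have hP : ∀ r, HasDerivAt (fun r : ℝ ↦ (r - s) ^ (k + 1) • h s +
            (r - s) ^ (k + 2) • (k + 2 : ℝ)⁻¹ • derivWithin F I s)
          ((((k + 1 : ℕ) : ℝ) * (r - s) ^ k * 1) • h s +
            (((k + 2 : ℕ) : ℝ) * (r - s) ^ (k + 1) * 1) • (k + 2 : ℝ)⁻¹ • derivWithin F I s) r :=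
          fun r ↦ by
            have := ((((hasDerivAt_id r).sub_const s).pow (k + 1)).smul_const (h s)).add
              ((((hasDerivAt_id r).sub_const s).pow (k + 2)).smul_const
                ((k + 2 : ℝ)⁻¹ • derivWithin F I s))
            exact this.congr_deriv (by simp)
        have h2 := tendsto_of_hasDerivWithinAt_pow_smul hI ht k hh hP 1 (by simp) (by
          have e2 : (fun r ↦ (r - s) ^ k • F r - ((((k + 1 : ℕ) : ℝ) * (r - s) ^ k * 1) • h s +
            (((k + 2 : ℕ) : ℝ) * (r - s) ^ (k + 1) * 1) • (k + 2 : ℝ)⁻¹ • derivWithin F I s)) =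
              fun r ↦ (r - s) ^ k • (F r - F s - (r - s) • derivWithin F I s) := by
            ext r
            have hk : (k + 2 : ℝ) ≠ 0 := by positivity
            rw [smul_sub, smul_sub, ← ht0, smul_smul, smul_smul, smul_smul, sub_sub]
            push_cast
            congr 3
            · ring
            · field_simp
              ring
          rw [e2]
          have h3 := (hFd s hs).hasDerivWithinAt.hasFDerivWithinAt.isLittleO
          have h4 : (fun r ↦ F r - F s - (r - s) • derivWithin F I s) =o[𝓝[I] s]
            fun r ↦ r - s := by simpa using h3
          simpa [pow_succ] using
            (Asymptotics.isBigO_refl (fun r ↦ (r - s) ^ k) (𝓝[I] s)).smul_isLittleO h4)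
        rw [← hasDerivWithinAt_sdiff_singleton, hasDerivWithinAt_iff_isLittleO]
        refine (isLittleO_of_pow_smul (m := 1) (k := k + 1) (h2.congr_left fun r ↦ ?_)).congr_right
          fun r ↦ pow_one _
        rw [smul_sub, smul_sub, pow_succ (r - s) (k + 1), mul_smul, sub_sub]
      · have e1 : h1 s = (s - t)⁻¹ • (F s - (k + 1 : ℝ) • h s) := by simp [h1, hst]
        rw [e1]
        exact off k F h hh s hs hst
    have hC : ContDiffOn ℝ n h1 I := by
      refine ih (k + 1) (derivWithin F I) h1 hF' (fun s hs ↦ ?_) ?_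
      · have e : (fun s ↦ (s - t) ^ (k + 1 + 1) • h1 s) = fun s ↦
            (s - t) ^ (k + 1) • F s - (k + 1 : ℝ) • ((s - t) ^ (k + 1) • h s) := by
          ext s
          by_cases hst : s = t
          · subst hst; simp
          · have : s - t ≠ 0 := sub_ne_zero.2 hst
            simp only [h1, Function.update_of_ne hst]
            rw [smul_smul, pow_succ, mul_assoc, mul_inv_cancel₀ this, mul_one, smul_sub,
              smul_comm (k + 1 : ℝ)]
        rw [e]
        have := ((((hasDerivWithinAt_id s I).sub_const t).pow (k + 1)).smul
          (hFd s hs).hasDerivWithinAt).sub ((hh s hs).const_smul (k + 1 : ℝ))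
        refine (this.congr_deriv ?_).congr_of_eventuallyEq (.of_forall fun _ ↦ by simp) (by simp)
        simp [smul_smul]
      · have hk : (k + 2 : ℝ) ≠ 0 := by positivity
        have : ((k + 1 : ℕ) + 1 : ℝ) = k + 2 := by push_cast; ring
        rw [this]
        simp [h1, smul_smul, hk]
    have := (contDiffOn_succ_iff_derivWithin (n := n) hu (f := h)).2
      ⟨fun s hs ↦ (hder s hs).differentiableWithinAt, by simp,
        hC.congr fun s hs ↦ (hder s hs).derivWithin (hu s hs)⟩
    exact_mod_cast this

/-- If a smooth function vanishes at `t`, its quotient by `s - t` is smooth at `t`. -/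
theorem ContDiffWithinAt.div_sub {f : ℝ → E} {J : Set ℝ} (hJ : J.OrdConnected) (hJ' : J.Nontrivial)
    (ht : t ∈ J) (hf : ContDiffWithinAt ℝ ∞ f J t) (h0 : f t = 0) :
    ContDiffWithinAt ℝ ∞
      (Function.update (fun s ↦ (s - t)⁻¹ • f s) t (derivWithin f J t)) J t := by
  classical
  have hJc : Convex ℝ J := hJ.convex
  rw [contDiffWithinAt_infty]
  intro n
  -- The division costs one derivative, so order n + 1 of f is needed for order n of the quotient;
  -- both are considered on a ball around t inside J.
  obtain ⟨u, huo, htu, hfu⟩ := (hf.of_le (m := ((n + 1 : ℕ) : WithTop ℕ∞))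
    (by exact_mod_cast le_top)).contDiffOn' le_rfl (by simp)
  rw [insert_eq_of_mem ht] at hfu
  obtain ⟨r, hr, hru⟩ := Metric.isOpen_iff.1 huo t htu
  have hIc : Convex ℝ (J ∩ Metric.ball t r) := hJc.inter (convex_ball t r)
  have hti : t ∈ J ∩ Metric.ball t r := ⟨ht, Metric.mem_ball_self hr⟩
  have hint : (interior (J ∩ Metric.ball t r)).Nonempty := by
    have hcl := subset_closure ht
    have hni := (Convex.nontrivial_iff_nonempty_interior hJc).1 hJ'
    rw [← hJc.closure_interior_eq_closure_of_nonempty_interior hni] at hcl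
    rw [interior_inter, Metric.isOpen_ball.interior_eq, inter_comm]
    exact mem_closure_iff.1 hcl _ Metric.isOpen_ball (Metric.mem_ball_self hr)
  have hu := uniqueDiffOn_convex hIc hint
  have hf' := hfu.mono (inter_subset_inter_right J hru)
  obtain ⟨hfd, hfC⟩ : DifferentiableOn ℝ f (J ∩ Metric.ball t r) ∧
      ContDiffOn ℝ n (derivWithin f (J ∩ Metric.ball t r)) (J ∩ Metric.ball t r) := by
    have := (contDiffOn_succ_iff_derivWithin (n := n) hu).1 (by exact_mod_cast hf')
    exact ⟨this.1, this.2.2⟩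
  have hball : Metric.ball t r ∈ 𝓝 t := Metric.ball_mem_nhds t hr
  refine (contDiffOn_of_hasDerivWithinAt_pow_smul hIc hint hti n 0 _ _ hfC (fun s hs ↦ ?_)
    ?_ t hti).mono_of_mem_nhdsWithin (inter_mem_nhdsWithin J hball)
  · have e : (fun s ↦ (s - t) ^ (0 + 1) • Function.update (fun s ↦ (s - t)⁻¹ • f s) t
        (derivWithin f J t) s) = f := by
      ext s
      by_cases hst : s = t
      · subst hst; simp [h0]
      · simp [Function.update_of_ne hst, smul_smul, mul_inv_cancel₀ (sub_ne_zero.2 hst)]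
    rw [e]
    simpa using (hfd s hs).hasDerivWithinAt
  · simp [derivWithin_inter hball]

end Division

/-! ### Uniqueness for Jacobi fields -/

theorem eq_zero_of_norm_deriv_le_Icc {E : Type*} [NormedAddCommGroup E] [NormedSpace ℝ E]
    {z z' : ℝ → E} {a b K : ℝ} (hz : ∀ s ∈ Icc a b, HasDerivWithinAt z (z' s) (Icc a b) s)
    (hK : ∀ s ∈ Icc a b, ‖z' s‖ ≤ K * ‖z s‖) (h0 : z a = 0) {s : ℝ} (hs : s ∈ Icc a b) :
    z s = 0 := by
  have := norm_le_gronwallBound_of_norm_deriv_right_le (f := z) (f' := z') (δ := 0) (K := K)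
    (ε := 0) (a := a) (b := b) (fun s hs ↦ (hz s hs).continuousWithinAt)
    (fun s hs ↦ (hz s (Ico_subset_Icc_self hs)).mono_of_mem_nhdsWithin
      (Icc_mem_nhdsGE_of_mem hs)) (by simp [h0])
    (fun s hs ↦ by simpa using hK s (Ico_subset_Icc_self hs)) s hs
  simpa [gronwallBound_ε0] using this

theorem eq_zero_of_norm_deriv_le {E : Type*} [NormedAddCommGroup E] [NormedSpace ℝ E]
    {I : Set ℝ} (hI : I.OrdConnected) {z z' : ℝ → E} {K t : ℝ}
    (hz : ∀ s ∈ I, HasDerivWithinAt z (z' s) I s) (hK : ∀ s ∈ I, ‖z' s‖ ≤ K * ‖z s‖)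
    (ht : t ∈ I) (h0 : z t = 0) {s : ℝ} (hs : s ∈ I) : z s = 0 := by
  rcases le_total t s with hts | hst
  · have hsub := hI.out ht hs
    exact eq_zero_of_norm_deriv_le_Icc (fun r hr ↦ (hz r (hsub hr)).mono hsub)
      (fun r hr ↦ hK r (hsub hr)) h0 (right_mem_Icc.2 hts)
  · have hsub := hI.out hs ht
    -- Grönwall's inequality runs forward in time; points before t are reached after the reflection
    -- r ↦ -r.
    have hmaps : MapsTo (fun r : ℝ ↦ -r) (Icc (-t) (-s)) (Icc s t) := fun r hr ↦
      ⟨by linarith [hr.2], by linarith [hr.1]⟩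
    have := eq_zero_of_norm_deriv_le_Icc (z := fun r ↦ z (-r)) (z' := fun r ↦ -z' (-r))
      (a := -t) (b := -s) (K := K) (fun r hr ↦ ?_) (fun r hr ↦ ?_) (by simpa using h0)
      (right_mem_Icc.2 (neg_le_neg hst))
    · simpa using this
    · have h1 := ((hz (-r) (hsub (hmaps hr))).mono hsub).scomp r
        ((hasDerivWithinAt_id r (Icc (-t) (-s))).neg) hmaps
      exact h1.congr_deriv (by simp)
    · simpa using hK (-r) (hsub (hmaps hr))

section Uniqueness

variable {E : Type*} [NormedAddCommGroup E] [NormedSpace ℝ E] [FiniteDimensional ℝ E]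

theorem norm_coordCurvature_le (g : E → E →L[ℝ] E →L[ℝ] ℝ) (y u v w : E) :
    ‖coordCurvature g y u v w‖ ≤
      2 * (‖fderiv ℝ (christoffel g) y‖ + ‖christoffel g y‖ ^ 2) * (‖u‖ * ‖v‖ * ‖w‖) := by
  have h1 : ∀ u v w : E, ‖fderiv ℝ (christoffel g) y u v w‖ ≤
      ‖fderiv ℝ (christoffel g) y‖ * (‖u‖ * ‖v‖ * ‖w‖) := fun u v w ↦ by
    refine (((fderiv ℝ (christoffel g) y u).le_opNorm₂ v w).trans ?_)
    rw [← mul_assoc, ← mul_assoc]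
    gcongr
    exact (fderiv ℝ (christoffel g) y).le_opNorm u
  have h2 : ∀ u v w : E, ‖christoffel g y u (christoffel g y v w)‖ ≤
      ‖christoffel g y‖ ^ 2 * (‖u‖ * ‖v‖ * ‖w‖) := fun u v w ↦
    calc _ ≤ ‖christoffel g y‖ * ‖u‖ * ‖christoffel g y v w‖ := (christoffel g y).le_opNorm₂ _ _
      _ ≤ ‖christoffel g y‖ * ‖u‖ * (‖christoffel g y‖ * ‖v‖ * ‖w‖) := by
        gcongr
        exact (christoffel g y).le_opNorm₂ _ _
      _ = _ := by ring
  rw [coordCurvature]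
  refine (norm_sub_le _ _).trans ((add_le_add_left ((norm_add_le _ _).trans
    (add_le_add_left (norm_sub_le _ _) _)) _).trans ?_)
  have := h1 u v w
  have := h1 v u w
  have := h2 u v w
  have := h2 v u w
  nlinarith

variable {M : Type*} [TopologicalSpace M] [ChartedSpace E M] [IsManifold 𝓘(ℝ, E) ∞ M]
  [RiemannianBundle (fun x : M ↦ TangentSpace 𝓘(ℝ, E) x)]
  [IsContMDiffRiemannianBundle 𝓘(ℝ, E) ∞ E (fun x : M ↦ TangentSpace 𝓘(ℝ, E) x)]
  {c : ℝ → M} {J : Set ℝ} {t : ℝ} {X Y : ∀ t, TangentSpace 𝓘(ℝ, E) (c t)}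

theorem toCoord_eq_zero_iff {x₀ x : M} (hx : x ∈ (chartAt E x₀).source)
    {w : TangentSpace 𝓘(ℝ, E) x} : toCoord x₀ x w = 0 ↔ w = 0 := by
  refine ⟨fun h ↦ ?_, fun h ↦ by rw [h, map_zero]⟩
  rw [← ofCoord_toCoord hx w, h, map_zero]

/-- In a chart the pair (X, X') solves a linear first-order system, so Grönwall's inequality applies
in both directions. The equivalence is a symmetric and transitive relation between t and s, which is
what allows its propagation along the connected set J. -/
theorem eventually_jacobi_eq_zero_iff (hJ : J.OrdConnected) (hu : UniqueDiffOn ℝ J)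
    (hc : ContMDiffOn 𝓘(ℝ, ℝ) 𝓘(ℝ, E) ∞ c J) (hX : IsJacobiFieldOn c J X) (ht : t ∈ J) :
    ∀ᶠ s in 𝓝[J] t, ((X t = 0 ∧ covDeriv c J X t = 0) ↔ (X s = 0 ∧ covDeriv c J X s = 0)) := by
  have h₀ := mem_chart_source E (c t)
  have hXs : ∀ s ∈ J, SmoothAlongAt c J X s := hX.1
  have hDs : ∀ s ∈ J, SmoothAlongAt c J (covDeriv c J X) s := fun s hs ↦ (hXs s hs).covDeriv hc hu hs
  let γ : ℝ → E := fun s ↦ extChartAt 𝓘(ℝ, E) (c t) (c s)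
  let v : ℝ → E := fun s ↦ toCoord (c t) (c s) (velocity c J s)
  let a : ℝ → E := fun s ↦ toCoord (c t) (c s) (X s)
  let b : ℝ → E := fun s ↦ toCoord (c t) (c s) (covDeriv c J X s)
  let g := chartMetric (E := E) (c t)
  have hγ : ContinuousWithinAt γ J t :=
    (contDiffWithinAt_extChartAt_comp (hc t ht) h₀).continuousWithinAt
  have hv : ContinuousWithinAt v J t :=
    ((smoothAlongAt_iff (hc t ht) h₀).1 (smoothAlongAt_velocity hc hu ht)).continuousWithinAt
  have hΓ := contDiffAt_christoffel (contDiffAt_chartMetric h₀) (isInvertible_chartMetric h₀)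
  have hΓc : ContinuousWithinAt (fun s ↦ christoffel g (γ s)) J t :=
    hΓ.continuousAt.comp_continuousWithinAt (f := γ) hγ
  have hdΓc : ContinuousWithinAt (fun s ↦ fderiv ℝ (christoffel g) (γ s)) J t :=
    (hΓ.fderiv_right (m := ∞) (by simp)).continuousAt.comp_continuousWithinAt (f := γ) hγ
  -- A bound for the coefficients of the system for (a, b), continuous at t and therefore at most k
  -- t + 1 nearby.
  let k : ℝ → ℝ := fun s ↦ 1 + ‖christoffel g (γ s)‖ * ‖v s‖ +
    2 * (‖fderiv ℝ (christoffel g) (γ s)‖ + ‖christoffel g (γ s)‖ ^ 2) * (‖v s‖ * ‖v s‖)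
  have hk : ContinuousWithinAt k J t :=
    (continuousWithinAt_const.add (hΓc.norm.mul hv.norm)).add
      ((continuousWithinAt_const.mul (hdΓc.norm.add (hΓc.norm.pow 2))).mul
        (hv.norm.mul hv.norm))
  have hev := (eventually_mem_source (hc t ht) h₀).and (hk.eventually_lt_const (lt_add_one (k t)))
  rw [eventually_nhdsWithin_iff, Metric.eventually_nhds_iff_ball] at hev
  obtain ⟨ε, hε, hev⟩ := hev
  let I := J ∩ Metric.ball t ε
  have hI : I.OrdConnected := by
    refine hJ.inter ?_
    rw [Real.ball_eq_Ioo]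
    exact ordConnected_Ioo
  have hsrc : ∀ s ∈ I, c s ∈ (chartAt E (c t)).source := fun s hs ↦ (hev s hs.2 hs.1).1
  have hIJ : I ⊆ J := inter_subset_left
  have htI : t ∈ I := ⟨ht, Metric.mem_ball_self hε⟩
  have ha : ∀ s ∈ I, HasDerivWithinAt a (b s - christoffel g (γ s) (v s) (a s)) I s := by
    intro s hs
    have h1 := ((hXs s hs.1).differentiableWithinAt (hc s hs.1) (hsrc s hs)).hasDerivWithinAt
    have h2 := toCoord_covDeriv (hXs s hs.1) (hc s hs.1) (hu s hs.1) (hsrc s hs)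
    exact (h1.congr_deriv (eq_sub_of_add_eq h2.symm)).mono hIJ
  have hb : ∀ s ∈ I, HasDerivWithinAt b
      (-coordCurvature g (γ s) (a s) (v s) (v s) - christoffel g (γ s) (v s) (b s)) I s := by
    intro s hs
    have h1 := ((hDs s hs.1).differentiableWithinAt (hc s hs.1) (hsrc s hs)).hasDerivWithinAt
    have h2 := toCoord_covDeriv (hDs s hs.1) (hc s hs.1) (hu s hs.1) (hsrc s hs)
    rw [eq_neg_of_add_eq_zero_left (hX.2 s hs.1), map_neg, toCoord_curvature (hsrc s hs)] at h2
    exact (h1.congr_deriv (eq_sub_of_add_eq h2.symm)).mono hIJ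
  have hz : ∀ s ∈ I, HasDerivWithinAt (fun s ↦ (a s, b s)) (b s - christoffel g (γ s) (v s) (a s),
      -coordCurvature g (γ s) (a s) (v s) (v s) - christoffel g (γ s) (v s) (b s)) I s :=
    fun s hs ↦ (ha s hs).prodMk (hb s hs)
  have hK : ∀ s ∈ I, ‖(b s - christoffel g (γ s) (v s) (a s),
      -coordCurvature g (γ s) (a s) (v s) (v s) - christoffel g (γ s) (v s) (b s))‖ ≤
      (k t + 1) * ‖(a s, b s)‖ := by
    intro s hs
    have hks := (hev s hs.2 hs.1).2.le
    refine le_trans ?_ (mul_le_mul_of_nonneg_right hks (norm_nonneg _))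
    have h1 : ‖a s‖ ≤ ‖(a s, b s)‖ := norm_fst_le (a s, b s)
    have h2 : ‖b s‖ ≤ ‖(a s, b s)‖ := norm_snd_le (a s, b s)
    set m := ‖(a s, b s)‖
    have hΓa := (christoffel g (γ s)).le_opNorm₂ (v s) (a s)
    have hΓb := (christoffel g (γ s)).le_opNorm₂ (v s) (b s)
    have hR := norm_coordCurvature_le g (γ s) (a s) (v s) (v s)
    have hΓm : ∀ x : E, ‖x‖ ≤ m → ‖christoffel g (γ s)‖ * ‖v s‖ * ‖x‖ ≤
        ‖christoffel g (γ s)‖ * ‖v s‖ * m := fun x hx ↦ by gcongr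
    have hRm : 2 * (‖fderiv ℝ (christoffel g) (γ s)‖ + ‖christoffel g (γ s)‖ ^ 2) *
        (‖a s‖ * ‖v s‖ * ‖v s‖) ≤ 2 * (‖fderiv ℝ (christoffel g) (γ s)‖ +
          ‖christoffel g (γ s)‖ ^ 2) * (‖v s‖ * ‖v s‖) * m := by
      calc _ ≤ 2 * (‖fderiv ℝ (christoffel g) (γ s)‖ + ‖christoffel g (γ s)‖ ^ 2) *
            (m * ‖v s‖ * ‖v s‖) := by gcongr
        _ = _ := by ring
    have hm : 0 ≤ m := norm_nonneg _
    have e1 : 0 ≤ ‖christoffel g (γ s)‖ * ‖v s‖ * m := by positivity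
    have e2 : 0 ≤ 2 * (‖fderiv ℝ (christoffel g) (γ s)‖ +
          ‖christoffel g (γ s)‖ ^ 2) * (‖v s‖ * ‖v s‖) * m := by positivity
    have hkm : k s * m = m + ‖christoffel g (γ s)‖ * ‖v s‖ * m +
      2 * (‖fderiv ℝ (christoffel g) (γ s)‖ + ‖christoffel g (γ s)‖ ^ 2) * (‖v s‖ * ‖v s‖) * m := by
      simp only [k]
      ring
    rw [hkm]
    refine norm_prod_le_iff.2 ⟨?_, ?_⟩
    · have := norm_sub_le (b s) (christoffel g (γ s) (v s) (a s))
      have := hΓm _ h1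
      simp only
      linarith
    · have h3 := norm_sub_le (-coordCurvature g (γ s) (a s) (v s) (v s))
        (christoffel g (γ s) (v s) (b s))
      have := hΓm _ h2
      rw [norm_neg] at h3
      simp only
      linarith
  have hzero : ∀ s ∈ I, (X s = 0 ∧ covDeriv c J X s = 0) ↔ (a s, b s) = 0 := fun s hs ↦ by
    rw [Prod.mk_eq_zero, toCoord_eq_zero_iff (hsrc s hs), toCoord_eq_zero_iff (hsrc s hs)]
  have hInhds : I ∈ 𝓝[J] t := inter_mem_nhdsWithin J (Metric.ball_mem_nhds t hε)
  filter_upwards [hInhds] with s hs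
  rw [hzero t htI, hzero s hs]
  exact ⟨fun h ↦ eq_zero_of_norm_deriv_le hI hz hK htI h hs,
    fun h ↦ eq_zero_of_norm_deriv_le hI hz hK hs h htI⟩

/-- A Jacobi field that vanishes together with its derivative at a point vanishes. -/
theorem IsJacobiFieldOn.eq_zero (hX : IsJacobiFieldOn c J X) (hJ : J.OrdConnected)
    (hu : UniqueDiffOn ℝ J) (hc : ContMDiffOn 𝓘(ℝ, ℝ) 𝓘(ℝ, E) ∞ c J) (ht : t ∈ J) (h0 : X t = 0)
    (h1 : covDeriv c J X t = 0) {s : ℝ} (hs : s ∈ J) : X s = 0 :=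
  ((hJ.isPreconnected.induction₂ (fun r r' ↦
    ((X r = 0 ∧ covDeriv c J X r = 0) ↔ (X r' = 0 ∧ covDeriv c J X r' = 0)))
    (fun _ hr ↦ eventually_jacobi_eq_zero_iff hJ hu hc hX hr) (fun _ _ _ _ _ _ h h' ↦ h.trans h')
    (fun _ _ _ _ h ↦ h.symm) ht hs).1 ⟨h0, h1⟩).1

end Uniqueness

/-! ### Ky Fan's principle for the smallest eigenvalues -/

section KyFan

variable {V : Type*} [NormedAddCommGroup V] [InnerProductSpace ℝ V] [FiniteDimensional ℝ V]

/-- The weights and the indicator of the first p indices have the same sum, so subtracting the p-th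
smallest value m from μ changes both sides equally. Afterwards the comparison holds term by term: μ
- m is nonpositive on the first p indices, where a ≤ 1, and nonnegative on the others. -/
theorem sum_le_sum_mul_of_monotone {n p : ℕ} (hp : 1 ≤ p) (hpn : p ≤ n) {μ a : Fin n → ℝ}
    (hμ : Monotone μ) (h0 : ∀ k, 0 ≤ a k) (h1 : ∀ k, a k ≤ 1) (hs : ∑ k, a k = p) :
    ∑ k with k.val < p, μ k ≤ ∑ k, μ k * a k := by
  set m := μ ⟨p - 1, by omega⟩ with hm
  have hcard : ∑ k : Fin n with k.val < p, (1 : ℝ) = p := by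
    rw [Finset.sum_const, Fin.card_filter_val_lt]
    simp [hpn]
  have key : ∑ k with k.val < p, (μ k - m) ≤ ∑ k, (μ k - m) * a k := by
    rw [Finset.sum_filter]
    refine Finset.sum_le_sum fun k _ ↦ ?_
    split_ifs with hk
    · have : μ k ≤ m := hμ (Fin.le_def.2 (by simp; omega))
      nlinarith [h1 k]
    · have : m ≤ μ k := hμ (Fin.le_def.2 (by simp; omega))
      exact mul_nonneg (by linarith) (h0 k)
  simp only [sub_mul, Finset.sum_sub_distrib, ← Finset.mul_sum, hs] at key
  have : ∑ k : Fin n with k.val < p, m = m * p := by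
    rw [← hcard, Finset.mul_sum]; simp
  linarith

/-- In an eigenbasis b the right side is the sum of μ k weighted by ∑ i, ⟪b k, f i⟫². These weights
are at most 1 by Bessel's inequality for f and add up to p by Parseval's identity for b. -/
theorem sumSmallestEigenvalues_le {p : ℕ} {T : V →ₗ[ℝ] V} (hT : T.IsSymmetric) {f : Fin p → V}
    (hf : Orthonormal ℝ f) : sumSmallestEigenvalues p T ≤ ∑ i, ⟪T (f i), f i⟫_ℝ := by
  rcases Nat.eq_zero_or_pos p with rfl | hp
  · simp [sumSmallestEigenvalues]
  set n := Module.finrank ℝ V with hn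
  have hpn : p ≤ n := by simpa using hf.linearIndependent.fintype_card_le_finrank
  -- `eigenvalues` is listed in decreasing order, the smallest ones are wanted first.
  let μ : Fin n → ℝ := fun i ↦ hT.eigenvalues hn.symm (Fin.rev i)
  have hμ : Monotone μ := fun i j hij ↦ hT.eigenvalues_antitone hn.symm (Fin.rev_le_rev.2 hij)
  let b : OrthonormalBasis (Fin n) ℝ V := (hT.eigenvectorBasis hn.symm).reindex Fin.revPerm
  have hb : ∀ k, T (b k) = μ k • b k := fun k ↦ by
    simp [b, μ, hT.apply_eigenvectorBasis]
  have hsort : T.charpoly.roots.sort (· ≤ ·) = List.ofFn μ := by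
    have h1 : T.charpoly.roots = (List.ofFn μ : Multiset ℝ) := by
      rw [hT.roots_charpoly_eq_eigenvalues hn.symm]
      have h2 : (List.ofFn μ : Multiset ℝ) = Multiset.map μ Finset.univ.val := by
        rw [Fin.univ_val_map]
      have h3 : (Finset.univ : Finset (Fin n)).val = Multiset.map Fin.rev Finset.univ.val := by
        have := congrArg Finset.val (Finset.map_univ_equiv (Fin.revPerm (n := n)))
        rw [Finset.map_val] at this
        exact this.symm
      rw [h2]
      conv_lhs => rw [h3]
      rw [Multiset.map_map]
      rfl
    rw [h1, Multiset.coe_sort]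
    refine List.mergeSort_of_pairwise ?_
    simpa only [decide_eq_true_eq] using List.sortedLE_iff_pairwise.1 hμ.sortedLE_ofFn
  rw [sumSmallestEigenvalues, hsort, List.sum_take_ofFn]
  have hexp : ∀ x, ⟪T x, x⟫_ℝ = ∑ k, μ k * ⟪b k, x⟫_ℝ ^ 2 := by
    intro x
    rw [← b.sum_inner_mul_inner]
    refine Finset.sum_congr rfl fun k _ ↦ ?_
    rw [hT x (b k), hb, inner_smul_right, real_inner_comm]
    ring
  simp only [hexp]
  rw [Finset.sum_comm]
  simp only [← Finset.mul_sum]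
  refine sum_le_sum_mul_of_monotone hp hpn hμ (fun k ↦ Finset.sum_nonneg fun i _ ↦ sq_nonneg _)
    (fun k ↦ ?_) ?_
  · have := hf.sum_inner_products_le (s := Finset.univ) (b k)
    simpa [real_inner_comm] using this
  · rw [Finset.sum_comm]
    have : ∀ i, ∑ k, ⟪b k, f i⟫_ℝ ^ 2 = 1 := fun i ↦ by
      have := b.sum_sq_norm_inner_right (f i)
      simpa [hf.1 i] using this
    simp [this]

end KyFan

/-! ### Determinants and inverses of matrix functions -/

section Determinant

variable {n : Type*} [Fintype n] [DecidableEq n]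

theorem contDiff_det : ContDiff ℝ ∞ (fun M : n → n → ℝ ↦ (Matrix.of M).det) := by
  simp only [Matrix.det_apply, Matrix.of_apply]
  refine ContDiff.sum fun σ _ ↦ ContDiff.const_smul _ (contDiff_prod fun i _ ↦ ?_)
  exact contDiff_apply_apply ℝ ℝ (σ i) i

theorem contDiffWithinAt_det {F : Type*} [NormedAddCommGroup F] [NormedSpace ℝ F]
    {M : F → Matrix n n ℝ} {s : Set F} {t : F}
    (hM : ∀ i j, ContDiffWithinAt ℝ ∞ (fun r ↦ M r i j) s t) :
    ContDiffWithinAt ℝ ∞ (fun r ↦ (M r).det) s t :=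
  contDiff_det.contDiffAt.comp_contDiffWithinAt t (f := fun r i j ↦ M r i j)
    (contDiffWithinAt_pi.2 fun i ↦ contDiffWithinAt_pi.2 fun j ↦ hM i j)

theorem contDiffWithinAt_inv_apply {F : Type*} [NormedAddCommGroup F] [NormedSpace ℝ F]
    {M : F → Matrix n n ℝ} {s : Set F} {t : F}
    (hM : ∀ i j, ContDiffWithinAt ℝ ∞ (fun r ↦ M r i j) s t) (hdet : (M t).det ≠ 0) (i j : n) :
    ContDiffWithinAt ℝ ∞ (fun r ↦ (M r)⁻¹ i j) s t := by
  -- Cramer's rule reduces the claim to the smoothness of determinants.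
  have h : ∀ r, (M r)⁻¹ i j = (M r).det⁻¹ * ((M r).updateRow j (Pi.single i 1)).det := fun r ↦ by
    rw [Matrix.inv_def, Ring.inverse_eq_inv', Matrix.smul_apply, Matrix.adjugate_apply, smul_eq_mul]
  simp only [h]
  refine ((contDiffWithinAt_det hM).inv hdet).mul (contDiffWithinAt_det fun k l ↦ ?_)
  by_cases hk : k = j
  · subst hk
    simpa using contDiffWithinAt_const
  · simpa [Matrix.updateRow_ne hk] using hM k l

/-- Jacobi's formula for the derivative of a determinant. -/
theorem hasDerivWithinAt_det {M : ℝ → Matrix n n ℝ} {M' : Matrix n n ℝ} {s : Set ℝ} {t : ℝ}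
    (hM : ∀ i j, HasDerivWithinAt (fun r ↦ M r i j) (M' i j) s t) (hdet : (M t).det ≠ 0) :
    HasDerivWithinAt (fun r ↦ (M r).det) ((M t).det * ((M t)⁻¹ * M').trace) s t := by
  have hd : HasFDerivAt (fun N : n → n → ℝ ↦ (Matrix.of N).det) _ (fun i j ↦ M t i j) :=
    (contDiff_det.differentiable (by simp) _).hasFDerivAt
  have h1 := hd.comp_hasDerivWithinAt t (f := fun r i j ↦ M r i j) (f' := fun i j ↦ M' i j)
    (hasDerivWithinAt_pi.2 fun i ↦ hasDerivWithinAt_pi.2 fun j ↦ hM i j)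
  have hline : HasDerivAt (fun (r : ℝ) i j ↦ M t i j + r * M' i j) (fun i j ↦ M' i j) 0 := by
    refine hasDerivAt_pi.2 fun i ↦ hasDerivAt_pi.2 fun j ↦ ?_
    simpa using ((hasDerivAt_id (0 : ℝ)).mul_const (M' i j)).const_add (M t i j)
  have h2 := HasFDerivAt.comp_hasDerivAt (0 : ℝ) (by simpa using hd) hline
  have hu : IsUnit (M t).det := isUnit_iff_ne_zero.2 hdet
  -- The derivative of det in the direction M' is read off along the line M t + r M', where det(M t)
  -- factors out and the remaining factor det(1 + r M⁻¹M') is 1 + r tr(M⁻¹M') plus r² times a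
  -- polynomial.
  have h3 : HasDerivAt (fun r : ℝ ↦ (M t).det * (1 + ((M t)⁻¹ * M').trace * r +
      (Matrix.det (1 + (Polynomial.X : Polynomial ℝ) •
        ((M t)⁻¹ * M').map Polynomial.C)).divX.divX.eval r * r ^ 2))
      ((M t).det * ((M t)⁻¹ * M').trace) 0 := by
    have hp := (((Matrix.det (1 + (Polynomial.X : Polynomial ℝ) •
        ((M t)⁻¹ * M').map Polynomial.C)).divX.divX.hasDerivAt (0 : ℝ)).mul
        ((hasDerivAt_id (0 : ℝ)).pow 2))
    have := ((((hasDerivAt_id (0 : ℝ)).const_mul ((M t)⁻¹ * M').trace).const_add 1).add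
      hp).const_mul (M t).det
    exact this.congr_deriv (by simp)
  have h4 : (fun r : ℝ ↦ (Matrix.of fun i j ↦ M t i j + r * M' i j).det) = fun r : ℝ ↦
      (M t).det * (1 + ((M t)⁻¹ * M').trace * r +
      (Matrix.det (1 + (Polynomial.X : Polynomial ℝ) •
        ((M t)⁻¹ * M').map Polynomial.C)).divX.divX.eval r * r ^ 2) := by
    ext r
    rw [← Matrix.det_one_add_smul, ← Matrix.det_mul, mul_add, mul_one, Matrix.mul_smul,
      Matrix.mul_nonsing_inv_cancel_left _ _ hu]
    congr 1
  rw [← h4] at h3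
  exact h1.congr_deriv (h2.unique h3)

theorem hasDerivWithinAt_trace_inv_mul {M N : ℝ → Matrix n n ℝ} {M' N' : Matrix n n ℝ} {s : Set ℝ}
    {t : ℝ} (hM : ∀ i j, HasDerivWithinAt (fun r ↦ M r i j) (M' i j) s t)
    (hMi : ∀ i j, DifferentiableWithinAt ℝ (fun r ↦ (M r)⁻¹ i j) s t)
    (hN : ∀ i j, HasDerivWithinAt (fun r ↦ N r i j) (N' i j) s t) (hs : UniqueDiffWithinAt ℝ s t)
    (hdet : ∀ᶠ r in 𝓝[s] t, (M r).det ≠ 0) (hdet' : (M t).det ≠ 0) :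
    HasDerivWithinAt (fun r ↦ ((M r)⁻¹ * N r).trace)
      (((M t)⁻¹ * N').trace - ((M t)⁻¹ * M' * (M t)⁻¹ * N t).trace) s t := by
  have hu : IsUnit (M t).det := isUnit_iff_ne_zero.2 hdet'
  let K' : Matrix n n ℝ := Matrix.of fun i j ↦ derivWithin (fun r ↦ (M r)⁻¹ i j) s t
  have hK : ∀ i j, HasDerivWithinAt (fun r ↦ (M r)⁻¹ i j) (K' i j) s t := fun i j ↦
    (hMi i j).hasDerivWithinAt
  have hK' : K' = -((M t)⁻¹ * M' * (M t)⁻¹) := by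
    have h0 : M' * (M t)⁻¹ + M t * K' = 0 := by
      ext i j
      have h1 : HasDerivWithinAt (fun r ↦ (M r * (M r)⁻¹) i j) ((M' * (M t)⁻¹ + M t * K') i j)
          s t := by
        simp only [Matrix.mul_apply, Matrix.add_apply, ← Finset.sum_add_distrib]
        exact HasDerivWithinAt.fun_sum fun k _ ↦ (hM i k).mul (hK k j)
      have h2 : HasDerivWithinAt (fun r ↦ (M r * (M r)⁻¹) i j) 0 s t := by
        refine (hasDerivWithinAt_const t s ((1 : Matrix n n ℝ) i j)).congr_of_eventuallyEq ?_ ?_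
        · filter_upwards [hdet] with r hr
          rw [Matrix.mul_nonsing_inv _ (isUnit_iff_ne_zero.2 hr)]
        · rw [Matrix.mul_nonsing_inv _ hu]
      exact hs.eq_deriv _ h1 h2
    have h1 := congrArg (fun X ↦ (M t)⁻¹ * X) h0
    simp only [mul_add, mul_zero, ← mul_assoc, Matrix.nonsing_inv_mul _ hu, one_mul] at h1
    exact eq_neg_of_add_eq_zero_right h1
  have h1 : HasDerivWithinAt (fun r ↦ ((M r)⁻¹ * N r).trace)
      (K' * N t + (M t)⁻¹ * N').trace s t := by
    simp only [Matrix.trace, Matrix.diag, Matrix.mul_apply, Matrix.add_apply,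
      ← Finset.sum_add_distrib]
    exact HasDerivWithinAt.fun_sum fun i _ ↦ HasDerivWithinAt.fun_sum fun k _ ↦
      (hK i k).mul (hN k i)
  refine h1.congr_deriv ?_
  rw [hK', Matrix.trace_add, neg_mul, Matrix.trace_neg]
  ring

/-- All eigenvalues are at least δ, so each of them times δ^(n-1) is at most their product. It
serves to make det blow up as soon as one diagonal entry does. -/
theorem trace_le_card_mul_det {M : Matrix n n ℝ} (hM : M.IsHermitian) {δ : ℝ} (hδ : 0 < δ)
    (h : ∀ x : n → ℝ, δ * (x ⬝ᵥ x) ≤ x ⬝ᵥ M.mulVec x) :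
    δ ^ (Fintype.card n - 1) * M.trace ≤ Fintype.card n * M.det := by
  have hev : ∀ i, δ ≤ hM.eigenvalues i := by
    intro i
    have h1 := h (hM.eigenvectorBasis i)
    rw [hM.mulVec_eigenvectorBasis, dotProduct_smul] at h1
    have h2 : (hM.eigenvectorBasis i : n → ℝ) ⬝ᵥ (hM.eigenvectorBasis i) = 1 := by
      have := hM.eigenvectorBasis.orthonormal.1 i
      have h3 := real_inner_self_eq_norm_sq (hM.eigenvectorBasis i)
      rw [this, EuclideanSpace.inner_eq_star_dotProduct, star_trivial, one_pow] at h3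
      exact h3
    rw [h2] at h1
    simpa using h1
  have htr : M.trace = ∑ i, hM.eigenvalues i := by simpa using hM.trace_eq_sum_eigenvalues
  have hde : M.det = ∏ i, hM.eigenvalues i := by simpa using hM.det_eq_prod_eigenvalues
  rw [htr, hde, Finset.mul_sum, ← nsmul_eq_mul, ← Finset.card_univ, ← Finset.sum_const]
  refine Finset.sum_le_sum fun i _ ↦ ?_
  rw [← Finset.mul_prod_erase _ _ (Finset.mem_univ i), mul_comm]
  refine mul_le_mul_of_nonneg_left ?_ (hδ.le.trans (hev i))
  rw [← Finset.card_erase_of_mem (Finset.mem_univ i), ← Finset.prod_const]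
  exact Finset.prod_le_prod (fun _ _ ↦ hδ.le) fun j _ ↦ hev j

end Determinant

/-! ### The algebraic inequality behind concavity -/

section TraceInequality

variable {V : Type*} [NormedAddCommGroup V] [InnerProductSpace ℝ V] {p : ℕ}

theorem transpose_mul_mul_apply_eq_inner (C : Matrix (Fin p) (Fin p) ℝ) {a b : Fin p → V}
    {X : Matrix (Fin p) (Fin p) ℝ} (hX : ∀ i j, X i j = ⟪a i, b j⟫_ℝ) (i j : Fin p) :
    (C.transpose * X * C) i j = ⟪∑ k, C k i • a k, ∑ k, C k j • b k⟫_ℝ := by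
  simp only [sum_inner, inner_sum, real_inner_smul_left, real_inner_smul_right,
    Matrix.mul_apply, Matrix.transpose_apply, Finset.sum_mul, hX]
  refine Finset.sum_congr rfl fun k _ ↦ Finset.sum_congr rfl fun l _ ↦ ?_
  ring

/-- If B holds the coordinates of z in an orthonormal basis of its span, the Gram matrix is BᵀB, and
C = B⁻¹ transforms z into that basis. -/
theorem exists_orthonormal_combination {z : Fin p → V} (hz : LinearIndependent ℝ z) :
    ∃ C : Matrix (Fin p) (Fin p) ℝ, IsUnit C.det ∧ (Matrix.gram ℝ z)⁻¹ = C * C.transpose ∧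
      Orthonormal ℝ fun i ↦ ∑ k, C k i • z k := by
  classical
  let U := Submodule.span ℝ (range z)
  have : FiniteDimensional ℝ U := FiniteDimensional.span_of_finite ℝ (finite_range z)
  have hfin : Module.finrank ℝ U = p := by
    simpa using finrank_span_eq_card hz
  let b : OrthonormalBasis (Fin p) ℝ U := (stdOrthonormalBasis ℝ U).reindex (finCongr hfin)
  let z' : Fin p → U := fun i ↦ ⟨z i, Submodule.subset_span (mem_range_self i)⟩
  have hg : Matrix.gram ℝ z' = Matrix.gram ℝ z := rfl
  have hB := Matrix.gram_eq_conjTranspose_mul b z'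
  set B := Matrix.of fun i j ↦ b.repr (z' j) i with hBdef
  have hdet : (Matrix.gram ℝ z).det ≠ 0 := Matrix.det_gram_ne_zero_iff_linearIndependent.2 hz
  rw [hg] at hB
  have hBu : IsUnit B.det := by
    rw [isUnit_iff_ne_zero]
    intro h
    rw [hB, Matrix.det_mul, h, mul_zero] at hdet
    exact hdet rfl
  have hCu : IsUnit (B⁻¹).det := B.isUnit_nonsing_inv_det hBu
  have hBt : B.conjTranspose = B.transpose := Matrix.conjTranspose_eq_transpose_of_trivial B
  have hone : (B⁻¹).transpose * Matrix.gram ℝ z * B⁻¹ = 1 := by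
    rw [hB, hBt, ← mul_assoc, ← Matrix.transpose_mul, Matrix.mul_nonsing_inv _ hBu,
      Matrix.transpose_one, one_mul, Matrix.mul_nonsing_inv _ hBu]
  refine ⟨B⁻¹, hCu, ?_, ?_⟩
  · apply Matrix.inv_eq_right_inv
    rw [mul_assoc] at hone
    have := mul_eq_one_comm.1 hone
    rwa [mul_assoc] at this
  · rw [← Matrix.gram_eq_one_iff_orthonormal, ← hone]
    ext i j
    exact (transpose_mul_mul_apply_eq_inner B⁻¹ (fun _ _ ↦ rfl) i j).symm

/-- The change of frame C turns the Gram matrix into 1, z into an orthonormal f and y into w. The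
left side becomes 2B - 3S - ∑⟪R f_i, f_i⟫ + (∑⟪w_i, f_i⟫)²/p with B = ∑⟪w_i, f_j⟫² and S = ∑‖w_i‖².
The symmetry hypothesis is what makes the first trace equal to B. Cauchy-Schwarz bounds the last
term by B, and B ≤ S by Bessel. If the trace vanishes, only 2B has to be absorbed by 3S; the spare S
is then forced to be zero, so w = 0 and y = 0. -/
theorem trace_inequality {z y : Fin p → V} (hp : 1 ≤ p) (hz : LinearIndependent ℝ z)
    (hsym : ∀ i j, ⟪y i, z j⟫_ℝ = ⟪z i, y j⟫_ℝ) (R : V →ₗ[ℝ] V) {κ : ℝ}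
    (hκ : ∀ f : Fin p → V, Orthonormal ℝ f → κ ≤ ∑ i, ⟪R (f i), f i⟫_ℝ)
    {N Q : Matrix (Fin p) (Fin p) ℝ} (hN : ∀ i j, N i j = ⟪y i, z j⟫_ℝ)
    (hQ : ∀ i j, Q i j = 3 * ⟪y i, y j⟫_ℝ + ⟪R (z i), z j⟫_ℝ) :
    2 * ((Matrix.gram ℝ z)⁻¹ * N * (Matrix.gram ℝ z)⁻¹ * N).trace
        - ((Matrix.gram ℝ z)⁻¹ * Q).trace + ((Matrix.gram ℝ z)⁻¹ * N).trace ^ 2 / p ≤ -κ ∧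
      (((Matrix.gram ℝ z)⁻¹ * N).trace = 0 → 0 ≤ κ →
        0 ≤ 2 * ((Matrix.gram ℝ z)⁻¹ * N * (Matrix.gram ℝ z)⁻¹ * N).trace
          - ((Matrix.gram ℝ z)⁻¹ * Q).trace → ∀ i, y i = 0) := by
  obtain ⟨C, hCu, hC, hf⟩ := exists_orthonormal_combination hz
  set f : Fin p → V := fun i ↦ ∑ k, C k i • z k with hfdef
  let w : Fin p → V := fun i ↦ ∑ k, C k i • y k
  have htr : ∀ X : Matrix (Fin p) (Fin p) ℝ,
      ((Matrix.gram ℝ z)⁻¹ * X).trace = (C.transpose * X * C).trace := by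
    intro X
    rw [hC, mul_assoc, Matrix.trace_mul_comm]
  have hNt := transpose_mul_mul_apply_eq_inner C hN
  have hQt : ∀ i, (C.transpose * Q * C) i i = 3 * ‖w i‖ ^ 2 + ⟪R (f i), f i⟫_ℝ := by
    intro i
    have e : Q = (3 : ℝ) • Matrix.of (fun i j ↦ ⟪y i, y j⟫_ℝ)
        + Matrix.of (fun i j ↦ ⟪R (z i), z j⟫_ℝ) := by
      ext i j; simp [hQ]
    rw [e, mul_add, add_mul, Matrix.mul_smul, Matrix.smul_mul, Matrix.add_apply,
      Matrix.smul_apply, transpose_mul_mul_apply_eq_inner C (a := y) (b := y)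
        (X := Matrix.of (fun i j ↦ ⟪y i, y j⟫_ℝ)) (fun _ _ ↦ rfl),
      transpose_mul_mul_apply_eq_inner C (a := fun i ↦ R (z i)) (b := z)
        (X := Matrix.of (fun i j ↦ ⟪R (z i), z j⟫_ℝ)) (fun _ _ ↦ rfl), ← real_inner_self_eq_norm_sq]
    simp [hfdef, w, map_sum]
  have hsymw : ∀ i j, ⟪w i, f j⟫_ℝ = ⟪w j, f i⟫_ℝ := by
    intro i j
    have hNs : N.transpose = N := by
      ext i j
      rw [Matrix.transpose_apply, hN, hN, hsym j i, real_inner_comm]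
    have h1 : (C.transpose * N * C).transpose = C.transpose * N * C := by
      rw [Matrix.transpose_mul, Matrix.transpose_mul, hNs, Matrix.transpose_transpose, mul_assoc]
    exact (hNt i j).symm.trans ((congrFun₂ h1.symm i j).trans (hNt j i))
  have e1 : ((Matrix.gram ℝ z)⁻¹ * N).trace = ∑ i, ⟪w i, f i⟫_ℝ := by
    rw [htr]
    simp [Matrix.trace, hNt, w, hfdef]
  have e2 : ((Matrix.gram ℝ z)⁻¹ * N * (Matrix.gram ℝ z)⁻¹ * N).trace =
      ∑ i, ∑ j, ⟪w i, f j⟫_ℝ ^ 2 := by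
    rw [mul_assoc _ N, mul_assoc _ (N * _), htr]
    have : C.transpose * (N * (Matrix.gram ℝ z)⁻¹ * N) * C =
        (C.transpose * N * C) * (C.transpose * N * C) := by
      rw [hC]; simp only [mul_assoc]
    rw [this, Matrix.trace]
    refine Finset.sum_congr rfl fun i _ ↦ ?_
    rw [Matrix.diag_apply, Matrix.mul_apply]
    refine Finset.sum_congr rfl fun j _ ↦ ?_
    rw [hNt, hNt]
    change ⟪w i, f j⟫_ℝ * ⟪w j, f i⟫_ℝ = _
    rw [hsymw j i]
    ring
  have e3 : ((Matrix.gram ℝ z)⁻¹ * Q).trace =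
      3 * ∑ i, ‖w i‖ ^ 2 + ∑ i, ⟪R (f i), f i⟫_ℝ := by
    rw [htr, Matrix.trace]
    simp [hQt, Finset.sum_add_distrib, Finset.mul_sum]
  have hbessel : ∑ i, ∑ j, ⟪w i, f j⟫_ℝ ^ 2 ≤ ∑ i, ‖w i‖ ^ 2 :=
    Finset.sum_le_sum fun i _ ↦ by
      have := hf.sum_inner_products_le (s := Finset.univ) (w i)
      simpa [real_inner_comm] using this
  have hcs : (∑ i, ⟪w i, f i⟫_ℝ) ^ 2 / p ≤ ∑ i, ∑ j, ⟪w i, f j⟫_ℝ ^ 2 := by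
    have hp' : (0 : ℝ) < p := by exact_mod_cast hp
    rw [div_le_iff₀ hp']
    have h1 := sq_sum_le_card_mul_sum_sq (s := Finset.univ) (f := fun i ↦ ⟪w i, f i⟫_ℝ)
    have h2 : ∑ i, ⟪w i, f i⟫_ℝ ^ 2 ≤ ∑ i, ∑ j, ⟪w i, f j⟫_ℝ ^ 2 :=
      Finset.sum_le_sum fun i _ ↦ Finset.single_le_sum (f := fun j ↦ ⟪w i, f j⟫_ℝ ^ 2)
        (fun j _ ↦ sq_nonneg _) (Finset.mem_univ i)
    simp only [Finset.card_univ, Fintype.card_fin] at h1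
    nlinarith
  have hk := hκ f hf
  rw [e1, e2, e3]
  refine ⟨by linarith, fun h0 hκ0 hge ↦ ?_⟩
  have hw : ∑ i, ‖w i‖ ^ 2 = 0 := by
    refine le_antisymm (by linarith) (Finset.sum_nonneg fun i _ ↦ sq_nonneg _)
  have hw0 : ∀ i, w i = 0 := fun i ↦ by
    have := (Finset.sum_eq_zero_iff_of_nonneg fun i _ ↦ sq_nonneg _).1 hw i (Finset.mem_univ i)
    simpa using this
  intro j
  have : ∑ i, C⁻¹ i j • w i = y j := by
    simp only [w, Finset.smul_sum, smul_smul]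
    rw [Finset.sum_comm]
    have : ∀ k, ∑ i, (C⁻¹ i j * C k i) • y k = (1 : Matrix (Fin p) (Fin p) ℝ) k j • y k := by
      intro k
      rw [← Finset.sum_smul, ← Matrix.mul_nonsing_inv _ hCu, Matrix.mul_apply]
      simp [mul_comm]
    simp [this, Matrix.one_apply]
  rw [← this]
  simp [hw0]

end TraceInequality

/-- A family of Euclidean spaces over an interval with a metric connection and a symmetric
curvature endomorphism. `Smooth X t` is smoothness of the section `X` at `t` within `J`. -/
structure MetricConnection (J : Set ℝ) (T : ℝ → Type*) [∀ t, NormedAddCommGroup (T t)]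
    [∀ t, InnerProductSpace ℝ (T t)] where
  /-- Smoothness of a section at a point. -/
  Smooth : (∀ t, T t) → ℝ → Prop
  /-- The covariant derivative. -/
  D : (∀ t, T t) → ∀ t, T t
  /-- The curvature endomorphism. -/
  R : ∀ t, T t →ₗ[ℝ] T t
  smooth_congr : ∀ {X Y : ∀ t, T t} {t : ℝ}, t ∈ J → Smooth X t →
    (∀ᶠ s in 𝓝[J] t, Y s = X s) → Smooth Y t
  smooth_add : ∀ {X Y : ∀ t, T t} {t : ℝ}, t ∈ J → Smooth X t → Smooth Y t →
    Smooth (fun s ↦ X s + Y s) t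
  smooth_smul : ∀ {f : ℝ → ℝ} {X : ∀ t, T t} {t : ℝ}, t ∈ J → ContDiffWithinAt ℝ ∞ f J t →
    Smooth X t → Smooth (fun s ↦ f s • X s) t
  smooth_D : ∀ {X : ∀ t, T t} {t : ℝ}, t ∈ J → Smooth X t → Smooth (D X) t
  smooth_R : ∀ {X : ∀ t, T t} {t : ℝ}, t ∈ J → Smooth X t → Smooth (fun s ↦ R s (X s)) t
  smooth_inner : ∀ {X Y : ∀ t, T t} {t : ℝ}, t ∈ J → Smooth X t → Smooth Y t →
    ContDiffWithinAt ℝ ∞ (fun s ↦ ⟪X s, Y s⟫_ℝ) J t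
  hasDerivWithinAt_inner : ∀ {X Y : ∀ t, T t} {t : ℝ}, t ∈ J → Smooth X t → Smooth Y t →
    HasDerivWithinAt (fun s ↦ ⟪X s, Y s⟫_ℝ) (⟪D X t, Y t⟫_ℝ + ⟪X t, D Y t⟫_ℝ) J t
  smooth_div : ∀ {X : ∀ t, T t} {t : ℝ}, t ∈ J → Smooth X t → X t = 0 →
    Smooth (Function.update (fun s ↦ (s - t)⁻¹ • X s) t (D X t)) t
  D_add : ∀ {X Y : ∀ t, T t} {t : ℝ}, t ∈ J → Smooth X t → Smooth Y t →
    D (fun s ↦ X s + Y s) t = D X t + D Y t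
  D_smul : ∀ (a : ℝ) {X : ∀ t, T t} {t : ℝ}, t ∈ J → Smooth X t →
    D (fun s ↦ a • X s) t = a • D X t
  R_symm : ∀ t, (R t).IsSymmetric

/-! ### Lagrange tensors and their desingularisation -/

section Lagrange

variable {J : Set ℝ} {T : ℝ → Type*} [∀ t, NormedAddCommGroup (T t)]
  [∀ t, InnerProductSpace ℝ (T t)]
  {V : Type*} [NormedAddCommGroup V] [InnerProductSpace ℝ V] [FiniteDimensional ℝ V]

/-- A Lagrange tensor for a metric connection. -/
structure MetricConnection.IsLagrange (𝒞 : MetricConnection J T) (A : ∀ t, V →L[ℝ] T t) :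
    Prop where
  smooth : ∀ u, ∀ t ∈ J, 𝒞.Smooth (fun s ↦ A s u) t
  jacobi : ∀ u, ∀ t ∈ J, 𝒞.D (𝒞.D fun s ↦ A s u) t + 𝒞.R t (A t u) = 0
  symm : ∀ u w, ∀ t ∈ J, ⟪𝒞.D (fun s ↦ A s u) t, A t w⟫_ℝ = ⟪A t u, 𝒞.D (fun s ↦ A s w) t⟫_ℝ
  nondegenerate : ∀ u, ∀ t ∈ J, A t u = 0 → 𝒞.D (fun s ↦ A s u) t = 0 → u = 0
  finrank_eq : ∀ t ∈ J, Module.finrank ℝ (T t) = Module.finrank ℝ V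

variable {𝒞 : MetricConnection J T} {A : ∀ t, V →L[ℝ] T t} {t : ℝ}

/-- The symmetry of a Lagrange tensor propagates from one point to the whole interval. -/
theorem symm_of_symm_at (hJ : J.OrdConnected)
    (hs : ∀ u, ∀ t ∈ J, 𝒞.Smooth (fun s ↦ A s u) t)
    (hj : ∀ u, ∀ t ∈ J, 𝒞.D (𝒞.D fun s ↦ A s u) t + 𝒞.R t (A t u) = 0) {r : ℝ} (hr : r ∈ J)
    (h : ∀ u w, ⟪𝒞.D (fun s ↦ A s u) r, A r w⟫_ℝ = ⟪A r u, 𝒞.D (fun s ↦ A s w) r⟫_ℝ)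
    (u w : V) (ht : t ∈ J) :
    ⟪𝒞.D (fun s ↦ A s u) t, A t w⟫_ℝ = ⟪A t u, 𝒞.D (fun s ↦ A s w) t⟫_ℝ := by
  -- The Wronskian of two Jacobi fields is constant: the terms ⟪X', Y'⟫ cancel, and so do the
  -- curvature terms because R is symmetric.
  have hd : ∀ s ∈ J, HasDerivWithinAt (fun s ↦ ⟪𝒞.D (fun s ↦ A s u) s, A s w⟫_ℝ
      - ⟪A s u, 𝒞.D (fun s ↦ A s w) s⟫_ℝ) 0 J s := by
    intro s hsJ
    refine ((𝒞.hasDerivWithinAt_inner hsJ (𝒞.smooth_D hsJ (hs u s hsJ)) (hs w s hsJ)).sub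
      (𝒞.hasDerivWithinAt_inner hsJ (hs u s hsJ) (𝒞.smooth_D hsJ (hs w s hsJ)))).congr_deriv ?_
    rw [eq_neg_of_add_eq_zero_left (hj u s hsJ), eq_neg_of_add_eq_zero_left (hj w s hsJ),
      inner_neg_left, inner_neg_right, 𝒞.R_symm s]
    ring
  have := hJ.convex.norm_image_sub_le_of_norm_hasDerivWithin_le (C := 0) hd (by simp) hr ht
  simp only [h, sub_self, sub_zero, zero_mul, norm_le_zero_iff] at this
  exact sub_eq_zero.1 this

namespace MetricConnection.IsLagrange

variable (hA : 𝒞.IsLagrange A)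
include hA

theorem D_add (ht : t ∈ J) (u w : V) :
    𝒞.D (fun s ↦ A s (u + w)) t = 𝒞.D (fun s ↦ A s u) t + 𝒞.D (fun s ↦ A s w) t := by
  simp only [map_add]
  exact 𝒞.D_add ht (hA.smooth u t ht) (hA.smooth w t ht)

theorem D_smul (ht : t ∈ J) (a : ℝ) (u : V) :
    𝒞.D (fun s ↦ A s (a • u)) t = a • 𝒞.D (fun s ↦ A s u) t := by
  simp only [map_smul]
  exact 𝒞.D_smul a ht (hA.smooth u t ht)

end MetricConnection.IsLagrange

variable (𝒞 A) in
/-- The desingularised tensor: `A` on the complement of the kernel of `A t`, `A / (s - t)` on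
the kernel, the derivative of `A` replacing the quotient at `t`. -/
noncomputable def desing (t : ℝ) (u : V) (s : ℝ) : T s :=
  A s (u - (A t).ker.starProjection u) + Function.update
    (fun s ↦ (s - t)⁻¹ • A s ((A t).ker.starProjection u)) t
    (𝒞.D (fun s ↦ A s ((A t).ker.starProjection u)) t) s

theorem desing_self (t : ℝ) (u : V) : desing 𝒞 A t u t =
    A t (u - (A t).ker.starProjection u) + 𝒞.D (fun s ↦ A s ((A t).ker.starProjection u)) t := by
  simp [desing]

theorem desing_of_ne {s : ℝ} (hst : s ≠ t) (u : V) : desing 𝒞 A t u s =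
    A s (u - (A t).ker.starProjection u + (s - t)⁻¹ • (A t).ker.starProjection u) := by
  simp [desing, Function.update_of_ne hst]

theorem apply_eq_desing {s : ℝ} (hst : s ≠ t) (u : V) : A s u =
    desing 𝒞 A t (u - (A t).ker.starProjection u + (s - t) • (A t).ker.starProjection u) s := by
  have h : (A t).ker.starProjection ((A t).ker.starProjection u) = (A t).ker.starProjection u :=
    Submodule.starProjection_eq_self_iff.2 (Submodule.starProjection_apply_mem _ u)
  rw [desing_of_ne hst]
  congr 1
  simp only [map_add, map_sub, map_smul, h, smul_add, smul_sub, smul_smul,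
    inv_mul_cancel₀ (sub_ne_zero.2 hst), one_smul]
  abel

theorem apply_starProjection_ker (t : ℝ) (u : V) : A t ((A t).ker.starProjection u) = 0 :=
  (Submodule.starProjection_apply_mem (A t).ker u)

namespace MetricConnection.IsLagrange

variable (hA : 𝒞.IsLagrange A)
include hA

theorem smooth_desing (ht : t ∈ J) (u : V) : 𝒞.Smooth (desing 𝒞 A t u) t :=
  𝒞.smooth_add ht (hA.smooth _ t ht)
    (𝒞.smooth_div ht (hA.smooth _ t ht) (apply_starProjection_ker t u))

theorem desing_add (ht : t ∈ J) (u w : V) (s : ℝ) :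
    desing 𝒞 A t (u + w) s = desing 𝒞 A t u s + desing 𝒞 A t w s := by
  by_cases hst : s = t
  · subst hst
    rw [desing_self, desing_self, desing_self, map_add (A s).ker.starProjection, hA.D_add ht]
    simp only [map_add, map_sub]
    abel
  · simp only [desing_of_ne hst, map_add, map_sub, smul_add]
    abel

theorem desing_smul (ht : t ∈ J) (a : ℝ) (u : V) (s : ℝ) :
    desing 𝒞 A t (a • u) s = a • desing 𝒞 A t u s := by
  by_cases hst : s = t
  · subst hst
    rw [desing_self, desing_self, map_smul (A s).ker.starProjection, hA.D_smul ht]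
    simp only [map_smul, map_sub, smul_add, smul_sub]
  · simp only [desing_of_ne hst, map_add, map_smul, map_sub, smul_add, smul_sub]
    rw [smul_comm a]

/-- The desingularised tensor as a linear map. -/
noncomputable def desingₗ (ht : t ∈ J) (s : ℝ) : V →ₗ[ℝ] T s where
  toFun u := desing 𝒞 A t u s
  map_add' u w := hA.desing_add ht u w s
  map_smul' a u := hA.desing_smul ht a u s

@[simp]
theorem desingₗ_apply (ht : t ∈ J) (s : ℝ) (u : V) :
    hA.desingₗ ht s u = desing 𝒞 A t u s := rfl

/-- The derivative of the Lagrange tensor maps the kernel to the complement of the image. -/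
theorem inner_D_of_mem_ker (ht : t ∈ J) {k : V} (hk : k ∈ (A t).ker) (u : V) :
    ⟪A t u, 𝒞.D (fun s ↦ A s k) t⟫_ℝ = 0 := by
  rw [← hA.symm u k t ht, show A t k = 0 from hk, inner_zero_right]

/-- The two summands, one in the image of A_t and one in A'(ker A_t), are orthogonal, so both vanish
with their sum. On the kernel non-degeneracy applies, off the kernel A_t is injective. -/
theorem desing_self_injective (ht : t ∈ J) : Function.Injective (hA.desingₗ ht t) := by
  rw [injective_iff_map_eq_zero]
  intro u hu
  rw [desingₗ_apply, desing_self] at hu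
  have hmem := Submodule.starProjection_apply_mem (A t).ker u
  have h1 := hA.inner_D_of_mem_ker ht hmem (u - (A t).ker.starProjection u)
  have h2 : A t (u - (A t).ker.starProjection u) = 0 := by
    have := congrArg (fun x ↦ ⟪A t (u - (A t).ker.starProjection u), x⟫_ℝ) hu
    simp only [inner_add_right, h1, add_zero, inner_zero_right, inner_self_eq_zero] at this
    exact this
  rw [h2, zero_add] at hu
  have h3 := hA.nondegenerate _ t ht hmem hu
  rw [h3, sub_zero] at h2
  rw [← h3, Submodule.starProjection_eq_self_iff.2 h2]

variable [∀ t, FiniteDimensional ℝ (T t)]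

theorem isInvertible_of_injective (ht : t ∈ J) (h : Function.Injective (A t)) :
    (A t).IsInvertible := by
  let e : V ≃ₗ[ℝ] T t := LinearMap.linearEquivOfInjective (A t).toLinearMap h
    (hA.finrank_eq t ht).symm
  exact ⟨e.toContinuousLinearEquiv, by ext; rfl⟩

theorem desing_self_surjective (ht : t ∈ J) : Function.Surjective (hA.desingₗ ht t) :=
  (LinearMap.injective_iff_surjective_of_finrank_eq_finrank (hA.finrank_eq t ht).symm).1
    (hA.desing_self_injective ht)

/-- Surjectivity of the desingularised tensor gives an orthogonal splitting of the whole space into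
the image of A_t and A'(ker A_t). -/
theorem exists_of_orthogonal (ht : t ∈ J) {y : T t} (hy : ∀ u, ⟪y, A t u⟫_ℝ = 0) :
    ∃ k ∈ (A t).ker, 𝒞.D (fun s ↦ A s k) t = y := by
  obtain ⟨u, rfl⟩ := hA.desing_self_surjective ht y
  have hmem := Submodule.starProjection_apply_mem (A t).ker u
  refine ⟨_, hmem, ?_⟩
  have h1 := hy (u - (A t).ker.starProjection u)
  rw [desingₗ_apply, desing_self, inner_add_left, real_inner_comm _ (𝒞.D _ t),
    hA.inner_D_of_mem_ker ht hmem, add_zero, inner_self_eq_zero] at h1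
  rw [desingₗ_apply, desing_self, h1, zero_add]

end MetricConnection.IsLagrange

end Lagrange

/-! ### Virtual Jacobi fields -/

section Virtual

variable {J : Set ℝ} {T : ℝ → Type*} [∀ t, NormedAddCommGroup (T t)]
  [∀ t, InnerProductSpace ℝ (T t)]
  {V : Type*} [NormedAddCommGroup V] [InnerProductSpace ℝ V] [FiniteDimensional ℝ V]
  {𝒞 : MetricConnection J T} {A : ∀ t, V →L[ℝ] T t} {t s : ℝ} {v w : V}

variable (𝒞 A) in
/-- The Gram matrix of the desingularised tensor. -/
noncomputable def desingGram (t s : ℝ) :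
    Matrix (Fin (Module.finrank ℝ V)) (Fin (Module.finrank ℝ V)) ℝ :=
  Matrix.gram ℝ fun i ↦ desing 𝒞 A t (stdOrthonormalBasis ℝ V i) s

variable (𝒞 A) in
/-- The vector at `s` whose inner products with the desingularised tensor are the numbers `a`. -/
noncomputable def desingDual (t s : ℝ) (a : Fin (Module.finrank ℝ V) → ℝ) : T s :=
  ∑ i, ∑ j, ((desingGram 𝒞 A t s)⁻¹ i j * a j) • desing 𝒞 A t (stdOrthonormalBasis ℝ V i) s

theorem desingGram_symm (i j : Fin (Module.finrank ℝ V)) :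
    desingGram 𝒞 A t s i j = desingGram 𝒞 A t s j i :=
  real_inner_comm _ _

theorem inner_desingDual_basis (hdet : (desingGram 𝒞 A t s).det ≠ 0)
    (a : Fin (Module.finrank ℝ V) → ℝ) (k : Fin (Module.finrank ℝ V)) :
    ⟪desingDual 𝒞 A t s a, desing 𝒞 A t (stdOrthonormalBasis ℝ V k) s⟫_ℝ = a k := by
  have h : ∀ j, ∑ i, desingGram 𝒞 A t s k i * (desingGram 𝒞 A t s)⁻¹ i j =
      (1 : Matrix _ _ ℝ) k j := fun j ↦ by
    rw [← Matrix.mul_nonsing_inv _ (isUnit_iff_ne_zero.2 hdet), Matrix.mul_apply]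
  have h' : ∀ i, ⟪desing 𝒞 A t (stdOrthonormalBasis ℝ V i) s,
      desing 𝒞 A t (stdOrthonormalBasis ℝ V k) s⟫_ℝ = desingGram 𝒞 A t s k i := fun i ↦
    desingGram_symm i k
  simp only [desingDual, sum_inner, real_inner_smul_left, h']
  rw [Finset.sum_comm]
  calc _ = ∑ j, (∑ i, desingGram 𝒞 A t s k i * (desingGram 𝒞 A t s)⁻¹ i j) * a j := by
        refine Finset.sum_congr rfl fun j _ ↦ ?_
        rw [Finset.sum_mul]
        exact Finset.sum_congr rfl fun i _ ↦ by ring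
    _ = a k := by simp [h, Matrix.one_apply]

variable (𝒞 A) in
/-- The virtual Jacobi field of `v`: the field `(A^*)⁻¹ v`, extended to the singular points. -/
noncomputable def virt (v : V) (t : ℝ) : T t :=
  desingDual 𝒞 A t t fun j ↦ ⟪v, stdOrthonormalBasis ℝ V j⟫_ℝ

theorem virt_sum_smul {ι : Type*} [Fintype ι] (a : ι → ℝ) (e : ι → V) (t : ℝ) :
    virt 𝒞 A (∑ i, a i • e i) t = ∑ i, a i • virt 𝒞 A (e i) t := by
  simp only [virt, desingDual, sum_inner, real_inner_smul_left, Finset.mul_sum, Finset.smul_sum,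
    Finset.sum_smul, smul_smul]
  calc _ = ∑ i, ∑ k, ∑ j, ((desingGram 𝒞 A t t)⁻¹ i j * (a k * ⟪e k, stdOrthonormalBasis ℝ V j⟫_ℝ))
        • desing 𝒞 A t (stdOrthonormalBasis ℝ V i) t :=
        Finset.sum_congr rfl fun i _ ↦ Finset.sum_comm
    _ = _ := by
        rw [Finset.sum_comm]
        refine Finset.sum_congr rfl fun k _ ↦ Finset.sum_congr rfl fun i _ ↦
          Finset.sum_congr rfl fun j _ ↦ ?_
        congr 1
        ring

namespace MetricConnection.IsLagrange

variable (hA : 𝒞.IsLagrange A)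
include hA

theorem smooth_zero (ht : t ∈ J) : 𝒞.Smooth (fun _ ↦ 0) t := by
  simpa using hA.smooth 0 t ht

theorem smooth_sum {ι : Type*} (S : Finset ι) {X : ι → ∀ t, T t} (ht : t ∈ J)
    (hX : ∀ i ∈ S, 𝒞.Smooth (X i) t) : 𝒞.Smooth (fun s ↦ ∑ i ∈ S, X i s) t := by
  classical
  induction S using Finset.induction_on with
  | empty => simpa using hA.smooth_zero ht
  | insert i S hi ih =>
    simp only [Finset.sum_insert hi]
    exact 𝒞.smooth_add ht (hX i (Finset.mem_insert_self i S))
      (ih fun j hj ↦ hX j (Finset.mem_insert_of_mem hj))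

theorem D_zero (ht : t ∈ J) : 𝒞.D (fun s ↦ A s 0) t = 0 := by
  simpa using hA.D_smul ht 0 0

theorem D_sum_smul {ι : Type*} (S : Finset ι) (a : ι → ℝ) {X : ι → ∀ t, T t} (ht : t ∈ J)
    (hX : ∀ i ∈ S, 𝒞.Smooth (X i) t) :
    𝒞.D (fun s ↦ ∑ i ∈ S, a i • X i s) t = ∑ i ∈ S, a i • 𝒞.D (X i) t := by
  classical
  induction S using Finset.induction_on with
  | empty => simpa using hA.D_zero ht
  | insert i S hi ih =>
    have h := fun j (hj : j ∈ S) ↦ hX j (Finset.mem_insert_of_mem hj)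
    have hi' := hX i (Finset.mem_insert_self i S)
    simp only [Finset.sum_insert hi]
    rw [𝒞.D_add ht (𝒞.smooth_smul ht contDiffWithinAt_const hi') (hA.smooth_sum S ht fun j hj ↦
      𝒞.smooth_smul ht contDiffWithinAt_const (h j hj)), 𝒞.D_smul _ ht hi', ih h]

theorem inner_desingDual (ht : t ∈ J) (hdet : (desingGram 𝒞 A t s).det ≠ 0) (v u : V) :
    ⟪desingDual 𝒞 A t s fun j ↦ ⟪v, stdOrthonormalBasis ℝ V j⟫_ℝ, desing 𝒞 A t u s⟫_ℝ =
      ⟪v, u⟫_ℝ := by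
  have hu := (stdOrthonormalBasis ℝ V).sum_repr u
  have h1 : desing 𝒞 A t u s = ∑ i, (stdOrthonormalBasis ℝ V).repr u i •
      desing 𝒞 A t (stdOrthonormalBasis ℝ V i) s := by
    conv_lhs => rw [← hu]
    exact (map_sum (hA.desingₗ ht s) _ _).trans
      (Finset.sum_congr rfl fun i _ ↦ map_smul (hA.desingₗ ht s) _ _)
  conv_rhs => rw [← hu]
  rw [h1, inner_sum, inner_sum]
  refine Finset.sum_congr rfl fun i _ ↦ ?_
  rw [real_inner_smul_right, real_inner_smul_right, inner_desingDual_basis hdet]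

theorem contDiffWithinAt_desingGram (ht : t ∈ J) (i j : Fin (Module.finrank ℝ V)) :
    ContDiffWithinAt ℝ ∞ (fun s ↦ desingGram 𝒞 A t s i j) J t :=
  𝒞.smooth_inner ht (hA.smooth_desing ht _) (hA.smooth_desing ht _)

theorem det_desingGram_ne_zero (ht : t ∈ J) : (desingGram 𝒞 A t t).det ≠ 0 := by
  refine Matrix.det_gram_ne_zero_iff_linearIndependent.2 ?_
  exact (stdOrthonormalBasis ℝ V).orthonormal.linearIndependent.map_injOn (hA.desingₗ ht t)
    (hA.desing_self_injective ht).injOn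

theorem eventually_det_desingGram_ne_zero (ht : t ∈ J) :
    ∀ᶠ s in 𝓝[J] t, (desingGram 𝒞 A t s).det ≠ 0 :=
  (contDiffWithinAt_det (hA.contDiffWithinAt_desingGram ht)).continuousWithinAt.eventually_ne
    (hA.det_desingGram_ne_zero ht)

/-- For s ≠ t the two tensors differ by the invertible rescaling of the kernel by s - t. As the
determinant is continuous at t and nonzero there, singular points are isolated. -/
theorem injective_of_det_ne_zero (ht : t ∈ J) (hst : s ≠ t)
    (hdet : (desingGram 𝒞 A t s).det ≠ 0) : Function.Injective (A s) := by
  rw [injective_iff_map_eq_zero]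
  intro u hu
  rw [apply_eq_desing (𝒞 := 𝒞) hst] at hu
  set u' := u - (A t).ker.starProjection u + (s - t) • (A t).ker.starProjection u with hu'
  have h0 : u' = 0 := by
    have := hA.inner_desingDual ht hdet u' u'
    rw [hu, inner_zero_right] at this
    exact inner_self_eq_zero.1 this.symm
  have hPP : (A t).ker.starProjection ((A t).ker.starProjection u) = (A t).ker.starProjection u :=
    Submodule.starProjection_eq_self_iff.2 (Submodule.starProjection_apply_mem _ u)
  have hP := congrArg (A t).ker.starProjection h0
  simp only [hu', map_add, map_sub, map_smul, hPP, sub_self, zero_add, map_zero,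
    smul_eq_zero, sub_ne_zero.2 hst, false_or] at hP
  rw [hu', hP] at h0
  simpa using h0

variable [∀ t, FiniteDimensional ℝ (T t)]

theorem eventually_isInvertible (ht : t ∈ J) :
    ∀ᶠ s in 𝓝[J] t, s ≠ t → (A s).IsInvertible := by
  filter_upwards [hA.eventually_det_desingGram_ne_zero ht, self_mem_nhdsWithin] with s hs hsJ hst
  exact hA.isInvertible_of_injective hsJ (hA.injective_of_det_ne_zero ht hst hs)

theorem inner_virt (ht : t ∈ J) (v u : V) : ⟪virt 𝒞 A v t, desing 𝒞 A t u t⟫_ℝ = ⟪v, u⟫_ℝ :=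
  hA.inner_desingDual ht (hA.det_desingGram_ne_zero ht) v u

theorem eq_virt (ht : t ∈ J) {z : T t} (hz : ∀ u, ⟪z, desing 𝒞 A t u t⟫_ℝ = ⟪v, u⟫_ℝ) :
    z = virt 𝒞 A v t := by
  refine ext_inner_right ℝ fun y ↦ ?_
  obtain ⟨u, rfl⟩ := hA.desing_self_surjective ht y
  rw [desingₗ_apply, hz, hA.inner_virt ht]

theorem apply_eq_desing_self (ht : t ∈ J) (u : V) :
    A t u = desing 𝒞 A t (u - (A t).ker.starProjection u) t := by
  have h : (A t).ker.starProjection ((A t).ker.starProjection u) = (A t).ker.starProjection u :=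
    Submodule.starProjection_eq_self_iff.2 (Submodule.starProjection_apply_mem _ u)
  rw [desing_self, map_sub (A t).ker.starProjection, h, sub_self, sub_zero, hA.D_zero ht, add_zero,
    map_sub, apply_starProjection_ker, sub_zero]

theorem D_eq_desing_self {k : V} (hk : k ∈ (A t).ker) :
    𝒞.D (fun s ↦ A s k) t = desing 𝒞 A t k t := by
  rw [desing_self, Submodule.starProjection_eq_self_iff.2 hk, sub_self, map_zero, zero_add]

theorem inner_virt_apply (ht : t ∈ J) (hv : v ∈ (A t).kerᗮ) (u : V) :
    ⟪virt 𝒞 A v t, A t u⟫_ℝ = ⟪v, u⟫_ℝ := by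
  rw [hA.apply_eq_desing_self ht, hA.inner_virt ht, inner_sub_right,
    Submodule.inner_left_of_mem_orthogonal (Submodule.starProjection_apply_mem _ u) hv, sub_zero]

theorem inner_virt_D (ht : t ∈ J) (hv : v ∈ (A t).kerᗮ) {k : V} (hk : k ∈ (A t).ker) :
    ⟪virt 𝒞 A v t, 𝒞.D (fun s ↦ A s k) t⟫_ℝ = 0 := by
  rw [hA.D_eq_desing_self hk, hA.inner_virt ht, Submodule.inner_left_of_mem_orthogonal hk hv]

theorem mem_orthogonal_ker_of_isInvertible (h : (A t).IsInvertible) (v : V) :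
    v ∈ (A t).kerᗮ := by
  obtain ⟨e, he⟩ := h
  have : (A t).ker = ⊥ := by
    rw [← he]
    exact LinearMap.ker_eq_bot.2 e.injective
  rw [this, Submodule.bot_orthogonal_eq_top]
  trivial

theorem adjoint_inverse_eq_virt (ht : t ∈ J) (h : (A t).IsInvertible) (v : V) :
    (ContinuousLinearMap.adjoint (A t)).inverse v = virt 𝒞 A v t := by
  have hsurj : Function.Surjective (A t) := by
    obtain ⟨e, he⟩ := h
    rw [← he]
    exact e.surjective
  have hinv : (ContinuousLinearMap.adjoint (A t)).IsInvertible := by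
    have hinj : Function.Injective (ContinuousLinearMap.adjoint (A t)) := by
      rw [injective_iff_map_eq_zero]
      intro y hy
      obtain ⟨u, rfl⟩ := hsurj y
      have := ContinuousLinearMap.adjoint_inner_left (A t) u (A t u)
      rw [hy, inner_zero_left] at this
      exact inner_self_eq_zero.1 this.symm
    let e : T t ≃ₗ[ℝ] V := LinearMap.linearEquivOfInjective
      (ContinuousLinearMap.adjoint (A t)).toLinearMap hinj (hA.finrank_eq t ht)
    exact ⟨e.toContinuousLinearEquiv, by ext; rfl⟩
  refine ext_inner_right ℝ fun y ↦ ?_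
  obtain ⟨u, rfl⟩ := hsurj y
  rw [← ContinuousLinearMap.adjoint_inner_left, hinv.self_apply_inverse,
    hA.inner_virt_apply ht (hA.mem_orthogonal_ker_of_isInvertible h v)]

theorem eventually_mem_orthogonal_ker (ht : t ∈ J) (hv : v ∈ (A t).kerᗮ) :
    ∀ᶠ s in 𝓝[J] t, v ∈ (A s).kerᗮ := by
  filter_upwards [hA.eventually_isInvertible ht] with s hs
  by_cases hst : s = t
  · rwa [hst]
  · exact hA.mem_orthogonal_ker_of_isInvertible (hs hst) v

theorem smooth_desingDual (ht : t ∈ J) (a : Fin (Module.finrank ℝ V) → ℝ) :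
    𝒞.Smooth (fun s ↦ desingDual 𝒞 A t s a) t :=
  hA.smooth_sum _ ht fun i _ ↦ hA.smooth_sum _ ht fun j _ ↦ 𝒞.smooth_smul ht
    ((contDiffWithinAt_inv_apply (hA.contDiffWithinAt_desingGram ht)
      (hA.det_desingGram_ne_zero ht) i j).mul contDiffWithinAt_const) (hA.smooth_desing ht _)

theorem eq_virt_of_isInvertible (ht : t ∈ J) (h : (A t).IsInvertible) {z : T t}
    (hz : ∀ u, ⟪z, A t u⟫_ℝ = ⟪v, u⟫_ℝ) : z = virt 𝒞 A v t := by
  refine hA.eq_virt ht fun u ↦ ?_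
  have hu : u ∈ (A t).kerᗮ := hA.mem_orthogonal_ker_of_isInvertible h u
  have h0 : (A t).ker.starProjection u = 0 :=
    (Submodule.starProjection_apply_eq_zero_iff (A t).ker).2 hu
  rw [← hz u, hA.apply_eq_desing_self ht u, h0, sub_zero]

/-- `virt` desingularises at the moving point s, whereas smoothness is visible with the base point t
fixed. The two agree near t: passing from A to the tensor desingularised at t changes only the
kernel component of u, to which v is orthogonal. -/
theorem smooth_virt (ht : t ∈ J) (hv : v ∈ (A t).kerᗮ) : 𝒞.Smooth (virt 𝒞 A v) t := by
  have h1 := hA.smooth_desingDual ht fun j ↦ ⟪v, stdOrthonormalBasis ℝ V j⟫_ℝ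
  refine 𝒞.smooth_congr ht h1 ?_
  filter_upwards [hA.eventually_det_desingGram_ne_zero ht, self_mem_nhdsWithin] with s hs hsJ
  by_cases hst : s = t
  · subst hst; rfl
  · have hinj := hA.injective_of_det_ne_zero ht hst hs
    have hinv := hA.isInvertible_of_injective hsJ hinj
    symm
    refine hA.eq_virt_of_isInvertible hsJ hinv fun u ↦ ?_
    rw [apply_eq_desing (𝒞 := 𝒞) hst, hA.inner_desingDual ht hs, inner_add_right,
      inner_sub_right, real_inner_smul_right,
      Submodule.inner_left_of_mem_orthogonal (Submodule.starProjection_apply_mem _ u) hv]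
    simp

theorem linearIndependent_virt {ι : Type*} [Finite ι] {e : ι → V} (he : LinearIndependent ℝ e)
    (ht : t ∈ J) : LinearIndependent ℝ fun i ↦ virt 𝒞 A (e i) t := by
  have := Fintype.ofFinite ι
  rw [Fintype.linearIndependent_iff] at he ⊢
  intro a ha
  rw [← virt_sum_smul] at ha
  refine he a ?_
  rw [← inner_self_eq_zero (𝕜 := ℝ), ← hA.inner_virt ht, ha, inner_zero_left]

/-- The derivative of `⟪(A^*)⁻¹ v, A u⟫ = ⟪v, u⟫`. -/
theorem inner_D_virt_apply (hJ : UniqueDiffOn ℝ J) (ht : t ∈ J) (hv : v ∈ (A t).kerᗮ) (u : V) :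
    ⟪𝒞.D (virt 𝒞 A v) t, A t u⟫_ℝ = -⟪virt 𝒞 A v t, 𝒞.D (fun s ↦ A s u) t⟫_ℝ := by
  have h1 := 𝒞.hasDerivWithinAt_inner ht (hA.smooth_virt ht hv) (hA.smooth u t ht)
  have h2 : HasDerivWithinAt (fun s ↦ ⟪virt 𝒞 A v s, A s u⟫_ℝ) 0 J t := by
    refine (hasDerivWithinAt_const t J ⟪v, u⟫_ℝ).congr_of_eventuallyEq ?_
      (hA.inner_virt_apply ht hv u)
    filter_upwards [hA.eventually_mem_orthogonal_ker ht hv, self_mem_nhdsWithin] with s hs hsJ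
    exact hA.inner_virt_apply hsJ hs u
  have := (hJ t ht).eq_deriv _ h1 h2
  linarith

/-- A virtual field at t is orthogonal to A'(ker A_t), hence lies in the image of A_t and equals A_t
x for some x. The sum of the two derivatives is orthogonal to the image by the Lagrange symmetry, so
it is A'k with k in the kernel, and x - k is the vector sought. -/
theorem exists_eq_virt (hJ : UniqueDiffOn ℝ J) (ht : t ∈ J) (hv : v ∈ (A t).kerᗮ) :
    ∃ u, A t u = virt 𝒞 A v t ∧ 𝒞.D (fun s ↦ A s u) t = -𝒞.D (virt 𝒞 A v) t := by
  obtain ⟨x, hx⟩ := hA.desing_self_surjective ht (virt 𝒞 A v t)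
  have hmem := Submodule.starProjection_apply_mem (A t).ker x
  have hA1 : A t x = virt 𝒞 A v t := by
    have h1 := hA.inner_virt_D ht hv hmem
    rw [← hx, desingₗ_apply, desing_self, inner_add_left, hA.inner_D_of_mem_ker ht hmem, zero_add,
      inner_self_eq_zero] at h1
    rw [← hx, desingₗ_apply, desing_self, h1, add_zero, map_sub, apply_starProjection_ker,
      sub_zero]
  obtain ⟨k, hk, hk'⟩ := hA.exists_of_orthogonal ht
    (y := 𝒞.D (virt 𝒞 A v) t + 𝒞.D (fun s ↦ A s x) t) fun u ↦ by
      rw [inner_add_left, hA.inner_D_virt_apply hJ ht hv, hA.symm x u t ht, hA1]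
      ring
  refine ⟨x + (-1 : ℝ) • k, ?_, ?_⟩
  · rw [map_add, map_smul, show A t k = 0 from hk, smul_zero, add_zero, hA1]
  · rw [hA.D_add ht, hA.D_smul ht, hk']
    module

theorem inner_D_virt_symm (hJ : UniqueDiffOn ℝ J) (ht : t ∈ J) (hv : v ∈ (A t).kerᗮ)
    (hw : w ∈ (A t).kerᗮ) :
    ⟪𝒞.D (virt 𝒞 A v) t, virt 𝒞 A w t⟫_ℝ = ⟪virt 𝒞 A v t, 𝒞.D (virt 𝒞 A w) t⟫_ℝ := by
  obtain ⟨u, hu, hu'⟩ := hA.exists_eq_virt hJ ht hw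
  rw [← hu, hA.inner_D_virt_apply hJ ht hv, hu', inner_neg_right, neg_neg]

/-- Differentiate ⟪z', A u⟫ = -⟪z, A' u⟫ for the vector u attached to w by `exists_eq_virt`, and
insert A'' = -RA. -/
theorem inner_D_D_virt (hJ : UniqueDiffOn ℝ J) (ht : t ∈ J) (hv : v ∈ (A t).kerᗮ)
    (hw : w ∈ (A t).kerᗮ) :
    ⟪𝒞.D (𝒞.D (virt 𝒞 A v)) t, virt 𝒞 A w t⟫_ℝ =
      2 * ⟪𝒞.D (virt 𝒞 A v) t, 𝒞.D (virt 𝒞 A w) t⟫_ℝ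
        + ⟪𝒞.R t (virt 𝒞 A v t), virt 𝒞 A w t⟫_ℝ := by
  obtain ⟨u, hu, hu'⟩ := hA.exists_eq_virt hJ ht hw
  have hs := hA.smooth_virt ht hv
  have hsu := hA.smooth u t ht
  have h1 := 𝒞.hasDerivWithinAt_inner ht (𝒞.smooth_D ht hs) hsu
  have h2 := (𝒞.hasDerivWithinAt_inner ht hs (𝒞.smooth_D ht hsu)).neg
  have h3 := h2.congr_of_eventuallyEq (f₁ := fun s ↦ ⟪𝒞.D (virt 𝒞 A v) s, A s u⟫_ℝ) (by
    filter_upwards [hA.eventually_mem_orthogonal_ker ht hv, self_mem_nhdsWithin] with s hs hsJ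
    exact hA.inner_D_virt_apply hJ hsJ hs u) (hA.inner_D_virt_apply hJ ht hv u)
  have h4 := (hJ t ht).eq_deriv _ h1 h3
  rw [eq_neg_of_add_eq_zero_left (hA.jacobi u t ht), hu', hu] at h4
  simp only [inner_neg_right] at h4
  rw [← 𝒞.R_symm t (virt 𝒞 A v t)] at h4
  linarith

end MetricConnection.IsLagrange

end Virtual

/-! ### The root of the Gram determinant and its logarithmic derivative -/

section Root

variable {J : Set ℝ} {T : ℝ → Type*} [∀ t, NormedAddCommGroup (T t)]
  [∀ t, InnerProductSpace ℝ (T t)] [∀ t, FiniteDimensional ℝ (T t)]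
  {V : Type*} [NormedAddCommGroup V] [InnerProductSpace ℝ V] [FiniteDimensional ℝ V]
  {𝒞 : MetricConnection J T} {A : ∀ t, V →L[ℝ] T t} {t s : ℝ} {v w : V} {p : ℕ} {e : Fin p → V}

variable (A e) in
/-- The function `(det M)^(-1/2p)`, meaningful at the regular points of `A`. -/
noncomputable def regularRoot (t : ℝ) : ℝ :=
  (Matrix.of fun i j ↦ ⟪(ContinuousLinearMap.adjoint (A t)).inverse (e i),
    (ContinuousLinearMap.adjoint (A t)).inverse (e j)⟫_ℝ).det ^ (-(1 / (2 * (p : ℝ))))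

open scoped Classical in
variable (J A e) in
/-- The function `(det M)^(-1/2p)`, extended by its limits to the singular points. -/
noncomputable def gramRoot (t : ℝ) : ℝ :=
  if (A t).IsInvertible then regularRoot A e t else limUnder (𝓝[J \ {t}] t) (regularRoot A e)

variable (𝒞 A e) in
/-- The Gram matrix of the virtual Jacobi fields of `e`. -/
noncomputable def virtGram (t : ℝ) : Matrix (Fin p) (Fin p) ℝ :=
  Matrix.gram ℝ fun i ↦ virt 𝒞 A (e i) t

variable (𝒞 A e) in
/-- Half the derivative of the Gram matrix of the virtual Jacobi fields of `e`. -/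
noncomputable def virtGramDeriv (t : ℝ) : Matrix (Fin p) (Fin p) ℝ :=
  Matrix.of fun i j ↦ ⟪𝒞.D (virt 𝒞 A (e i)) t, virt 𝒞 A (e j) t⟫_ℝ

variable (𝒞 A e) in
/-- The derivative of `virtGramDeriv`. -/
noncomputable def virtGramDeriv₂ (t : ℝ) : Matrix (Fin p) (Fin p) ℝ :=
  Matrix.of fun i j ↦ 3 * ⟪𝒞.D (virt 𝒞 A (e i)) t, 𝒞.D (virt 𝒞 A (e j)) t⟫_ℝ
    + ⟪𝒞.R t (virt 𝒞 A (e i) t), virt 𝒞 A (e j) t⟫_ℝ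

variable (𝒞 A e) in
/-- The logarithmic derivative of `gramRoot`. -/
noncomputable def logDerivRoot (t : ℝ) : ℝ :=
  -(1 / (p : ℝ)) * ((virtGram 𝒞 A e t)⁻¹ * virtGramDeriv 𝒞 A e t).trace

theorem neBot_nhdsWithin_diff_singleton (hJ : UniqueDiffOn ℝ J) (ht : t ∈ J) :
    (𝓝[J \ {t}] t).NeBot :=
  accPt_principal_iff_nhdsWithin.1 (uniqueDiffWithinAt_iff_accPt.1 (hJ t ht))

theorem nhdsWithin_diff_singleton_le (J : Set ℝ) (t : ℝ) : 𝓝[J \ {t}] t ≤ 𝓝[J] t :=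
  nhdsWithin_mono t sdiff_subset

namespace MetricConnection.IsLagrange

variable (hA : 𝒞.IsLagrange A)
include hA

theorem regularRoot_eq (ht : t ∈ J) (h : (A t).IsInvertible) :
    regularRoot A e t = (virtGram 𝒞 A e t).det ^ (-(1 / (2 * (p : ℝ)))) := by
  simp only [regularRoot, hA.adjoint_inverse_eq_virt ht h]
  rfl

theorem eventually_regularRoot_eq (ht : t ∈ J) : ∀ᶠ s in 𝓝[J \ {t}] t,
    regularRoot A e s = (virtGram 𝒞 A e s).det ^ (-(1 / (2 * (p : ℝ)))) := by
  filter_upwards [nhdsWithin_diff_singleton_le J t (hA.eventually_isInvertible ht),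
    self_mem_nhdsWithin] with s hs hsJ
  exact hA.regularRoot_eq hsJ.1 (hs hsJ.2)

theorem det_virtGram_pos (he : LinearIndependent ℝ e) (ht : t ∈ J) :
    0 < (virtGram 𝒞 A e t).det :=
  (Matrix.posDef_gram_iff_linearIndependent.2 (hA.linearIndependent_virt he ht)).det_pos

theorem contDiffWithinAt_virtGram (ht : t ∈ J) (hv : ∀ i, e i ∈ (A t).kerᗮ) (i j : Fin p) :
    ContDiffWithinAt ℝ ∞ (fun s ↦ virtGram 𝒞 A e s i j) J t :=
  𝒞.smooth_inner ht (hA.smooth_virt ht (hv i)) (hA.smooth_virt ht (hv j))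

theorem contDiffWithinAt_det_virtGram_rpow (he : LinearIndependent ℝ e) (ht : t ∈ J)
    (hv : ∀ i, e i ∈ (A t).kerᗮ) (q : ℝ) :
    ContDiffWithinAt ℝ ∞ (fun s ↦ (virtGram 𝒞 A e s).det ^ q) J t :=
  (contDiffWithinAt_det (hA.contDiffWithinAt_virtGram ht hv)).rpow_const_of_ne
    (hA.det_virtGram_pos he ht).ne'

/-- When the kernel is orthogonal to all e i, the extended virtual fields are smooth at t, so the
limit that defines the value at a singular point is the value of the same expression for those
fields. -/
theorem gramRoot_eq (hJ : UniqueDiffOn ℝ J) (he : LinearIndependent ℝ e) (ht : t ∈ J)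
    (hv : ∀ i, e i ∈ (A t).kerᗮ) :
    gramRoot J A e t = (virtGram 𝒞 A e t).det ^ (-(1 / (2 * (p : ℝ)))) := by
  rw [gramRoot]
  split_ifs with h
  · exact hA.regularRoot_eq ht h
  · have := neBot_nhdsWithin_diff_singleton hJ ht
    refine Tendsto.limUnder_eq ?_
    exact ((hA.contDiffWithinAt_det_virtGram_rpow he ht hv _).continuousWithinAt.mono_left
      (nhdsWithin_diff_singleton_le J t)).congr' ((hA.eventually_regularRoot_eq ht).mono
        fun s hs ↦ hs.symm)

theorem gramRoot_pos (hJ : UniqueDiffOn ℝ J) (he : LinearIndependent ℝ e) (ht : t ∈ J)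
    (hv : ∀ i, e i ∈ (A t).kerᗮ) : 0 < gramRoot J A e t := by
  rw [hA.gramRoot_eq hJ he ht hv]
  exact Real.rpow_pos_of_pos (hA.det_virtGram_pos he ht) _

theorem eventually_orthogonal_ker (ht : t ∈ J) (hv : ∀ i, e i ∈ (A t).kerᗮ) :
    ∀ᶠ s in 𝓝[J] t, ∀ i, e i ∈ (A s).kerᗮ :=
  eventually_all.2 fun i ↦ hA.eventually_mem_orthogonal_ker ht (hv i)

theorem eventually_gramRoot_eq (hJ : UniqueDiffOn ℝ J) (he : LinearIndependent ℝ e) (ht : t ∈ J)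
    (hv : ∀ i, e i ∈ (A t).kerᗮ) : ∀ᶠ s in 𝓝[J] t,
    gramRoot J A e s = (virtGram 𝒞 A e s).det ^ (-(1 / (2 * (p : ℝ)))) := by
  filter_upwards [hA.eventually_orthogonal_ker ht hv, self_mem_nhdsWithin] with s hs hsJ
  exact hA.gramRoot_eq hJ he hsJ hs

theorem contDiffWithinAt_gramRoot (hJ : UniqueDiffOn ℝ J) (he : LinearIndependent ℝ e)
    (ht : t ∈ J) (hv : ∀ i, e i ∈ (A t).kerᗮ) :
    ContDiffWithinAt ℝ ∞ (gramRoot J A e) J t :=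
  (hA.contDiffWithinAt_det_virtGram_rpow he ht hv _).congr_of_eventuallyEq
    (hA.eventually_gramRoot_eq hJ he ht hv) (hA.gramRoot_eq hJ he ht hv)

theorem hasDerivWithinAt_virtGram (hJ : UniqueDiffOn ℝ J) (ht : t ∈ J)
    (hv : ∀ i, e i ∈ (A t).kerᗮ) (i j : Fin p) :
    HasDerivWithinAt (fun s ↦ virtGram 𝒞 A e s i j)
      (((2 : ℝ) • virtGramDeriv 𝒞 A e t) i j) J t := by
  refine (𝒞.hasDerivWithinAt_inner ht (hA.smooth_virt ht (hv i))
    (hA.smooth_virt ht (hv j))).congr_deriv ?_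
  rw [← hA.inner_D_virt_symm hJ ht (hv i) (hv j)]
  simp only [virtGramDeriv, Matrix.smul_apply, Matrix.of_apply, smul_eq_mul]
  ring

theorem hasDerivWithinAt_gramRoot (hJ : UniqueDiffOn ℝ J) (he : LinearIndependent ℝ e)
    (hp : 1 ≤ p) (ht : t ∈ J) (hv : ∀ i, e i ∈ (A t).kerᗮ) :
    HasDerivWithinAt (gramRoot J A e) (gramRoot J A e t * logDerivRoot 𝒞 A e t) J t := by
  have hpos := hA.det_virtGram_pos he ht
  have hp' : (p : ℝ) ≠ 0 := by positivity
  have h := (hasDerivWithinAt_det (hA.hasDerivWithinAt_virtGram hJ ht hv) hpos.ne').rpow_const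
    (p := -(1 / (2 * (p : ℝ)))) (Or.inl hpos.ne')
  refine (h.congr_of_eventuallyEq (hA.eventually_gramRoot_eq hJ he ht hv)
    (hA.gramRoot_eq hJ he ht hv)).congr_deriv ?_
  rw [hA.gramRoot_eq hJ he ht hv, Real.rpow_sub_one hpos.ne', Matrix.mul_smul, Matrix.trace_smul,
    logDerivRoot, smul_eq_mul]
  field_simp

theorem hasDerivWithinAt_logDerivRoot (hJ : UniqueDiffOn ℝ J) (he : LinearIndependent ℝ e)
    (ht : t ∈ J) (hv : ∀ i, e i ∈ (A t).kerᗮ) :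
    HasDerivWithinAt (logDerivRoot 𝒞 A e)
      (1 / (p : ℝ) * (2 * ((virtGram 𝒞 A e t)⁻¹ * virtGramDeriv 𝒞 A e t *
        (virtGram 𝒞 A e t)⁻¹ * virtGramDeriv 𝒞 A e t).trace
        - ((virtGram 𝒞 A e t)⁻¹ * virtGramDeriv₂ 𝒞 A e t).trace)) J t := by
  have hpos := hA.det_virtGram_pos he ht
  have hM := hA.contDiffWithinAt_virtGram ht hv
  have hN : ∀ i j, HasDerivWithinAt (fun r ↦ virtGramDeriv 𝒞 A e r i j)
      (virtGramDeriv₂ 𝒞 A e t i j) J t := fun i j ↦ by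
    refine (𝒞.hasDerivWithinAt_inner ht (𝒞.smooth_D ht (hA.smooth_virt ht (hv i)))
      (hA.smooth_virt ht (hv j))).congr_deriv ?_
    rw [hA.inner_D_D_virt hJ ht (hv i) (hv j)]
    simp only [virtGramDeriv₂, Matrix.of_apply]
    ring
  have h := hasDerivWithinAt_trace_inv_mul (hA.hasDerivWithinAt_virtGram hJ ht hv)
    (fun i j ↦ (contDiffWithinAt_inv_apply hM hpos.ne' i j).differentiableWithinAt (by simp)) hN
    (hJ t ht) ((contDiffWithinAt_det hM).continuousWithinAt.eventually_ne hpos.ne') hpos.ne'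
  refine (h.const_mul (-(1 / (p : ℝ)))).congr_deriv ?_
  simp only [Matrix.mul_smul, Matrix.smul_mul, Matrix.trace_smul, smul_eq_mul]
  ring

/-- The Riccati-type inequality for the logarithmic derivative of `gramRoot`. -/
theorem logDerivRoot_inequality (hJ : UniqueDiffOn ℝ J) (he : LinearIndependent ℝ e)
    (hp : 1 ≤ p) (ht : t ∈ J) (hv : ∀ i, e i ∈ (A t).kerᗮ) :
    2 * ((virtGram 𝒞 A e t)⁻¹ * virtGramDeriv 𝒞 A e t *
        (virtGram 𝒞 A e t)⁻¹ * virtGramDeriv 𝒞 A e t).trace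
        - ((virtGram 𝒞 A e t)⁻¹ * virtGramDeriv₂ 𝒞 A e t).trace
        + ((virtGram 𝒞 A e t)⁻¹ * virtGramDeriv 𝒞 A e t).trace ^ 2 / p
      ≤ -sumSmallestEigenvalues p (𝒞.R t) ∧
    (((virtGram 𝒞 A e t)⁻¹ * virtGramDeriv 𝒞 A e t).trace = 0 →
      0 ≤ sumSmallestEigenvalues p (𝒞.R t) →
      0 ≤ 2 * ((virtGram 𝒞 A e t)⁻¹ * virtGramDeriv 𝒞 A e t *
        (virtGram 𝒞 A e t)⁻¹ * virtGramDeriv 𝒞 A e t).trace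
        - ((virtGram 𝒞 A e t)⁻¹ * virtGramDeriv₂ 𝒞 A e t).trace →
      ∀ i, 𝒞.D (virt 𝒞 A (e i)) t = 0) :=
  trace_inequality hp (hA.linearIndependent_virt he ht)
    (fun i j ↦ hA.inner_D_virt_symm hJ ht (hv i) (hv j)) (𝒞.R t)
    (fun _ hf ↦ sumSmallestEigenvalues_le (𝒞.R_symm t) hf) (fun _ _ ↦ rfl) (fun _ _ ↦ rfl)

end MetricConnection.IsLagrange

end Root

/-! ### Behaviour where W is not orthogonal to the kernel -/

section Singular

variable {J : Set ℝ} {T : ℝ → Type*} [∀ t, NormedAddCommGroup (T t)]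
  [∀ t, InnerProductSpace ℝ (T t)] [∀ t, FiniteDimensional ℝ (T t)]
  {V : Type*} [NormedAddCommGroup V] [InnerProductSpace ℝ V] [FiniteDimensional ℝ V]
  {𝒞 : MetricConnection J T} {A : ∀ t, V →L[ℝ] T t} {t s : ℝ} {v w : V} {p : ℕ} {e : Fin p → V}

variable (𝒞 A) in
/-- The smooth extension of `(s - t) • virt v s` to `s = t`. -/
noncomputable def scaledVirt (t : ℝ) (v : V) (s : ℝ) : T s :=
  (s - t) • desingDual 𝒞 A t s
      (fun j ↦ ⟪v - (A t).ker.starProjection v, stdOrthonormalBasis ℝ V j⟫_ℝ)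
    + desingDual 𝒞 A t s (fun j ↦ ⟪(A t).ker.starProjection v, stdOrthonormalBasis ℝ V j⟫_ℝ)

theorem scaledVirt_self (t : ℝ) (v : V) :
    scaledVirt 𝒞 A t v t = virt 𝒞 A ((A t).ker.starProjection v) t := by
  simp [scaledVirt, virt]

namespace MetricConnection.IsLagrange

variable (hA : 𝒞.IsLagrange A)
include hA

theorem smooth_scaledVirt (ht : t ∈ J) (v : V) : 𝒞.Smooth (scaledVirt 𝒞 A t v) t :=
  𝒞.smooth_add ht (𝒞.smooth_smul ht (contDiffWithinAt_id.sub contDiffWithinAt_const)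
    (hA.smooth_desingDual ht _)) (hA.smooth_desingDual ht _)

/-- Dividing `A` by s - t on the kernel divides the dual vector of the kernel component of v by the
same factor; multiplication by s - t clears this pole. -/
theorem eventually_scaledVirt_eq (ht : t ∈ J) (v : V) :
    ∀ᶠ s in 𝓝[J \ {t}] t, scaledVirt 𝒞 A t v s = (s - t) • virt 𝒞 A v s := by
  filter_upwards [nhdsWithin_diff_singleton_le J t (hA.eventually_det_desingGram_ne_zero ht),
    self_mem_nhdsWithin] with s hs hsJ
  have hst : s ≠ t := hsJ.2
  have hst' : s - t ≠ 0 := sub_ne_zero.2 hst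
  have hinv := hA.isInvertible_of_injective hsJ.1 (hA.injective_of_det_ne_zero ht hst hs)
  suffices h : (s - t)⁻¹ • scaledVirt 𝒞 A t v s = virt 𝒞 A v s by
    rw [← h, smul_inv_smul₀ hst']
  refine hA.eq_virt_of_isInvertible hsJ.1 hinv fun u ↦ ?_
  have h1 : ∀ x y : V,
      ⟪x - (A t).ker.starProjection x, (A t).ker.starProjection y⟫_ℝ = 0 := fun x y ↦
    Submodule.inner_left_of_mem_orthogonal (Submodule.starProjection_apply_mem _ y)
      (Submodule.sub_starProjection_mem_orthogonal x)
  have h2 := h1 v u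
  have h3 := h1 u v
  rw [real_inner_comm] at h3
  rw [apply_eq_desing (𝒞 := 𝒞) hst, real_inner_smul_left, scaledVirt, inner_add_left,
    real_inner_smul_left, hA.inner_desingDual ht hs, hA.inner_desingDual ht hs]
  simp only [inner_add_right, inner_sub_right, inner_sub_left, real_inner_smul_right] at h2 h3 ⊢
  field_simp
  linear_combination (s - t - 1) * (s - t) * h2 + (1 - (s - t)) * h3

theorem eventually_norm_apply_le (ht : t ∈ J) :
    ∃ C : ℝ, 0 < C ∧ ∀ᶠ s in 𝓝[J] t, ∀ v, ‖A s v‖ ≤ C * ‖v‖ := by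
  let b := stdOrthonormalBasis ℝ V
  let C : ℝ := ∑ i, (‖A t (b i)‖ + 1) + 1
  refine ⟨C, by positivity, ?_⟩
  have h1 : ∀ i, ∀ᶠ s in 𝓝[J] t, ‖A s (b i)‖ < ‖A t (b i)‖ + 1 := fun i ↦ by
    have hc := (𝒞.smooth_inner ht (hA.smooth (b i) t ht) (hA.smooth (b i) t ht)).continuousWithinAt
    have hc' : ContinuousWithinAt (fun s ↦ ‖A s (b i)‖) J t := by
      simpa [real_inner_self_eq_norm_sq, Real.sqrt_sq] using hc.sqrt
    exact hc'.eventually_lt_const (lt_add_one _)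
  filter_upwards [eventually_all.2 h1] with s hs v
  calc ‖A s v‖ = ‖∑ i, ⟪b i, v⟫_ℝ • A s (b i)‖ := by
        conv_lhs => rw [← b.sum_repr' v]
        simp only [map_sum, map_smul]
    _ ≤ ∑ i, ‖v‖ * (‖A t (b i)‖ + 1) := by
        refine (norm_sum_le _ _).trans (Finset.sum_le_sum fun i _ ↦ ?_)
        rw [norm_smul]
        refine mul_le_mul ?_ (hs i).le (norm_nonneg _) (norm_nonneg _)
        simpa [b.orthonormal.1 i] using norm_inner_le_norm (𝕜 := ℝ) (b i) v
    _ ≤ C * ‖v‖ := by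
        rw [← Finset.mul_sum, mul_comm]
        exact mul_le_mul_of_nonneg_right (by simp [C]) (norm_nonneg _)

/-- The eigenvalues of the Gram matrix stay above C⁻², where C bounds A near t: ‖u‖² = ⟪virt u, A u⟫
≤ C ‖virt u‖ ‖u‖. If e i has a kernel component, the i-th diagonal entry is (s - t)⁻² times a
function with positive limit. So the trace diverges, and by `trace_le_card_mul_det` the determinant
does. -/
theorem tendsto_det_virtGram_atTop (he : Orthonormal ℝ e) (ht : t ∈ J)
    (hv : ∃ i, e i ∉ (A t).kerᗮ) :
    Tendsto (fun s ↦ (virtGram 𝒞 A e s).det) (𝓝[J \ {t}] t) atTop := by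
  obtain ⟨i, hi⟩ := hv
  have hp : 0 < p := i.pos
  obtain ⟨C, hC, hbound⟩ := hA.eventually_norm_apply_le ht
  have hPi : (A t).ker.starProjection (e i) ≠ 0 := fun h ↦
    hi ((Submodule.starProjection_apply_eq_zero_iff _).1 h)
  have hX : 0 < ⟪scaledVirt 𝒞 A t (e i) t, scaledVirt 𝒞 A t (e i) t⟫_ℝ := by
    rw [real_inner_self_pos, scaledVirt_self]
    intro h
    have := hA.inner_virt ht ((A t).ker.starProjection (e i)) ((A t).ker.starProjection (e i))
    rw [h, inner_zero_left] at this
    exact hPi (inner_self_eq_zero.1 this.symm)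
  have hXc := (𝒞.smooth_inner ht (hA.smooth_scaledVirt ht (e i))
    (hA.smooth_scaledVirt ht (e i))).continuousWithinAt.mono_left
      (nhdsWithin_diff_singleton_le J t)
  have hsq : Tendsto (fun s ↦ ((s - t) ^ 2)⁻¹) (𝓝[J \ {t}] t) atTop := by
    refine tendsto_inv_nhdsGT_zero.comp (tendsto_nhdsWithin_iff.2 ⟨?_, ?_⟩)
    · have : ContinuousAt (fun s : ℝ ↦ (s - t) ^ 2) t := by fun_prop
      have h := this.tendsto.mono_left (nhdsWithin_le_nhds (s := J \ {t}))
      simpa using h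
    · filter_upwards [self_mem_nhdsWithin] with s hs
      have : s - t ≠ 0 := sub_ne_zero.2 hs.2
      exact pow_pos (abs_pos.2 this) 2 |>.trans_eq (sq_abs _)
  have htop := (hsq.atTop_mul_pos hX hXc).const_mul_atTop
    (show 0 < ((C ^ 2)⁻¹) ^ (p - 1) / p by positivity)
  refine tendsto_atTop_mono' _ ?_ htop
  filter_upwards [hA.eventually_scaledVirt_eq ht (e i),
    nhdsWithin_diff_singleton_le J t hbound,
    nhdsWithin_diff_singleton_le J t (hA.eventually_isInvertible ht), self_mem_nhdsWithin]
    with s hs hb hinv hsJ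
  have hst : s - t ≠ 0 := sub_ne_zero.2 hsJ.2
  have key := trace_le_card_mul_det (M := virtGram 𝒞 A e s) (Matrix.isHermitian_gram _ _)
    (δ := (C ^ 2)⁻¹) (by positivity) fun x ↦ by
      have h1 := Matrix.star_dotProduct_gram_mulVec (𝕜 := ℝ) (fun i ↦ virt 𝒞 A (e i) s) x x
      rw [star_trivial, ← virt_sum_smul] at h1
      rw [virtGram, h1]
      have h2 : x ⬝ᵥ x = ⟪∑ i, x i • e i, ∑ i, x i • e i⟫_ℝ := by
        rw [he.inner_sum]
        simp [dotProduct]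
      rw [h2, inv_mul_le_iff₀ (by positivity)]
      set u := ∑ i, x i • e i with hu
      rw [real_inner_self_eq_norm_sq, real_inner_self_eq_norm_sq, ← mul_pow]
      have h3 := hA.inner_virt_apply hsJ.1
        (hA.mem_orthogonal_ker_of_isInvertible (hinv hsJ.2) u) u
      rw [real_inner_self_eq_norm_sq] at h3
      have h4 := (real_inner_le_norm (virt 𝒞 A u s) (A s u)).trans
        (mul_le_mul_of_nonneg_left (hb u) (norm_nonneg _))
      rw [h3] at h4
      refine pow_le_pow_left₀ (norm_nonneg _) ?_ 2
      rcases (norm_nonneg u).eq_or_lt with h0 | h0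
      · rw [← h0]; positivity
      · nlinarith
  have htr : (virtGram 𝒞 A e s) i i ≤ (virtGram 𝒞 A e s).trace :=
    Finset.single_le_sum (f := fun j ↦ virtGram 𝒞 A e s j j)
      (fun j _ ↦ real_inner_self_nonneg) (Finset.mem_univ i)
  have hii : ((s - t) ^ 2)⁻¹ * ⟪scaledVirt 𝒞 A t (e i) s, scaledVirt 𝒞 A t (e i) s⟫_ℝ =
      (virtGram 𝒞 A e s) i i := by
    rw [hs, real_inner_smul_left, real_inner_smul_right, virtGram, Matrix.gram_apply]
    field_simp
  rw [hii, div_mul_eq_mul_div, div_le_iff₀ (by positivity)]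
  rw [Fintype.card_fin] at key
  calc _ ≤ ((C ^ 2)⁻¹) ^ (p - 1) * (virtGram 𝒞 A e s).trace := by gcongr
    _ ≤ _ := key
    _ = _ := mul_comm _ _

theorem gramRoot_eq_zero (hJ : UniqueDiffOn ℝ J) (he : Orthonormal ℝ e) (ht : t ∈ J)
    (hv : ∃ i, e i ∉ (A t).kerᗮ) : gramRoot J A e t = 0 := by
  have hp : 0 < p := hv.choose.pos
  have hninv : ¬ (A t).IsInvertible := fun h ↦
    hv.choose_spec (hA.mem_orthogonal_ker_of_isInvertible h _)
  rw [gramRoot, if_neg hninv]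
  have := neBot_nhdsWithin_diff_singleton hJ ht
  refine Tendsto.limUnder_eq ?_
  exact ((tendsto_rpow_neg_atTop (show 0 < 1 / (2 * (p : ℝ)) by positivity)).comp
    (hA.tendsto_det_virtGram_atTop he ht hv)).congr' ((hA.eventually_regularRoot_eq ht).mono
      fun s hs ↦ hs.symm)

theorem gramRoot_pos_iff (hJ : UniqueDiffOn ℝ J) (he : Orthonormal ℝ e) (ht : t ∈ J) :
    0 < gramRoot J A e t ↔ ∀ i, e i ∈ (A t).kerᗮ := by
  refine ⟨fun h ↦ ?_, hA.gramRoot_pos hJ he.linearIndependent ht⟩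
  by_contra! hv
  exact h.ne' (hA.gramRoot_eq_zero hJ he ht hv)

/-- The Gram determinant of the scaled fields equals (s - t)^(2p) det M and is bounded near t;
taking the power -1/2p leaves exactly one factor |s - t|. -/
theorem exists_mul_abs_le_gramRoot (hp : 1 ≤ p) (he : LinearIndependent ℝ e) (ht : t ∈ J) :
    ∃ c : ℝ, 0 < c ∧ ∀ᶠ s in 𝓝[J \ {t}] t, c * |s - t| ≤ gramRoot J A e s := by
  let G : ℝ → Matrix (Fin p) (Fin p) ℝ := fun s ↦
    Matrix.gram ℝ fun i ↦ scaledVirt 𝒞 A t (e i) s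
  have hG : ContinuousWithinAt (fun s ↦ (G s).det) J t :=
    (contDiffWithinAt_det fun i j ↦ 𝒞.smooth_inner ht (hA.smooth_scaledVirt ht (e i))
      (hA.smooth_scaledVirt ht (e j))).continuousWithinAt
  set B : ℝ := |(G t).det| + 1 with hB
  have hB0 : 0 < B := by positivity
  have hGB : ∀ᶠ s in 𝓝[J] t, (G s).det < B :=
    hG.eventually_lt_const ((le_abs_self _).trans_lt (lt_add_one _))
  have hp' : (p : ℝ) ≠ 0 := by positivity
  refine ⟨B ^ (-(1 / (2 * (p : ℝ)))), by positivity, ?_⟩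
  filter_upwards [nhdsWithin_diff_singleton_le J t hGB,
    eventually_all.2 fun i ↦ hA.eventually_scaledVirt_eq ht (e i),
    nhdsWithin_diff_singleton_le J t (hA.eventually_isInvertible ht), self_mem_nhdsWithin]
    with s hs hsc hinv hsJ
  have hst : s - t ≠ 0 := sub_ne_zero.2 hsJ.2
  have habs : 0 < |s - t| := abs_pos.2 hst
  have hdet : (G s).det = (|s - t| ^ 2) ^ p * (virtGram 𝒞 A e s).det := by
    have : G s = (|s - t| ^ 2) • virtGram 𝒞 A e s := by
      ext i j
      simp only [G, virtGram, Matrix.gram_apply, Matrix.smul_apply, hsc, real_inner_smul_left,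
        real_inner_smul_right, smul_eq_mul, sq_abs]
      ring
    rw [this, Matrix.det_smul, Fintype.card_fin]
  have hpos := hA.det_virtGram_pos he hsJ.1
  rw [gramRoot, if_pos (hinv hsJ.2), hA.regularRoot_eq hsJ.1 (hinv hsJ.2)]
  have h1 : (virtGram 𝒞 A e s).det ≤ B * (|s - t| ^ (2 * p))⁻¹ := by
    rw [← div_eq_mul_inv, le_div_iff₀ (by positivity), mul_comm, pow_mul, ← hdet]
    exact hs.le
  refine le_trans (le_of_eq ?_) (Real.rpow_le_rpow_of_nonpos hpos h1
    (neg_nonpos.2 (by positivity)))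
  rw [Real.mul_rpow hB0.le (by positivity), Real.rpow_neg (by positivity) , Real.inv_rpow
    (by positivity), ← Real.rpow_natCast, ← Real.rpow_mul habs.le]
  congr 1
  rw [← Real.rpow_neg habs.le]
  push_cast
  rw [mul_neg, neg_neg, mul_one_div_cancel (by positivity), Real.rpow_one]

theorem not_differentiableAt_gramRoot (hJ : UniqueDiffOn ℝ J) (he : Orthonormal ℝ e)
    (ht : t ∈ interior J) (hv : ∃ i, e i ∉ (A t).kerᗮ) :
    ¬ DifferentiableAt ℝ (gramRoot J A e) t := by
  intro hd
  have htJ := interior_subset ht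
  have hp : 1 ≤ p := hv.choose.pos
  obtain ⟨c, hc, hle⟩ := hA.exists_mul_abs_le_gramRoot hp he.linearIndependent htJ
  have hnhds : 𝓝[J \ {t}] t = 𝓝[≠] t := by
    rw [sdiff_eq, inter_comm, nhdsWithin_inter_of_mem' (nhdsWithin_le_nhds (mem_interior_iff_mem_nhds.1 ht))]
  rw [hnhds] at hle
  have h0 := hA.gramRoot_eq_zero hJ he htJ hv
  -- The value 0 at t is a minimum, so a derivative could only be 0, against the linear lower bound.
  have hmin : IsLocalMin (gramRoot J A e) t := by
    rw [eventually_nhdsWithin_iff] at hle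
    filter_upwards [hle] with s hs
    by_cases hst : s = t
    · rw [hst]
    · rw [h0]
      exact le_trans (by positivity) (hs hst)
  have hd' := hd.hasDerivAt
  rw [hmin.hasDerivAt_eq_zero hd'] at hd'
  have hlo := (hasDerivAt_iff_isLittleO.1 hd').def (half_pos hc)
  simp only [h0, smul_zero, sub_zero, Real.norm_eq_abs] at hlo
  obtain ⟨s, ⟨hs1, hs2⟩, hs3⟩ :=
    ((hle.and (nhdsWithin_le_nhds hlo)).and self_mem_nhdsWithin).exists
  have habs : 0 < |s - t| := abs_pos.2 (sub_ne_zero.2 hs3)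
  have := le_abs_self (gramRoot J A e s)
  nlinarith

end MetricConnection.IsLagrange

end Singular

/-! ### Concavity and the case of a constant function -/

section Concavity

variable {J : Set ℝ} {T : ℝ → Type*} [∀ t, NormedAddCommGroup (T t)]
  [∀ t, InnerProductSpace ℝ (T t)] [∀ t, FiniteDimensional ℝ (T t)]
  {V : Type*} [NormedAddCommGroup V] [InnerProductSpace ℝ V] [FiniteDimensional ℝ V]
  {𝒞 : MetricConnection J T} {A : ∀ t, V →L[ℝ] T t} {t s : ℝ} {v w : V} {p : ℕ} {e : Fin p → V}

namespace MetricConnection.IsLagrange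

variable (hA : 𝒞.IsLagrange A)
include hA

theorem continuousOn_gramRoot (hJ : UniqueDiffOn ℝ J) (he : Orthonormal ℝ e) {K : Set ℝ}
    (hK : K ⊆ J) (hpos : ∀ t ∈ K, 0 < gramRoot J A e t) : ContinuousOn (gramRoot J A e) K :=
  fun t ht ↦ (hA.contDiffWithinAt_gramRoot hJ he.linearIndependent (hK ht)
    ((hA.gramRoot_pos_iff hJ he (hK ht)).1 (hpos t ht))).continuousWithinAt.mono hK

theorem hasDerivAt_gramRoot (hJ : UniqueDiffOn ℝ J) (he : Orthonormal ℝ e) (hp : 1 ≤ p)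
    (ht : t ∈ interior J) (hpos : 0 < gramRoot J A e t) :
    HasDerivAt (gramRoot J A e) (gramRoot J A e t * logDerivRoot 𝒞 A e t) t := by
  have htJ := interior_subset ht
  exact (hA.hasDerivWithinAt_gramRoot hJ he.linearIndependent hp htJ
    ((hA.gramRoot_pos_iff hJ he htJ).1 hpos)).hasDerivAt (mem_interior_iff_mem_nhds.1 ht)

/-- With l the logarithmic derivative, g'' = g(l' + l²). The exponent 1/2p is the one for which l²
is 1/p times the square term tr(M⁻¹N)²/p of the trace inequality. -/
theorem exists_hasDerivAt_mul_logDerivRoot (hJ : UniqueDiffOn ℝ J) (he : Orthonormal ℝ e)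
    (hp : 1 ≤ p) (ht : t ∈ interior J) (hpos : 0 < gramRoot J A e t) :
    ∃ g'' : ℝ, HasDerivAt (fun s ↦ gramRoot J A e s * logDerivRoot 𝒞 A e s) g'' t ∧
      g'' ≤ -(gramRoot J A e t / p * sumSmallestEigenvalues p (𝒞.R t)) := by
  have htJ := interior_subset ht
  have hv := (hA.gramRoot_pos_iff hJ he htJ).1 hpos
  refine ⟨_, (hA.hasDerivAt_gramRoot hJ he hp ht hpos).mul ((hA.hasDerivWithinAt_logDerivRoot hJ
    he.linearIndependent htJ hv).hasDerivAt (mem_interior_iff_mem_nhds.1 ht)), ?_⟩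
  have h := (hA.logDerivRoot_inequality hJ he.linearIndependent hp htJ hv).1
  have hp' : (0 : ℝ) < p := by positivity
  rw [← mul_neg]
  refine le_trans (le_of_eq ?_) (mul_le_mul_of_nonneg_left h (div_pos hpos hp').le)
  rw [logDerivRoot]
  field_simp
  ring

theorem concaveOn_gramRoot (hJ : UniqueDiffOn ℝ J) (he : Orthonormal ℝ e) (hp : 1 ≤ p)
    (hR : ∀ t ∈ J, 0 ≤ sumSmallestEigenvalues p (𝒞.R t)) {K : Set ℝ} (hK : K ⊆ J)
    (hK' : K.OrdConnected) (hpos : ∀ t ∈ K, 0 < gramRoot J A e t) :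
    ConcaveOn ℝ K (gramRoot J A e) := by
  have hint : ∀ t ∈ interior K, t ∈ interior J := fun t ht ↦ interior_mono hK ht
  have h2 := fun t (ht : t ∈ interior K) ↦ hA.exists_hasDerivAt_mul_logDerivRoot hJ he hp
    (hint t ht) (hpos t (interior_subset ht))
  choose! g'' h3 h4 using h2
  refine concaveOn_of_hasDerivWithinAt2_nonpos hK'.convex (hA.continuousOn_gramRoot hJ he hK hpos)
    (fun t ht ↦ (hA.hasDerivAt_gramRoot hJ he hp (hint t ht)
      (hpos t (interior_subset ht))).hasDerivWithinAt)
    (fun t ht ↦ (h3 t ht).hasDerivWithinAt) fun t ht ↦ (h4 t ht).trans ?_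
  have := hpos t (interior_subset ht)
  have := hR t (interior_subset (hint t ht))
  exact neg_nonpos.2 (by positivity)

theorem strictConcaveOn_gramRoot (hJ : UniqueDiffOn ℝ J) (he : Orthonormal ℝ e) (hp : 1 ≤ p)
    (hR : ∀ t ∈ J, 0 < sumSmallestEigenvalues p (𝒞.R t)) {K : Set ℝ} (hK : K ⊆ J)
    (hK' : K.OrdConnected) (hpos : ∀ t ∈ K, 0 < gramRoot J A e t) :
    StrictConcaveOn ℝ K (gramRoot J A e) := by
  have hint : ∀ t ∈ interior K, t ∈ interior J := fun t ht ↦ interior_mono hK ht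
  refine strictConcaveOn_of_deriv2_neg hK'.convex (hA.continuousOn_gramRoot hJ he hK hpos)
    fun t ht ↦ ?_
  obtain ⟨g'', h3, h4⟩ := hA.exists_hasDerivAt_mul_logDerivRoot hJ he hp
    (hint t ht) (hpos t (interior_subset ht))
  have h5 : deriv (gramRoot J A e) =ᶠ[𝓝 t]
      fun s ↦ gramRoot J A e s * logDerivRoot 𝒞 A e s := by
    filter_upwards [isOpen_interior.mem_nhds ht] with s hs
    exact (hA.hasDerivAt_gramRoot hJ he hp (hint s hs) (hpos s (interior_subset hs))).deriv
  rw [Function.iterate_succ, Function.iterate_one, Function.comp_apply, h5.deriv_eq, h3.deriv]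
  refine h4.trans_lt ?_
  have := hpos t (interior_subset ht)
  have := hR t (interior_subset (hint t ht))
  exact neg_neg_of_pos (by positivity)

/-- If `gramRoot` is constant, it is positive. -/
theorem gramRoot_pos_of_const (hJ : UniqueDiffOn ℝ J) (he : Orthonormal ℝ e) {a : ℝ}
    (ha : ∀ t ∈ J, gramRoot J A e t = a) (ht : t ∈ J) : 0 < gramRoot J A e t := by
  have := neBot_nhdsWithin_diff_singleton hJ ht
  obtain ⟨s, hs, hsJ⟩ := (((hA.eventually_isInvertible ht).filter_mono
    (nhdsWithin_diff_singleton_le J t)).and self_mem_nhdsWithin).exists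
  rw [ha t ht, ← ha s hsJ.1]
  exact hA.gramRoot_pos hJ he.linearIndependent hsJ.1 fun i ↦
    hA.mem_orthogonal_ker_of_isInvertible (hs hsJ.2) _

/-- Constancy makes the logarithmic derivative and its derivative vanish, which are the two
hypotheses of the equality case of the trace inequality. -/
theorem D_virt_eq_zero_of_const (hJ : UniqueDiffOn ℝ J) (he : Orthonormal ℝ e) (hp : 1 ≤ p)
    (hR : ∀ t ∈ J, 0 ≤ sumSmallestEigenvalues p (𝒞.R t)) {a : ℝ}
    (ha : ∀ t ∈ J, gramRoot J A e t = a) (ht : t ∈ J) (i : Fin p) :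
    𝒞.D (virt 𝒞 A (e i)) t = 0 := by
  have hpos := fun t (ht : t ∈ J) ↦ hA.gramRoot_pos_of_const hJ he ha ht
  have hv := fun t (ht : t ∈ J) ↦ (hA.gramRoot_pos_iff hJ he ht).1 (hpos t ht)
  have hp' : (p : ℝ) ≠ 0 := by positivity
  have h0 : ∀ t ∈ J, logDerivRoot 𝒞 A e t = 0 := fun t ht ↦ by
    have h1 := hA.hasDerivWithinAt_gramRoot hJ he.linearIndependent hp ht (hv t ht)
    have h2 := (hasDerivWithinAt_const t J a).congr_of_mem (f₁ := gramRoot J A e) ha ht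
    exact (mul_eq_zero.1 ((hJ t ht).eq_deriv _ h1 h2)).resolve_left (hpos t ht).ne'
  have h1 := hA.hasDerivWithinAt_logDerivRoot hJ he.linearIndependent ht (hv t ht)
  have h2 := (hasDerivWithinAt_const t J (0 : ℝ)).congr_of_mem
    (f₁ := logDerivRoot 𝒞 A e) h0 ht
  have h3 := (mul_eq_zero.1 ((hJ t ht).eq_deriv _ h1 h2)).resolve_left (by simpa using hp')
  have h4 := h0 t ht
  rw [logDerivRoot] at h4
  exact (hA.logDerivRoot_inequality hJ he.linearIndependent hp ht (hv t ht)).2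
    ((mul_eq_zero.1 h4).resolve_left (by simpa using hp')) (hR t ht) h3.ge i

/-- As z is parallel, ⟪z, A' u⟫ = 0 on J; its derivative is -⟪z, R A u⟫, and A u ranges over
everything at a regular point. Continuity carries R z = 0 to the isolated singular points. -/
theorem R_virt_eq_zero (hJ : UniqueDiffOn ℝ J) (hv : ∀ t ∈ J, v ∈ (A t).kerᗮ)
    (hD : ∀ t ∈ J, 𝒞.D (virt 𝒞 A v) t = 0) (ht : t ∈ J) : 𝒞.R t (virt 𝒞 A v t) = 0 := by
  have hreg : ∀ s ∈ J, (A s).IsInvertible → 𝒞.R s (virt 𝒞 A v s) = 0 := by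
    intro s hs hinv
    refine ext_inner_right ℝ fun y ↦ ?_
    obtain ⟨u, rfl⟩ : ∃ u, A s u = y := by
      obtain ⟨f, hf⟩ := hinv
      rw [← hf]
      exact f.surjective y
    have h1 := 𝒞.hasDerivWithinAt_inner hs (hA.smooth_virt hs (hv s hs))
      (𝒞.smooth_D hs (hA.smooth u s hs))
    have h2 : HasDerivWithinAt (fun s ↦ ⟪virt 𝒞 A v s, 𝒞.D (fun s ↦ A s u) s⟫_ℝ) 0 J s := by
      refine (hasDerivWithinAt_const s J (0 : ℝ)).congr_of_mem (fun r hr ↦ ?_) hs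
      have := hA.inner_D_virt_apply hJ hr (hv r hr) u
      rw [hD r hr, inner_zero_left] at this
      linarith
    have h3 := (hJ s hs).eq_deriv _ h1 h2
    rw [hD s hs, inner_zero_left, zero_add, eq_neg_of_add_eq_zero_left (hA.jacobi u s hs),
      inner_neg_right, ← 𝒞.R_symm, neg_eq_zero] at h3
    rw [h3, inner_zero_left]
  have hX := 𝒞.smooth_R ht (hA.smooth_virt ht (hv t ht))
  have hc := (𝒞.smooth_inner ht hX hX).continuousWithinAt.mono_left
    (nhdsWithin_diff_singleton_le J t)
  have := neBot_nhdsWithin_diff_singleton hJ ht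
  have h0 : (fun s ↦ ⟪𝒞.R s (virt 𝒞 A v s), 𝒞.R s (virt 𝒞 A v s)⟫_ℝ) =ᶠ[𝓝[J \ {t}] t]
      fun _ ↦ 0 := by
    filter_upwards [nhdsWithin_diff_singleton_le J t (hA.eventually_isInvertible ht),
      self_mem_nhdsWithin] with s hs hsJ
    rw [hreg s hsJ.1 (hs hsJ.2), inner_zero_left]
  exact inner_self_eq_zero.1 (tendsto_nhds_unique (hc.congr' h0) tendsto_const_nhds)

/-- If `gramRoot` is constant, the virtual Jacobi fields are parallel Jacobi fields. -/
theorem parallel_virt_of_const (hJ : UniqueDiffOn ℝ J) (he : Orthonormal ℝ e) (hp : 1 ≤ p)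
    (hR : ∀ t ∈ J, 0 ≤ sumSmallestEigenvalues p (𝒞.R t)) {a : ℝ}
    (ha : ∀ t ∈ J, gramRoot J A e t = a) (x : Fin p → ℝ) (ht : t ∈ J) :
    𝒞.Smooth (virt 𝒞 A (∑ i, x i • e i)) t ∧ 𝒞.D (virt 𝒞 A (∑ i, x i • e i)) t = 0 ∧
      𝒞.R t (virt 𝒞 A (∑ i, x i • e i) t) = 0 := by
  have hv := fun t (ht : t ∈ J) ↦ (hA.gramRoot_pos_iff hJ he ht).1
    (hA.gramRoot_pos_of_const hJ he ha ht)
  have hv' : ∀ t ∈ J, ∑ i, x i • e i ∈ (A t).kerᗮ := fun t ht ↦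
    Submodule.sum_mem _ fun i _ ↦ Submodule.smul_mem _ _ (hv t ht i)
  have hD : ∀ t ∈ J, 𝒞.D (virt 𝒞 A (∑ i, x i • e i)) t = 0 := fun t ht ↦ by
    have h : virt 𝒞 A (∑ i, x i • e i) = fun s ↦ ∑ i, x i • virt 𝒞 A (e i) s :=
      funext fun s ↦ virt_sum_smul x e s
    rw [h, hA.D_sum_smul _ x ht fun i _ ↦ hA.smooth_virt ht (hv t ht i)]
    simp [hA.D_virt_eq_zero_of_const hJ he hp hR ha ht]
  exact ⟨hA.smooth_virt ht (hv' t ht), hD t ht, hA.R_virt_eq_zero hJ hv' hD ht⟩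

end MetricConnection.IsLagrange

end Concavity

/-! ### The normal bundle of a geodesic as a metric connection -/

section NormalBundle

variable {E : Type*} [NormedAddCommGroup E] [NormedSpace ℝ E] [FiniteDimensional ℝ E]
  {M : Type*} [TopologicalSpace M] [ChartedSpace E M] [IsManifold 𝓘(ℝ, E) ∞ M]
  {c : ℝ → M} {J : Set ℝ} {t : ℝ} {X Y : ∀ t, TangentSpace 𝓘(ℝ, E) (c t)}

theorem SmoothAlongAt.congr (hX : SmoothAlongAt c J X t) (ht : t ∈ J)
    (h : ∀ᶠ s in 𝓝[J] t, Y s = X s) : SmoothAlongAt c J Y t :=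
  ContMDiffWithinAt.congr_of_eventuallyEq hX (h.mono fun s hs ↦ by simp only [hs])
    (by simp only [h.self_of_nhdsWithin ht])

theorem SmoothAlongAt.add (hX : SmoothAlongAt c J X t) (hY : SmoothAlongAt c J Y t)
    (hc : ContMDiffWithinAt 𝓘(ℝ, ℝ) 𝓘(ℝ, E) ∞ c J t) :
    SmoothAlongAt c J (fun s ↦ X s + Y s) t := by
  have h₀ := mem_chart_source E (c t)
  rw [smoothAlongAt_iff hc h₀] at hX hY ⊢
  simpa only [map_add] using hX.add hY

theorem SmoothAlongAt.smul {f : ℝ → ℝ} (hf : ContDiffWithinAt ℝ ∞ f J t)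
    (hX : SmoothAlongAt c J X t) (hc : ContMDiffWithinAt 𝓘(ℝ, ℝ) 𝓘(ℝ, E) ∞ c J t) :
    SmoothAlongAt c J (fun s ↦ f s • X s) t := by
  have h₀ := mem_chart_source E (c t)
  rw [smoothAlongAt_iff hc h₀] at hX ⊢
  simp only [map_smul]
  exact hf.smul hX

variable [RiemannianBundle (fun x : M ↦ TangentSpace 𝓘(ℝ, E) x)]

theorem covDeriv_congr (h : ∀ s ∈ J, X s = Y s) (ht : t ∈ J) :
    covDeriv c J X t = covDeriv c J Y t := by
  rw [covDeriv, covDeriv, h t ht, derivWithin_congr (fun s hs ↦ by rw [h s hs]) (by rw [h t ht])]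

theorem covDeriv_zero (ht : t ∈ J) (h : ∀ s ∈ J, X s = 0) : covDeriv c J X t = 0 := by
  rw [covDeriv_congr (Y := fun _ ↦ 0) h ht, covDeriv]
  simp

theorem covDeriv_add (hX : SmoothAlongAt c J X t) (hY : SmoothAlongAt c J Y t)
    (hc : ContMDiffWithinAt 𝓘(ℝ, ℝ) 𝓘(ℝ, E) ∞ c J t) :
    covDeriv c J (fun s ↦ X s + Y s) t = covDeriv c J X t + covDeriv c J Y t := by
  have h₀ := mem_chart_source E (c t)
  simp only [covDeriv, map_add]
  rw [derivWithin_fun_add (hX.differentiableWithinAt hc h₀) (hY.differentiableWithinAt hc h₀)]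
  simp only [map_add]
  abel

theorem covDeriv_smul (a : ℝ) (hX : SmoothAlongAt c J X t)
    (hc : ContMDiffWithinAt 𝓘(ℝ, ℝ) 𝓘(ℝ, E) ∞ c J t) :
    covDeriv c J (fun s ↦ a • X s) t = a • covDeriv c J X t := by
  have h₀ := mem_chart_source E (c t)
  simp only [covDeriv, map_smul]
  rw [derivWithin_fun_const_smul _ (hX.differentiableWithinAt hc h₀)]
  simp only [map_smul, smul_add, map_add]

theorem coe_orthogonalProjectionOnto_normalSpace (y : TangentSpace 𝓘(ℝ, E) (c t)) :
    ((normalSpace c J t).orthogonalProjectionOnto y : TangentSpace 𝓘(ℝ, E) (c t)) =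
      y + (-(⟪velocity c J t, y⟫_ℝ / ⟪velocity (E := E) c J t, velocity c J t⟫_ℝ)) •
        velocity c J t := by
  rw [Submodule.coe_orthogonalProjectionOnto_apply, Submodule.starProjection_orthogonal_val,
    Submodule.starProjection_singleton, real_inner_self_eq_norm_sq, neg_smul, sub_eq_add_neg]
  rfl

theorem mem_normalSpace_iff {y : TangentSpace 𝓘(ℝ, E) (c t)} :
    y ∈ normalSpace c J t ↔ ⟪y, velocity c J t⟫_ℝ = 0 := by
  rw [Submodule.mem_orthogonal_singleton_iff_inner_left]

theorem inner_velocity (y : normalSpace (E := E) c J t) :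
    ⟪(y : TangentSpace 𝓘(ℝ, E) (c t)), velocity c J t⟫_ℝ = 0 :=
  mem_normalSpace_iff.1 y.2

variable [IsContMDiffRiemannianBundle 𝓘(ℝ, E) ∞ E (fun x : M ↦ TangentSpace 𝓘(ℝ, E) x)]

theorem SmoothAlongAt.normalPart (hX : SmoothAlongAt c J X t) (hc : IsGeodesicOn (E := E) c J)
    (hJ : UniqueDiffOn ℝ J) (ht : t ∈ J) : SmoothAlongAt c J
      (fun s ↦ ((normalSpace c J s).orthogonalProjectionOnto (X s) : TangentSpace 𝓘(ℝ, E) (c s)))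
      t := by
  simp only [coe_orthogonalProjectionOnto_normalSpace]
  have hv := smoothAlongAt_velocity hc.smooth hJ ht
  exact hX.add (.smul ((hv.inner hX).div (hv.inner hv)
    (inner_self_ne_zero.2 (hc.velocity_ne_zero t ht))).neg hv (hc.smooth t ht)) (hc.smooth t ht)

/-- Differentiate ⟪X, c'⟫ = 0 and use that c' is parallel. -/
theorem covDeriv_mem_normalSpace {X : ∀ t, normalSpace (E := E) c J t}
    (hX : SmoothAlongAt c J (fun s ↦ (X s : TangentSpace 𝓘(ℝ, E) (c s))) t)
    (hc : IsGeodesicOn (E := E) c J) (hJ : UniqueDiffOn ℝ J) (ht : t ∈ J) :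
    covDeriv c J (fun s ↦ (X s : TangentSpace 𝓘(ℝ, E) (c s))) t ∈ normalSpace c J t := by
  have h := hasDerivWithinAt_inner hX (smoothAlongAt_velocity hc.smooth hJ ht) (hc.smooth t ht)
    (hJ t ht)
  simp only [inner_velocity, hc.covDeriv_velocity t ht, inner_zero_right, add_zero] at h
  exact mem_normalSpace_iff.2 ((hJ t ht).eq_deriv _ h (hasDerivWithinAt_const t J 0))

theorem coe_orthogonalProjectionOnto_covDeriv {X : ∀ t, normalSpace (E := E) c J t}
    (hX : SmoothAlongAt c J (fun s ↦ (X s : TangentSpace 𝓘(ℝ, E) (c s))) t)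
    (hc : IsGeodesicOn (E := E) c J) (hJ : UniqueDiffOn ℝ J) (ht : t ∈ J) :
    ((normalSpace c J t).orthogonalProjectionOnto
      (covDeriv c J (fun s ↦ (X s : TangentSpace 𝓘(ℝ, E) (c s))) t) :
        TangentSpace 𝓘(ℝ, E) (c t)) =
      covDeriv c J (fun s ↦ (X s : TangentSpace 𝓘(ℝ, E) (c s))) t :=
  Submodule.starProjection_eq_self_iff.2 (covDeriv_mem_normalSpace hX hc hJ ht)

/-- The projection in the definition does nothing: ⟪R(w, v)v, v⟫ = ⟪R(v, v)v, w⟫ = 0. -/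
theorem coe_curvatureEndomorphism (x : M) (v : TangentSpace 𝓘(ℝ, E) x) (w : (ℝ ∙ v)ᗮ) :
    (curvatureEndomorphism x v w : TangentSpace 𝓘(ℝ, E) x) =
      curvature x (w : TangentSpace 𝓘(ℝ, E) x) v v := by
  refine Submodule.starProjection_eq_self_iff.2 ?_
  rw [Submodule.mem_orthogonal_singleton_iff_inner_left, inner_curvature_symm, curvature_self,
    inner_zero_left]

theorem isSymmetric_curvatureEndomorphism (x : M) (v : TangentSpace 𝓘(ℝ, E) x) :
    (curvatureEndomorphism x v).IsSymmetric := fun u w ↦ by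
  rw [Submodule.coe_inner, Submodule.coe_inner, coe_curvatureEndomorphism,
    coe_curvatureEndomorphism, inner_curvature_symm, real_inner_comm]

/-- The connection on the normal bundle of a geodesic. -/
noncomputable def normalConnection (hc : IsGeodesicOn (E := E) c J) (hJ : J.OrdConnected)
    (hJ' : J.Nontrivial) (hu : UniqueDiffOn ℝ J) :
    MetricConnection J (fun t ↦ normalSpace (E := E) c J t) where
  Smooth X t := SmoothAlongAt c J (fun s ↦ (X s : TangentSpace 𝓘(ℝ, E) (c s))) t
  D X t := (normalSpace c J t).orthogonalProjectionOnto
    (covDeriv c J (fun s ↦ (X s : TangentSpace 𝓘(ℝ, E) (c s))) t)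
  R t := curvatureEndomorphism (c t) (velocity c J t)
  smooth_congr ht hX h := hX.congr ht (h.mono fun s hs ↦ by rw [hs])
  smooth_add ht hX hY := hX.add hY (hc.smooth _ ht)
  smooth_smul ht hf hX := .smul hf hX (hc.smooth _ ht)
  smooth_D ht hX := (hX.covDeriv hc.smooth hu ht).normalPart hc hu ht
  smooth_R ht hX := by
    simp only [coe_curvatureEndomorphism]
    exact hX.curvature hc.smooth hu ht
  smooth_inner _ hX hY := hX.inner hY
  hasDerivWithinAt_inner ht hX hY := by
    simp only [Submodule.coe_inner, coe_orthogonalProjectionOnto_covDeriv hX hc hu ht,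
      coe_orthogonalProjectionOnto_covDeriv hY hc hu ht]
    exact hasDerivWithinAt_inner hX hY (hc.smooth _ ht) (hu _ ht)
  smooth_div {X t} ht hX h0 := by
    have h₀ := mem_chart_source E (c t)
    have h0' : (X t : TangentSpace 𝓘(ℝ, E) (c t)) = 0 := by rw [h0]; rfl
    have h1 := ContDiffWithinAt.div_sub hJ hJ' ht ((smoothAlongAt_iff (hc.smooth t ht) h₀).1 hX)
      (by rw [h0', map_zero])
    rw [smoothAlongAt_iff (hc.smooth t ht) h₀]
    refine h1.congr_of_mem (fun s _ ↦ ?_) ht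
    by_cases hst : s = t
    · subst hst
      -- Where X vanishes the Christoffel term does too, so the coordinates of the covariant
      -- derivative are the ordinary derivative, as the division lemma requires.
      rw [Function.update_self, Function.update_self,
        coe_orthogonalProjectionOnto_covDeriv hX hc hu ht,
        toCoord_covDeriv hX (hc.smooth s ht) (hu s ht) h₀, h0', map_zero, map_zero, add_zero]
    · rw [Function.update_of_ne hst, Function.update_of_ne hst, Submodule.coe_smul, map_smul]
  D_add ht hX hY := by
    simp only [Submodule.coe_add]
    rw [covDeriv_add hX hY (hc.smooth _ ht), map_add]
  D_smul a _ _ ht hX := by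
    simp only [Submodule.coe_smul]
    rw [covDeriv_smul a hX (hc.smooth _ ht), map_smul]
  R_symm t := isSymmetric_curvatureEndomorphism (c t) (velocity c J t)

theorem finrank_normalSpace (hc : IsGeodesicOn (E := E) c J) (ht : t ∈ J) :
    Module.finrank ℝ (normalSpace (E := E) c J t) + 1 = Module.finrank ℝ E := by
  have h := Submodule.finrank_add_finrank_orthogonal (ℝ ∙ velocity (E := E) c J t)
  rw [finrank_span_singleton (hc.velocity_ne_zero t ht), add_comm] at h
  exact h

theorem coe_normalConnection_D {X : ∀ t, normalSpace (E := E) c J t}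
    (hc : IsGeodesicOn (E := E) c J) (hJ : J.OrdConnected) (hJ' : J.Nontrivial)
    (hu : UniqueDiffOn ℝ J) (hX : (normalConnection hc hJ hJ' hu).Smooth X t) (ht : t ∈ J) :
    ((normalConnection hc hJ hJ' hu).D X t : TangentSpace 𝓘(ℝ, E) (c t)) =
      covDeriv c J (fun s ↦ (X s : TangentSpace 𝓘(ℝ, E) (c s))) t :=
  coe_orthogonalProjectionOnto_covDeriv hX hc hu ht

/-- Symmetry of S at a single regular point gives the symmetric pairing there, and constancy of the
Wronskian spreads it over J, singular points included. Pointwise non-degeneracy follows from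
uniqueness: a Jacobi field with vanishing initial data would vanish on all of J. -/
theorem IsLagrangeTensor.isLagrange {t₀ : ℝ} (ht₀ : t₀ ∈ J)
    {A : ∀ t, normalSpace (E := E) c J t₀ →L[ℝ] normalSpace (E := E) c J t}
    (hA : IsLagrangeTensor c J t₀ A) (hc : IsGeodesicOn (E := E) c J) (hJ : J.OrdConnected)
    (hJ' : J.Nontrivial) (hu : UniqueDiffOn ℝ J) :
    (normalConnection hc hJ hJ' hu).IsLagrange A := by
  set 𝒞 := normalConnection hc hJ hJ' hu with h𝒞
  have hs : ∀ u, ∀ t ∈ J, 𝒞.Smooth (fun s ↦ A s u) t := fun u t ht ↦ (hA.jacobi u).1 t ht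
  have hD : ∀ u, ∀ t ∈ J, (𝒞.D (fun s ↦ A s u) t : TangentSpace 𝓘(ℝ, E) (c t)) =
      covDeriv c J (fun s ↦ (A s u : TangentSpace 𝓘(ℝ, E) (c s))) t := fun u t ht ↦
    coe_normalConnection_D hc hJ hJ' hu (hs u t ht) ht
  have hj : ∀ u, ∀ t ∈ J, 𝒞.D (𝒞.D fun s ↦ A s u) t + 𝒞.R t (A t u) = 0 := fun u t ht ↦ by
    refine Subtype.ext ?_
    rw [Submodule.coe_add, coe_normalConnection_D hc hJ hJ' hu (𝒞.smooth_D ht (hs u t ht)) ht,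
      covDeriv_congr (hD u) ht]
    exact (congrArg _ (coe_curvatureEndomorphism _ _ _)).trans ((hA.jacobi u).2 t ht)
  obtain ⟨r, hr, hinv⟩ := hA.exists_regular
  refine ⟨hs, hj, fun u w t ht ↦ symm_of_symm_at hJ hs hj hr (fun u w ↦ ?_) u w ht,
    fun u t ht h0 h1 ↦ ?_, fun t ht ↦ ?_⟩
  · have := hA.symmetric r hr hinv (A r u) (A r w)
    rw [hinv.inverse_apply_self, hinv.inverse_apply_self] at this
    rw [Submodule.coe_inner, Submodule.coe_inner, hD u r hr, hD w r hr, this]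
  · by_contra hne
    obtain ⟨s, hsJ, hs0⟩ := hA.nondegenerate u hne
    refine hs0 (Subtype.ext ((hA.jacobi u).eq_zero hJ hu hc.smooth ht ?_ ?_ hsJ))
    · rw [h0]; rfl
    · rw [← hD u t ht, h1]; rfl
  · have h1 := finrank_normalSpace hc ht
    have h2 := finrank_normalSpace hc ht₀
    omega

end NormalBundle

/-! ### The theorem -/

section Main

theorem isOrtho_iff_basis {V : Type*} [NormedAddCommGroup V] [InnerProductSpace ℝ V]
    {W K : Submodule ℝ V} {ι : Type*} [Fintype ι] (e : OrthonormalBasis ι ℝ W) :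
    W ⟂ K ↔ ∀ i, (e i : V) ∈ Kᗮ := by
  refine ⟨fun h i ↦ h (e i).2, fun h v hv ↦ ?_⟩
  have : (↑(∑ i, e.repr ⟨v, hv⟩ i • e i) : V) = v := congrArg Subtype.val (e.sum_repr ⟨v, hv⟩)
  rw [← this, Submodule.coe_sum]
  exact Submodule.sum_mem _ fun i _ ↦ Submodule.smul_mem _ _ (h i)

variable {E : Type*} [NormedAddCommGroup E] [NormedSpace ℝ E] [FiniteDimensional ℝ E]
  {M : Type*} [TopologicalSpace M] [ChartedSpace E M] [IsManifold 𝓘(ℝ, E) ∞ M]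
  [RiemannianBundle (fun x : M ↦ TangentSpace 𝓘(ℝ, E) x)]

theorem gW_eq_gramRoot {c : ℝ → M} {J : Set ℝ} {t₀ : ℝ}
    (A : ∀ t, normalSpace (E := E) c J t₀ →L[ℝ] normalSpace (E := E) c J t)
    {W : Submodule ℝ (normalSpace (E := E) c J t₀)} {p : ℕ} (e : OrthonormalBasis (Fin p) ℝ W) :
    gW A e = gramRoot J A (fun i ↦ (e i : normalSpace (E := E) c J t₀)) := by
  funext t
  rfl

end Main

end VirtualJacobi

theorem theoremB {E : Type*} [NormedAddCommGroup E] [NormedSpace ℝ E] [FiniteDimensional ℝ E]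
    {M : Type*} [TopologicalSpace M] [T2Space M] [ChartedSpace E M] [IsManifold 𝓘(ℝ, E) ∞ M]
    [RiemannianBundle (fun x : M ↦ TangentSpace 𝓘(ℝ, E) x)]
    [IsContMDiffRiemannianBundle 𝓘(ℝ, E) ∞ E (fun x : M ↦ TangentSpace 𝓘(ℝ, E) x)]
    (c : ℝ → M) (J : Set ℝ) (hJ : J.OrdConnected) (hJ' : J.Nontrivial)
    (hc : IsGeodesicOn (E := E) c J) (t₀ : ℝ) (ht₀ : t₀ ∈ J)
    (A : ∀ t, normalSpace (E := E) c J t₀ →L[ℝ]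
      normalSpace (E := E) c J t)
    (hA : IsLagrangeTensor c J t₀ A)
    (p : ℕ) (hp : 1 ≤ p) (W : Submodule ℝ (normalSpace (E := E) c J t₀))
    (e : OrthonormalBasis (Fin p) ℝ W) :
    -- (a)
    ((NonnegPCurvature E M p → ∀ K ⊆ J, K.OrdConnected →
        (∀ t ∈ K, 0 < gW A e t) → ConcaveOn ℝ K (gW A e)) ∧
      (PosPCurvature E M p → ∀ K ⊆ J, K.OrdConnected →
        (∀ t ∈ K, 0 < gW A e t) → StrictConcaveOn ℝ K (gW A e))) ∧
    -- (b)
    ((∀ t ∈ J, (ContDiffWithinAt ℝ ∞ (gW A e) J t ∧ 0 < gW A e t) ↔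
        W ⟂ (A t).ker) ∧
      (∀ t ∈ interior J, ContDiffAt ℝ ∞ (gW A e) t ↔ W ⟂ (A t).ker)) ∧
    -- (c)
    (NonnegPCurvature E M p → (∃ a, ∀ t ∈ J, gW A e t = a) →
      ∀ v ∈ W, ∃ Z : ∀ t, TangentSpace 𝓘(ℝ, E) (c t),
        (∀ t ∈ J, (A t).IsInvertible → Z t = adjointInv A t v) ∧
        IsParallelOn c J Z ∧ IsJacobiFieldOn c J Z) := by
  have hu : UniqueDiffOn ℝ J := uniqueDiffOn_convex hJ.convex
    ((Convex.nontrivial_iff_nonempty_interior hJ.convex).1 hJ')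
  have hL := hA.isLagrange ht₀ hc hJ hJ' hu
  have he : Orthonormal ℝ fun i ↦ (e i : normalSpace (E := E) c J t₀) :=
    e.orthonormal.comp_linearIsometry W.subtypeₗᵢ
  rw [gW_eq_gramRoot]
  refine ⟨⟨fun hR K hK hK' hpos ↦ ?_, fun hR K hK hK' hpos ↦ ?_⟩, ⟨fun t ht ↦ ?_, fun t ht ↦ ?_⟩,
    fun hR ⟨a, ha⟩ v hv ↦ ?_⟩
  · exact hL.concaveOn_gramRoot hu he hp (fun t ht ↦ hR _ _ (hc.velocity_ne_zero t ht)) hK hK' hpos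
  · exact hL.strictConcaveOn_gramRoot hu he hp (fun t ht ↦ hR _ _ (hc.velocity_ne_zero t ht)) hK
      hK' hpos
  -- Positivity alone is equivalent to orthogonality, and orthogonality implies smoothness.
  · rw [hL.gramRoot_pos_iff hu he ht, isOrtho_iff_basis e]
    exact and_iff_right_of_imp (hL.contDiffWithinAt_gramRoot hu he.linearIndependent ht)
  · rw [isOrtho_iff_basis e]
    refine ⟨fun h ↦ ?_, fun h ↦ ?_⟩
    · by_contra! hv
      exact hL.not_differentiableAt_gramRoot hu he ht hv (h.differentiableAt (by simp))
    · exact (hL.contDiffWithinAt_gramRoot hu he.linearIndependent (interior_subset ht)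
        h).contDiffAt (mem_interior_iff_mem_nhds.1 ht)
  · have hsum : ∑ i, e.repr ⟨v, hv⟩ i • (e i : normalSpace (E := E) c J t₀) = v := by
      have := congrArg Subtype.val (e.sum_repr ⟨v, hv⟩)
      rwa [Submodule.coe_sum] at this
    have key := fun t (ht : t ∈ J) ↦ hL.parallel_virt_of_const hu he hp
      (fun t ht ↦ hR _ _ (hc.velocity_ne_zero t ht)) ha (e.repr ⟨v, hv⟩) ht
    rw [hsum] at key
    let Z : ∀ t, normalSpace (E := E) c J t := virt (normalConnection hc hJ hJ' hu) A v
    have hs : IsSmoothAlong c J fun t ↦ (Z t : TangentSpace 𝓘(ℝ, E) (c t)) :=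
      fun t ht ↦ (key t ht).1
    have hD : ∀ t ∈ J, covDeriv c J (fun t ↦ (Z t : TangentSpace 𝓘(ℝ, E) (c t))) t = 0 :=
      fun t ht ↦ by
        rw [← coe_normalConnection_D hc hJ hJ' hu (key t ht).1 ht, (key t ht).2.1]
        rfl
    refine ⟨fun t ↦ Z t, fun t ht hinv ↦ ?_, ⟨hs, hD⟩, hs, fun t ht ↦ ?_⟩
    · exact congrArg Subtype.val (hL.adjoint_inverse_eq_virt ht hinv v).symm
    -- For a parallel field the Jacobi equation reduces to R Z = 0.
    · rw [covDeriv_zero ht hD, zero_add, ← coe_curvatureEndomorphism (c t) (velocity c J t) (Z t)]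
      exact congrArg Subtype.val (key t ht).2.2
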